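/- **Setting.** Let $n_s\ge 0$, $n_x,n_z\ge 1$, let $\mathcal M$ be a finite set of landmark types, and let a landmark be a pair $(\mathbf x,m)\in\mathbb R^{n_x}\times\mathcal M$. At one update step there are given: a predicted vehicle density $f_{\mathsf p}$ on $\mathbb R^{n_s}$; a detection probability $\mathsf p_{\mathrm D}(\mathbf s,\mathbf x,m)\in[0,1]$; a measurement likelihood $g(\mathbf z|\mathbf s,\mathbf x,m)$, a probability density in $\mathbf z\in\mathbb R^{n_z}$ that for each $\mathbf z$ is bounded in $(\mathbf s,\mathbf x,m)$; an integrable clutter intensity $c\ge 0$ on $\mathbb R^{n_z}$; and a Poisson multi-Bernoulli (PMB) prior $f$ of the set $\mathcal X$ of landmarks with integrable Poisson intensity $\lambda\ge 0$ and Bernoulli components with existence probabilities $r^i\in[0,1]$ and densities $f^i$, $i=1,\dots,I$ (all functions measurable). Write $\uplus$ for the union of disjoint, possibly empty sets, and $\int F(\mathcal X)\,\delta\mathcal X=\sum_n\frac1{n!}\int F(\{x_1,\dots,x_n\})\,dx_1\cdots dx_n$ for the set integral, where $\int(\cdot)\,dx$ over landmarks means $\sum_m\int(\cdot)\,d\mathbf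 x$. Given $\mathbf s$ and $\mathcal X$, each landmark independently produces one measurement with density $g$ with probability $\mathsf p_{\mathrm D}$ and none otherwise, and the measurement set is the union of these measurements and of Poisson clutter with intensity $c$; let $g(\mathcal Z|\mathbf s,\mathcal X)$ be the corresponding set density. Let $\mathcal Z=\{\mathbf z_1,\dots,\mathbf z_J\}$ consist of $J$ distinct measurements for which $f_{\mathsf p}(\mathbf s)\int f(\mathcal X)g(\mathcal Z|\mathbf s,\mathcal X)\,\delta\mathcal X$ has a non-zero integral over $\mathbf s$, and let the vehicle posterior $f_{\mathsf u}(\mathbf s)$ be this function divided by that integral. Put $$\psi(\mathbf z,\mathbf s)=c(\mathbf z)+\sum_m\int \mathsf p_{\mathrm D}\,\lambda\, g\,d\mathbf x,\qquad q_i(\{\mathbf z\}|\mathbf s)=r^i\sum_m\int \mathsf p_{\mathrm D}f^i g\,d\mathbf x,\qquad q_i(\emptyset|\mathbf s)=r^i\sum_m\int(1-\mathsf p_{\mathrm D})f^i\,d\mathbf x+1-r^i,$$ $$\nu(\{\mathbf z\})=\sum_m\iint f_{\mathsf p}\,\mathsf p_{\mathrm D}\,\lambda\, g\,d\mathbf s\,d\mathbf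 x+c(\mathbf z),\quad \nu^i(\{\mathbf z\})=r^i\sum_m\iint f_{\mathsf p}\,\mathsf p_{\mathrm D}f^i g\,d\mathbf s\,d\mathbf x,\quad \nu^i(\emptyset)=1-r^i+r^i\sum_m\iint f_{\mathsf p}(1-\mathsf p_{\mathrm D})f^i\,d\mathbf s\,d\mathbf x,$$ with $q_i=\nu^i=0$ on sets with more than one element. An association is a family $A=(\mathcal Z^{\mathrm U},\mathcal Z^1,\dots,\mathcal Z^I)$ with $\uplus_i\mathcal Z^i\uplus\mathcal Z^{\mathrm U}=\mathcal Z$. Its weight is $W_A=\prod_{\mathbf z\in\mathcal Z^{\mathrm U}}\nu(\{\mathbf z\})\prod_i\nu^i(\mathcal Z^i)$, and $N_A$ denotes the integral over $\mathbf s$ of $f_{\mathsf p}(\mathbf s)\,q(\mathcal Z^{\mathrm U}|\mathbf s)\prod_i q(\mathcal Z^i|\mathbf s)$, where $q(\mathcal Z^{\mathrm U}|\mathbf s)$ and $q(\mathcal Z^i|\mathbf s)$ are the set integrals over $\mathcal X^{\mathrm U}$, $\mathcal X^i$ of the Poisson prior density times the likelihood (with clutter) of $\mathcal Z^{\mathrm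 U}$, respectively of the $i$-th Bernoulli prior density times the likelihood (without clutter) of $\mathcal Z^i$. Let $q(\mathbf s|A)$ be that integrand divided by $N_A$ (and $0$ if $N_A=0$). ($W_A$, $N_A$ are defined in the same way for all families of finite measurement sets.) **Claim.** 1. For all $\mathbf s$: $q(\mathcal Z^{\mathrm U}|\mathbf s)=e^{-\int\psi(\mathbf z,\mathbf s)d\mathbf z}\prod_{\mathbf z\in\mathcal Z^{\mathrm U}}\psi(\mathbf z,\mathbf s)$ and $q(\mathcal Z^i|\mathbf s)=q_i(\mathcal Z^i|\mathbf s)$. Moreover $\int f_{\mathsf p}\,\psi(\mathbf z,\cdot)\,d\mathbf s=\nu(\{\mathbf z\})$ and $\int f_{\mathsf p}\,q_i(\mathcal Z^i|\cdot)\,d\mathbf s=\nu^i(\mathcal Z^i)$. 2. $f_{\mathsf u}$ is a probability density and, for almost every $\mathbf s$, $f_{\mathsf u}(\mathbf s)=\sum_A N_A\,q(\mathbf s|A)/\sum_A N_A$. If $N_A\neq0$, then $q(\cdot|A)$ is a probability density and $W_A>0$. 3. Approximate constants. $(\mathcal Z^{\mathrm U},\mathcal Z^1,\dots,\mathcal Z^I)\mapsto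 N_A$ is a probability density (with respect to the set integral) on families of finite measurement sets. Among all densities of independent Poisson ($\mathcal Z^{\mathrm U}$) and Bernoulli ($\mathcal Z^i$) sets, $A\mapsto e^{-\int\nu(\{\mathbf z\})d\mathbf z}\,W_A$ is one, and it minimises the Kullback–Leibler divergence from the density $A\mapsto N_A$. 4. First form. The approximation of $f_{\mathsf u}$ obtained by replacing the $N_A$ by the weights $W_A$ is the mixture $$f_1(\mathbf s)=\frac1\chi\sum_{\uplus_i\mathcal Z^i\uplus\mathcal Z^{\mathrm U}=\mathcal Z}\ \prod_{\mathbf z\in\mathcal Z^{\mathrm U}}\nu(\{\mathbf z\})\prod_{i=1}^I\nu^i(\mathcal Z^i)\;q(\mathbf s|\mathcal Z^{\mathrm U},\mathcal Z^1,\dots,\mathcal Z^I),\qquad \chi=\sum_A W_A>0 .$$ It is a probability density if $N_A\ne0$ whenever $W_A\neq 0$. One has $\int|f_{\mathsf u}-f_1|\,d\mathbf s\le\sum_A\bigl|N_A/\sum_BN_B-W_A/\chi\bigr|$; and if, for some $K>0$ and $\varepsilon<1$, $|N_A-KW_A|\le\varepsilon KW_A$ for all $A$, then $\int|f_{\mathsf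 u}-f_1|\,d\mathbf s\le 2\varepsilon/(1-\varepsilon)$. 5. Global hypotheses. Let a global hypothesis be $\mathbf a=(c^1,\dots,c^I,d^1,\dots,d^J)$, $c^i\in\{0,\dots,J\}$, $d^j\in\{0,\dots,I\}$, with $c^i=j\Leftrightarrow d^j=i$ for all $i,j\geq1$; let $\mathrm U(\mathbf a)=\{j:d^j=0\}$, $\mathcal Z^{a^i}=\{\mathbf z_{c^i}\}$ if $c^i\ne0$ and $\mathcal Z^{a^i}=\emptyset$ otherwise. Then $\mathbf a\mapsto(\{\mathbf z_j\}_{j\in\mathrm U(\mathbf a)},\mathcal Z^{a^1},\dots,\mathcal Z^{a^I})$ is a bijection onto the associations with $|\mathcal Z^i|\le1$ for all $i$, the other associations have weight $0$, $\mathsf p(\mathbf a)\propto\prod_i\nu^i(\mathcal Z^{a^i})\prod_{j\in\mathrm U(\mathbf a)}\nu(\{\mathbf z_j\})$ is a probability mass function, and $f_1(\mathbf s)=\sum_{\mathbf a}\mathsf p(\mathbf a)\,q(\mathbf s|\mathbf a)$. 6. Second form. Let (a term with $\mathsf p(\mathbf a)=0$ being $0$) $$f_2(\mathbf s)=\sum_{\mathbf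 a}\mathsf p(\mathbf a)\,f_{\mathsf p}(\mathbf s)\prod_{j\in\mathrm U(\mathbf a)}\frac{\psi(\mathbf z_j,\mathbf s)}{\nu(\{\mathbf z_j\})}\prod_{i=1}^{I}\frac{q_i(\mathcal Z^{a^i}|\mathbf s)}{\nu^i(\mathcal Z^{a^i})}.$$ Then, for almost every $\mathbf s$, $f_{\mathsf u}(\mathbf s)=e^{-\int\psi(\mathbf z,\mathbf s)d\mathbf z}f_2(\mathbf s)\big/\int e^{-\int\psi(\mathbf z,\mathbf s')d\mathbf z}f_2(\mathbf s')\,d\mathbf s'$. If, for real $T$, $\delta$ and $\varepsilon<1$, $|\int\psi(\mathbf z,\mathbf s)d\mathbf z-T|\le\delta$ for almost every $\mathbf s$ with $f_{\mathsf p}(\mathbf s)\neq0$, and, for every $\mathbf a$ with corresponding association weight $W_{\mathbf a}$, the integral of $\Phi(\mathbf s|\mathbf a)=f_{\mathsf p}(\mathbf s)\prod_{j\in\mathrm U(\mathbf a)}\psi(\mathbf z_j,\mathbf s)\prod_iq_i(\mathcal Z^{a^i}|\mathbf s)$ over $\mathbf s$ differs from $W_{\mathbf a}$ by at most $\varepsilon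 W_{\mathbf a}$, then for almost every $\mathbf s$ both $f_{\mathsf u}(\mathbf s)$ and $f_1(\mathbf s)$ lie between $\frac{e^{-2\delta}}{1+\varepsilon}f_2(\mathbf s)$ and $\frac{e^{2\delta}}{1-\varepsilon}f_2(\mathbf s)$. -/

import Mathlib

open MeasureTheory
open scoped ENNReal

noncomputable section

namespace RFS

/-! ### Finite-set (random finite set) calculus -/

section SetCalculus

variable {α : Type*} [MeasurableSpace α]

/-- `f` is a probability density with respect to `μ`. -/
structure IsDensity (μ : Measure α) (f : α → ℝ) : Prop where
  measurable : Measurable f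
  nonneg : ∀ x, 0 ≤ f x
  integral_eq_one : ∫ x, f x ∂μ = 1

/-- `f` is the intensity function (with respect to `μ`) of a finite Poisson process. -/
structure IsIntensity (μ : Measure α) (f : α → ℝ) : Prop where
  measurable : Measurable f
  nonneg : ∀ x, 0 ≤ f x
  integrable : Integrable f μ

/-- The reference measure `∑ₙ (1 / n!) μⁿ` of the set integral, on finite sequences. -/
def setMeasure (μ : Measure α) : Measure (Σ n : ℕ, Fin n → α) :=
  Measure.sum fun n : ℕ =>
    ((n.factorial : ℝ≥0∞)⁻¹) • (Measure.pi fun _ : Fin n => μ).map (Sigma.mk n)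

open Classical in
/-- The finite set of the entries of a finite sequence. -/
def toSet {α : Type*} (t : Σ n : ℕ, Fin n → α) : Finset α := Finset.univ.image t.2

/-- The set integral `∫ F(X) δX = ∑ₙ (1 / n!) ∫ F({x₁, …, xₙ}) dx₁ ⋯ dxₙ`. -/
def setIntegral (μ : Measure α) (F : Finset α → ℝ) : ℝ :=
  ∫ t, F (toSet t) ∂(setMeasure μ)

open Classical in
/-- All decompositions `⊎ᵢ P i = A` of `A` into pairwise disjoint, possibly empty sets that are
labelled by `ι`. -/
def decomps {α : Type*} (ι : Type*) [Fintype ι] (A : Finset α) : Finset (ι → Finset α) :=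
  (Fintype.piFinset fun _ : ι => A.powerset).filter fun P =>
    (∀ i j, i ≠ j → Disjoint (P i) (P j)) ∧ Finset.univ.biUnion P = A

/-- Set density of the Poisson process with intensity `lam`. -/
def poisson (μ : Measure α) (lam : α → ℝ) (X : Finset α) : ℝ :=
  Real.exp (-∫ x, lam x ∂μ) * ∏ x ∈ X, lam x

/-- Set density of the Bernoulli process with existence probability `r` and density `f`. -/
def bernoulli {α : Type*} (r : ℝ) (f : α → ℝ) (X : Finset α) : ℝ :=
  if X.card = 0 then 1 - r else if X.card = 1 then r * ∏ x ∈ X, f x else 0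

/-- Set density of a Poisson multi-Bernoulli (PMB) process; the label `none` is the Poisson
part and `some i` the `i`-th Bernoulli component. -/
def pmb {I : ℕ} (μ : Measure α) (lam : α → ℝ) (r : Fin I → ℝ) (f : Fin I → α → ℝ)
    (X : Finset α) : ℝ :=
  ∑ P ∈ decomps (Option (Fin I)) X,
    poisson μ lam (P none) * ∏ i, bernoulli (r i) (f i) (P (some i))

/-- Law of a finite family of finite sets, labelled by `Option (Fin I)`, that has density `F`
with respect to the product of the reference measures of the set integral. -/
def labelledLaw {I : ℕ} (μ : Measure α) (F : (Option (Fin I) → Finset α) → ℝ) :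
    Measure (Option (Fin I) → Σ n : ℕ, Fin n → α) :=
  (Measure.pi fun _ : Option (Fin I) => setMeasure μ).withDensity
    fun ω => ENNReal.ofReal (F fun o => toSet (ω o))

/-- Density of a PMB process with the auxiliary variable that labels the component from which
an element comes: independent Poisson (`none`) and Bernoulli (`some i`) parts. -/
def labelledPMB {I : ℕ} (μ : Measure α) (lam : α → ℝ) (r : Fin I → ℝ) (f : Fin I → α → ℝ)
    (A : Option (Fin I) → Finset α) : ℝ :=
  poisson μ lam (A none) * ∏ i, bernoulli (r i) (f i) (A (some i))

end SetCalculus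

/-! ### The SLAM model -/

/-- Vehicle states, landmark locations and measurements live in Euclidean spaces. -/
abbrev Vec (n : ℕ) : Type := EuclideanSpace ℝ (Fin n)

/-- A landmark is a location together with a type. -/
abbrev Landmark (nx : ℕ) (M : Type*) : Type _ := Vec nx × M

/-- Integration over landmarks: `∫ F d(landmarks) = ∑ₘ ∫ F(x, m) dx`. -/
def landmarkMeasure (nx : ℕ) (M : Type*) [MeasurableSpace M] : Measure (Landmark nx M) :=
  (volume : Measure (Vec nx)).prod Measure.count

/-- One update step: predicted vehicle density `fp`, detection probability `pD`, single-landmark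
measurement likelihood `g s l z = g(z | s, l)`, clutter intensity `c`, and the PMB prior of the
landmark set with Poisson intensity `lam` and Bernoulli components `(r i, f i)`. -/
structure SlamModel (ns nx nz I : ℕ) (M : Type*) [MeasurableSpace M] where
  fp : Vec ns → ℝ
  pD : Vec ns → Landmark nx M → ℝ
  g : Vec ns → Landmark nx M → Vec nz → ℝ
  c : Vec nz → ℝ
  lam : Landmark nx M → ℝ
  r : Fin I → ℝ
  f : Fin I → Landmark nx M → ℝ
  fp_density : IsDensity volume fp
  pD_measurable : Measurable fun p : Vec ns × Landmark nx M => pD p.1 p.2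
  pD_mem : ∀ s l, pD s l ∈ Set.Icc (0 : ℝ) 1
  g_measurable : Measurable fun p : Vec ns × Landmark nx M × Vec nz => g p.1 p.2.1 p.2.2
  g_density : ∀ s l, IsDensity volume (g s l)
  g_bounded : ∀ z, ∃ C : ℝ, ∀ s l, g s l z ≤ C
  c_intensity : IsIntensity volume c
  lam_intensity : IsIntensity (landmarkMeasure nx M) lam
  r_mem : ∀ i, r i ∈ Set.Icc (0 : ℝ) 1
  f_density : ∀ i, IsDensity (landmarkMeasure nx M) (f i)

namespace SlamModel

variable {ns nx nz I J : ℕ} {M : Type*} [MeasurableSpace M] (𝓜 : SlamModel ns nx nz I M)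

/-! #### The exact vehicle posterior -/

/-- Density of the measurement set (empty or a singleton) produced by one landmark. -/
def single (s : Vec ns) (l : Landmark nx M) (W : Finset (Vec nz)) : ℝ :=
  if W.card = 0 then 1 - 𝓜.pD s l
  else if W.card = 1 then 𝓜.pD s l * ∏ z ∈ W, 𝓜.g s l z else 0

/-- RFS likelihood `g(Z | s, X)`: the measurement set is the disjoint union of Poisson clutter
(label `none`) and of the independent measurement sets of the landmarks in `X`. -/
def likelihood (Z : Finset (Vec nz)) (s : Vec ns) (X : Finset (Landmark nx M)) : ℝ :=
  ∑ P ∈ decomps (Option {l // l ∈ X}) Z,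
    poisson volume 𝓜.c (P none) * ∏ l : {l // l ∈ X}, 𝓜.single s l.1 (P (some l))

/-- PMB prior density of the set of landmarks. -/
def prior (X : Finset (Landmark nx M)) : ℝ :=
  pmb (landmarkMeasure nx M) 𝓜.lam 𝓜.r 𝓜.f X

/-- Unnormalised vehicle posterior `fp(s) ∫ f(X) g(Z | s, X) δX`. -/
def postUnnorm (Z : Finset (Vec nz)) (s : Vec ns) : ℝ :=
  𝓜.fp s * setIntegral (landmarkMeasure nx M) fun X => 𝓜.prior X * 𝓜.likelihood Z s X

/-- Vehicle posterior density, the landmarks being marginalised out. -/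
def posterior (Z : Finset (Vec nz)) (s : Vec ns) : ℝ :=
  𝓜.postUnnorm Z s / ∫ s', 𝓜.postUnnorm Z s'

/-! #### Posterior conditioned on an association -/

/-- Likelihood `t(W | s, X)` of a measurement set for a set of at most one landmark, without
clutter. -/
def bernLikelihood (W : Finset (Vec nz)) (s : Vec ns) (X : Finset (Landmark nx M)) : ℝ :=
  if X.card = 0 then (if W.card = 0 then 1 else 0)
  else if X.card = 1 then ∏ l ∈ X, 𝓜.single s l W else 0

/-- `q(W | s)` for measurements `W` of clutter or of undetected landmarks. -/
def qU (W : Finset (Vec nz)) (s : Vec ns) : ℝ :=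
  setIntegral (landmarkMeasure nx M) fun X =>
    poisson (landmarkMeasure nx M) 𝓜.lam X * 𝓜.likelihood W s X

/-- `q(W | s)` for the measurements `W` of the previously detected landmark `i`. -/
def qB (i : Fin I) (W : Finset (Vec nz)) (s : Vec ns) : ℝ :=
  setIntegral (landmarkMeasure nx M) fun X =>
    bernoulli (𝓜.r i) (𝓜.f i) X * 𝓜.bernLikelihood W s X

/-- `fp(s) q(Zᵁ | s) ∏ᵢ q(Zⁱ | s)` for an association `A = (Zᵁ, Z¹, …)`. -/
def condUnnorm (A : Option (Fin I) → Finset (Vec nz)) (s : Vec ns) : ℝ :=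
  𝓜.fp s * 𝓜.qU (A none) s * ∏ i, 𝓜.qB i (A (some i)) s

/-- Normalisation constant of the association `A`: the density of the labelled measurement
sets. -/
def normConst (A : Option (Fin I) → Finset (Vec nz)) : ℝ := ∫ s, 𝓜.condUnnorm A s

/-- Vehicle posterior conditioned on the association `A`. -/
def cond (A : Option (Fin I) → Finset (Vec nz)) (s : Vec ns) : ℝ :=
  𝓜.condUnnorm A s / 𝓜.normConst A

/-! #### Explicit functions and constants of the update -/

section Explicit

variable [Fintype M]

/-- `ψ(z, s)`. -/
def psi (z : Vec nz) (s : Vec ns) : ℝ :=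
  𝓜.c z + ∑ m, ∫ x, 𝓜.pD s (x, m) * 𝓜.lam (x, m) * 𝓜.g s (x, m) z

/-- `q_i({z} | s)`. -/
def qDet (i : Fin I) (z : Vec nz) (s : Vec ns) : ℝ :=
  𝓜.r i * ∑ m, ∫ x, 𝓜.pD s (x, m) * 𝓜.f i (x, m) * 𝓜.g s (x, m) z

/-- `q_i(∅ | s)`. -/
def qMis (i : Fin I) (s : Vec ns) : ℝ :=
  𝓜.r i * (∑ m, ∫ x, (1 - 𝓜.pD s (x, m)) * 𝓜.f i (x, m)) + 1 - 𝓜.r i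

/-- `q_i(W | s)`; it vanishes when `W` has more than one element. -/
def q (i : Fin I) (W : Finset (Vec nz)) (s : Vec ns) : ℝ :=
  if W.card = 0 then 𝓜.qMis i s else if W.card = 1 then ∏ z ∈ W, 𝓜.qDet i z s else 0

/-- `ν({z})`. -/
def nu (z : Vec nz) : ℝ :=
  (∑ m, ∫ x, ∫ s, 𝓜.pD s (x, m) * (𝓜.fp s * 𝓜.lam (x, m)) * 𝓜.g s (x, m) z) + 𝓜.c z

/-- `νⁱ({z})`. -/
def nuDet (i : Fin I) (z : Vec nz) : ℝ :=
  𝓜.r i * ∑ m, ∫ x, ∫ s, 𝓜.pD s (x, m) * (𝓜.fp s * 𝓜.f i (x, m)) * 𝓜.g s (x, m) z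

/-- `νⁱ(∅)`. -/
def nuMis (i : Fin I) : ℝ :=
  1 - 𝓜.r i + 𝓜.r i * ∑ m, ∫ x, ∫ s, (1 - 𝓜.pD s (x, m)) * (𝓜.fp s * 𝓜.f i (x, m))

/-- `νⁱ(W)`; it vanishes when `W` has more than one element. -/
def nuB (i : Fin I) (W : Finset (Vec nz)) : ℝ :=
  if W.card = 0 then 𝓜.nuMis i else if W.card = 1 then ∏ z ∈ W, 𝓜.nuDet i z else 0

/-- Weight `∏_{z ∈ Zᵁ} ν({z}) ∏ᵢ νⁱ(Zⁱ)` of an association. -/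
def weight (A : Option (Fin I) → Finset (Vec nz)) : ℝ :=
  (∏ z ∈ A none, 𝓜.nu z) * ∏ i, 𝓜.nuB i (A (some i))

/-- The normalised mixture
`∑_{⊎ᵢ Zⁱ ⊎ Zᵁ = Z} ∏_{z ∈ Zᵁ} ν({z}) ∏ᵢ νⁱ(Zⁱ) q(s | Zᵁ, Z¹, …)`. -/
def mixture (Z : Finset (Vec nz)) (s : Vec ns) : ℝ :=
  (∑ A ∈ decomps (Option (Fin I)) Z, 𝓜.weight A * 𝓜.cond A s) /
    ∑ A ∈ decomps (Option (Fin I)) Z, 𝓜.weight A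

/-- `Φ(s | A) = fp(s) ∏_{z ∈ Zᵁ} ψ(z, s) ∏ᵢ q_i(Zⁱ | s)`. -/
def Phi (A : Option (Fin I) → Finset (Vec nz)) (s : Vec ns) : ℝ :=
  𝓜.fp s * (∏ z ∈ A none, 𝓜.psi z s) * ∏ i, 𝓜.q i (A (some i)) s

end Explicit

end SlamModel

/-! ### Global hypotheses -/

/-- Candidate global hypotheses `a = (c, d)`: `c i = some j` associates measurement `j` to
landmark `i`, `c i = none` is a missed detection; `d j = none` means that measurement `j` does
not come from a previously detected landmark. -/
abbrev Hyp (I J : ℕ) : Type := (Fin I → Option (Fin J)) × (Fin J → Option (Fin I))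

open Classical in
/-- The valid global hypotheses: `c` and `d` describe the same association. -/
def globalHyps (I J : ℕ) : Finset (Hyp I J) :=
  Finset.univ.filter fun a => ∀ i j, a.1 i = some j ↔ a.2 j = some i

open Classical in
/-- `U(a)`: the measurements of newly detected landmarks or clutter. -/
def newMeas {I J : ℕ} (a : Hyp I J) : Finset (Fin J) :=
  Finset.univ.filter fun j => a.2 j = none

/-- The measurement set that a hypothesis `c i` associates to a landmark. -/
def measOf {J nz : ℕ} (z : Fin J → Vec nz) : Option (Fin J) → Finset (Vec nz)
  | none => ∅
  | some j => {z j}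

open Classical in
/-- The measurement set `Z = {z₁, …, z_J}`. -/
def measSet {J nz : ℕ} (z : Fin J → Vec nz) : Finset (Vec nz) := Finset.univ.image z

open Classical in
/-- The association `(Zᵁ, Z¹, …)` of the global hypothesis `a`. -/
def assoc {I J nz : ℕ} (z : Fin J → Vec nz) (a : Hyp I J) : Option (Fin I) → Finset (Vec nz)
  | none => (newMeas a).image z
  | some i => measOf z (a.1 i)

namespace SlamModel

variable {ns nx nz I J : ℕ} {M : Type*} [MeasurableSpace M] [Fintype M]
  (𝓜 : SlamModel ns nx nz I M)

/-- `∏ᵢ νⁱ(Z^{aⁱ}) ∏_{j ∈ U(a)} ν({z_j})`. -/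
def hypWeight (z : Fin J → Vec nz) (a : Hyp I J) : ℝ :=
  (∏ i, 𝓜.nuB i (measOf z (a.1 i))) * ∏ j ∈ newMeas a, 𝓜.nu (z j)

/-- Association probability `p(a)` of the global hypothesis `a`. -/
def hypProb (z : Fin J → Vec nz) (a : Hyp I J) : ℝ :=
  𝓜.hypWeight z a / ∑ b ∈ globalHyps I J, 𝓜.hypWeight z b

/-- `∑ₐ p(a) fp(s) ∏_{j ∈ U(a)} ψ(z_j, s) / ν({z_j}) ∏ᵢ q_i(Z^{aⁱ} | s) / νⁱ(Z^{aⁱ})`. -/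
def hypMixture (z : Fin J → Vec nz) (s : Vec ns) : ℝ :=
  ∑ a ∈ globalHyps I J, 𝓜.hypProb z a * 𝓜.fp s *
    (∏ j ∈ newMeas a, 𝓜.psi (z j) s / 𝓜.nu (z j)) *
    ∏ i, 𝓜.q i (measOf z (a.1 i)) s / 𝓜.nuB i (measOf z (a.1 i))

end SlamModel

end RFS

end

set_option linter.unusedSectionVars false

/-! The computation takes place in the algebra of functions of finite sets under convolution. A sum
over all decompositions of a set into labelled parts is an iterated convolution
(`sum_decomps_prod`), so the PMB prior and the likelihood are both products in this algebra. Almost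
every sequence has distinct entries, so set integrals can be evaluated on sequences. Apart from
linearity, the update needs only two rules: `∏ φ` has the set integral `exp (∫ φ)`, and `∑ l ∈ X, f
l * F (X.erase l)` has that of `F` times `∫ f`. The Poisson part is updated by adding measurements
one at a time (each is clutter or comes from exactly one landmark), and Bernoulli components are
then added one at a time. Integration over the landmarks thus carries the convolution of the prior
components to the convolution of their updates. Its value at `Z` is a sum over associations
(`postUnnorm_eq`), and every term is `exp (-∫ ψ)` times `Φ`.

Hence the posterior is a mixture with the exact constants as weights. A change of the weights costs
at most the distance of the normalised weights, as no component has mass above one. A vanishing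
product weight forces `Φ = 0` almost everywhere (`Phi_ae_zero`), which makes the zero denominators
harmless. In the second form the weight in `p(a)` cancels the denominators, so that `f₂` is `∑ Φ`
divided by the total weight, and the bounds follow because `exp (-∫ ψ)` is within `exp (±δ)` of `exp
(-T)`.

For the divergence, the labelled measurement sets are, given the vehicle state, independent Poisson
and Bernoulli sets. The logarithm of a labelled PMB density is a constant, plus a sum over the
points of the Poisson part, plus one term for each Bernoulli part. Its expectation therefore
involves only the intensity of the Poisson part and the marginal law of each Bernoulli part, and
these are `ν` and `νⁱ` (`lintegral_labelledLaw_none`, `lintegral_labelledLaw_some`). Gibbs'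
inequality, applied part by part, then gives minimality. Since divergences may be infinite, positive
and negative parts of the logarithms are kept apart (`lintegral_log_ratio_le`, `klDiv_le_klDiv`). -/

noncomputable section

namespace RFS

/-! ### Convolution algebra of set functions; sums over decompositions as products. -/

section SetFunctions

open scoped Classical

variable {α : Type*}

/-- Real functions of finite subsets of `α`, with the convolution product
`(F * G) X = ∑ F V * G (X \ V)` over the subsets `V` of `X`. -/
structure SetFn (α : Type*) where
  /-- The underlying function. -/
  toFun : Finset α → ℝ

namespace SetFn

instance : CoeFun (SetFn α) fun _ => Finset α → ℝ := ⟨toFun⟩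

@[ext]
protected theorem ext {F G : SetFn α} (h : ∀ X, F X = G X) : F = G := by
  cases F; cases G; congr; exact funext h

instance : Mul (SetFn α) := ⟨fun F G => ⟨fun X => ∑ V ∈ X.powerset, F V * G (X \ V)⟩⟩

instance : One (SetFn α) := ⟨⟨fun X => if X = ∅ then 1 else 0⟩⟩

theorem one_apply (X : Finset α) : (1 : SetFn α) X = if X = ∅ then 1 else 0 := rfl

theorem mul_apply (F G : SetFn α) (X : Finset α) :
    (F * G) X = ∑ V ∈ X.powerset, F V * G (X \ V) := rfl

protected theorem mul_comm' (F G : SetFn α) : F * G = G * F := by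
  ext X
  simp only [mul_apply]
  refine Finset.sum_nbij' (fun V => X \ V) (fun V => X \ V) ?_ ?_ ?_ ?_ ?_
  · intro V _; simp
  · intro V _; simp
  · intro V hV; simpa using hV
  · intro V hV; simpa using hV
  · intro V hV
    have : X \ (X \ V) = V := by simpa using hV
    rw [this, mul_comm]

protected theorem one_mul' (F : SetFn α) : 1 * F = F := by
  ext X
  rw [mul_apply, Finset.sum_eq_single ∅]
  · simp [one_apply]
  · intro V _ hV; simp [one_apply, hV]
  · intro h; simp at h

protected theorem mul_assoc' (F G H : SetFn α) : F * G * H = F * (G * H) := by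
  ext X
  simp only [mul_apply, Finset.sum_mul, Finset.mul_sum, Finset.sum_sigma']
  -- Both sides run over the splittings of `X` into three parts: a chain `U ⊆ V ⊆ X` corresponds to
  -- `U` together with `W = V \ U` inside `X \ U`.
  refine Finset.sum_nbij' (fun p => ⟨p.2, p.1 \ p.2⟩) (fun p => ⟨p.1 ∪ p.2, p.1⟩) ?_ ?_ ?_ ?_ ?_
  · rintro ⟨V, U⟩ h
    simp only [Finset.mem_sigma, Finset.mem_powerset] at h ⊢
    exact ⟨h.2.trans h.1, Finset.sdiff_subset_sdiff h.1 le_rfl⟩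
  · rintro ⟨U, W⟩ h
    simp only [Finset.mem_sigma, Finset.mem_powerset] at h ⊢
    exact ⟨Finset.union_subset h.1 (h.2.trans Finset.sdiff_subset), Finset.subset_union_left⟩
  · rintro ⟨V, U⟩ h
    simp only [Finset.mem_sigma, Finset.mem_powerset] at h ⊢
    simp [Finset.union_sdiff_of_subset h.2]
  · rintro ⟨U, W⟩ h
    simp only [Finset.mem_sigma, Finset.mem_powerset] at h ⊢
    have : Disjoint U W := (Finset.disjoint_sdiff.mono_right h.2)
    simp [Finset.union_sdiff_cancel_left this]
  · rintro ⟨V, U⟩ h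
    simp only [Finset.mem_sigma, Finset.mem_powerset] at h ⊢
    have : (X \ U) \ (V \ U) = X \ V := by
      ext a; have := @h.2 a; simp only [Finset.mem_sdiff]; tauto
    rw [this, mul_assoc]

instance : CommMonoid (SetFn α) where
  mul_assoc := SetFn.mul_assoc'
  mul_comm := SetFn.mul_comm'
  one_mul := SetFn.one_mul'
  mul_one F := by rw [SetFn.mul_comm', SetFn.one_mul']

/-- Convolution with a function that vanishes on sets with more than one element. -/
theorem mul_of_card_le_one {b : SetFn α} (hb : ∀ X, 1 < X.card → b X = 0) (F : SetFn α)
    (X : Finset α) : (b * F) X = b ∅ * F X + ∑ x ∈ X, b {x} * F (X.erase x) := by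
  have hsub : insert ∅ (X.image fun x => ({x} : Finset α)) ⊆ X.powerset := by
    intro V hV
    simp only [Finset.mem_insert, Finset.mem_image] at hV
    rcases hV with rfl | ⟨x, hx, rfl⟩ <;> simp [*]
  rw [mul_apply, ← Finset.sum_subset hsub, Finset.sum_insert, Finset.sum_image]
  · simp [Finset.sdiff_singleton_eq_erase]
  · intro x _ y _ h; simpa using h
  · simp
  · intro V hV hV'
    rw [hb, zero_mul]
    by_contra hc
    have : V.card = 0 ∨ V.card = 1 := by omega
    rcases this with h | h
    · rw [Finset.card_eq_zero] at h; simp [h] at hV'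
    · obtain ⟨x, rfl⟩ := Finset.card_eq_one.1 h
      simp at hV hV'; exact hV' hV

end SetFn

theorem mem_decomps {ι : Type*} [Fintype ι] {X : Finset α} {P : ι → Finset α} :
    P ∈ decomps ι X ↔ (∀ i j, i ≠ j → Disjoint (P i) (P j)) ∧ Finset.univ.biUnion P = X := by
  simp only [decomps, Finset.mem_filter, Fintype.mem_piFinset, Finset.mem_powerset,
    and_iff_right_iff_imp]
  rintro ⟨-, rfl⟩ i
  exact Finset.subset_biUnion_of_mem P (Finset.mem_univ i)

theorem mem_decomps_iff {ι : Type*} [Fintype ι] {X : Finset α} {P : ι → Finset α} :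
    P ∈ decomps ι X ↔
      (∀ i j, i ≠ j → Disjoint (P i) (P j)) ∧ ∀ x, x ∈ X ↔ ∃ i, x ∈ P i := by
  rw [mem_decomps]
  refine and_congr_right fun _ => ?_
  rw [Finset.ext_iff]
  simp only [Finset.mem_biUnion, Finset.mem_univ, true_and]
  exact forall_congr' fun _ => Iff.comm

/-- Induction on a finite label type works up to equivalence, which calls for invariance under
relabelling of the parts. -/
theorem sum_decomps_equiv {ι κ : Type*} [Fintype ι] [Fintype κ] (e : ι ≃ κ) (X : Finset α)
    (f : (ι → Finset α) → ℝ) :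
    ∑ P ∈ decomps ι X, f P = ∑ P ∈ decomps κ X, f (P ∘ e) := by
  refine Finset.sum_nbij' (fun P => P ∘ e.symm) (fun P => P ∘ e) ?_ ?_ ?_ ?_ ?_
  · intro P hP
    rw [mem_decomps_iff] at hP ⊢
    refine ⟨fun i j hij => hP.1 _ _ (by simpa using hij), fun x => (hP.2 x).trans ?_⟩
    exact (e.symm.exists_congr_right (q := fun i => x ∈ P i)).symm
  · intro P hP
    rw [mem_decomps_iff] at hP ⊢
    refine ⟨fun i j hij => hP.1 _ _ (by simpa using hij), fun x => (hP.2 x).trans ?_⟩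
    exact (e.exists_congr_right (q := fun i => x ∈ P i)).symm
  · intro P _; funext i; simp
  · intro P _; funext i; simp
  · intro P _; congr 1; funext i; simp

/-- The part labelled `none` can be any subset `V`, and the other parts then decompose `X \ V`; this
recursion matches the convolution product. -/
theorem sum_decomps_option {ι : Type*} [Fintype ι] (X : Finset α)
    (f : Finset α → (ι → Finset α) → ℝ) :
    ∑ P ∈ decomps (Option ι) X, f (P none) (fun i => P (some i)) =
      ∑ V ∈ X.powerset, ∑ P ∈ decomps ι (X \ V), f V P := by
  rw [Finset.sum_sigma']
  refine Finset.sum_nbij' (fun P => (⟨P none, fun i => P (some i)⟩ : Σ _ : Finset α, ι → Finset α))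
    (fun p o => o.elim p.1 p.2) ?_ ?_ ?_ ?_ ?_
  · intro P hP
    rw [mem_decomps_iff] at hP
    simp only [Finset.mem_sigma, Finset.mem_powerset, mem_decomps_iff]
    refine ⟨fun x hx => (hP.2 x).2 ⟨_, hx⟩, fun i j hij => hP.1 _ _ (by simpa using hij),
      fun x => ?_⟩
    rw [Finset.mem_sdiff, hP.2]
    constructor
    · rintro ⟨⟨o, ho⟩, hn⟩
      cases o with
      | none => exact absurd ho hn
      | some i => exact ⟨i, ho⟩
    · rintro ⟨i, hi⟩
      exact ⟨⟨_, hi⟩, fun h => Finset.disjoint_left.1 (hP.1 none (some i) (by simp)) h hi⟩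
  · rintro ⟨V, P⟩ h
    simp only [Finset.mem_sigma, Finset.mem_powerset, mem_decomps_iff, Finset.mem_sdiff] at h
    obtain ⟨hV, hd, hx⟩ := h
    have hVP : ∀ i, Disjoint V (P i) := fun i =>
      Finset.disjoint_right.2 fun x hxi => ((hx x).2 ⟨i, hxi⟩).2
    rw [mem_decomps_iff]
    refine ⟨?_, fun x => ?_⟩
    · rintro (_ | i) (_ | j) hij
      · exact absurd rfl hij
      · exact hVP j
      · exact (hVP i).symm
      · exact hd i j (by simpa using hij)
    · rw [Option.exists]
      simp only [Option.elim]
      rw [← hx x]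
      have := @hV x
      tauto
  · intro P _; funext o; cases o <;> rfl
  · rintro ⟨V, P⟩ _; rfl
  · intro P _; rfl

/-- The sum over all decompositions is the iterated convolution. -/
theorem sum_decomps_prod {ι : Type*} [Fintype ι] (F : ι → SetFn α) (X : Finset α) :
    ∑ P ∈ decomps ι X, ∏ i, F i (P i) = (∏ i, F i) X := by
  revert F X
  refine Fintype.induction_empty_option (P := fun ι _ => ∀ (F : ι → SetFn α) (X : Finset α),
    ∑ P ∈ decomps ι X, ∏ i, F i (P i) = (∏ i, F i) X) ?_ ?_ ?_ ι
  · intro ι κ _ e ih F X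
    let := Fintype.ofEquiv κ e.symm
    rw [← Equiv.prod_comp e, ← ih, sum_decomps_equiv e]
    refine Finset.sum_congr rfl fun P _ => ?_
    rw [← Equiv.prod_comp e]; rfl
  · intro F X
    simp only [Finset.univ_eq_empty, Finset.prod_empty, SetFn.one_apply, Finset.sum_const,
      nsmul_eq_mul, mul_one]
    -- The empty family decomposes only the empty set, which yields the unit of the convolution.
    by_cases hX : X = ∅
    · subst hX
      have : decomps PEmpty (∅ : Finset α) = {fun _ => ∅} := by
        ext P
        simp only [mem_decomps, Finset.univ_eq_empty, Finset.biUnion_empty, and_true,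
          Finset.mem_singleton]
        exact ⟨fun _ => funext fun x => x.elim, fun _ i => i.elim⟩
      rw [this]; simp
    · have : decomps PEmpty X = ∅ := by
        ext P; simp [mem_decomps, Ne.symm hX]
      rw [this]; simp [hX]
  · intro ι _ ih F X
    simp only [Fintype.prod_option]
    rw [sum_decomps_option X fun V P => F none V * ∏ i, F (some i) (P i), SetFn.mul_apply]
    simp only [← Finset.mul_sum, ih]

/-- The form in which the PMB density and the likelihood are written: one distinguished Poisson
factor and a family of further factors. -/
theorem sum_decomps_option_prod {ι : Type*} [Fintype ι] (F₀ : Finset α → ℝ)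
    (F : ι → Finset α → ℝ) (X : Finset α) :
    ∑ P ∈ decomps (Option ι) X, F₀ (P none) * ∏ i, F i (P (some i)) =
      (⟨F₀⟩ * ∏ i, ⟨F i⟩ : SetFn α) X := by
  have h := sum_decomps_prod (fun o : Option ι => (o.elim ⟨F₀⟩ fun i => ⟨F i⟩ : SetFn α)) X
  simpa only [Fintype.prod_option, Option.elim] using h

end SetFunctions

/-! ### The reference measure of the set integral on finite sequences. -/

section SetIntegrals

variable {α : Type*} [MeasurableSpace α]

/-- A subset of the disjoint union is measurable when all its slices are, and the image of `s` has
slice `s` at length `n` and empty slices elsewhere. -/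
theorem measurableEmbedding_sigmaMk (n : ℕ) :
    MeasurableEmbedding (@Sigma.mk ℕ (fun n => Fin n → α) n) where
  injective := sigma_mk_injective
  measurable := measurable_iff_comap_le.2 (by
    rw [MeasurableSpace.comap_le_iff_le_map]; exact iInf_le _ n)
  measurableSet_image' := by
    intro s hs
    refine MeasurableSpace.measurableSet_iInf.2 fun m => ?_
    change MeasurableSet (Sigma.mk m ⁻¹' ((@Sigma.mk ℕ (fun n => Fin n → α) n) '' s))
    by_cases h : m = n
    · subst h
      rwa [Set.preimage_image_eq _ sigma_mk_injective]
    · rw [Set.preimage_image_sigmaMk_of_ne h]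
      exact MeasurableSet.empty

theorem measurable_sigma {γ : Type*} [MeasurableSpace γ] {f : (Σ n : ℕ, Fin n → α) → γ}
    (hf : ∀ n, Measurable fun x => f ⟨n, x⟩) : Measurable f := by
  intro s hs
  exact MeasurableSpace.measurableSet_iInf.2 fun m => hf m hs

/-- The product σ-algebra is not given slice by slice, so the preimage is written as a countable
union of images under the embeddings of the individual lengths. -/
theorem measurable_sigma_prod {γ δ : Type*} [MeasurableSpace γ] [MeasurableSpace δ]
    {f : (Σ n : ℕ, Fin n → α) × δ → γ}
    (hf : ∀ n, Measurable fun p : (Fin n → α) × δ => f (⟨n, p.1⟩, p.2)) : Measurable f := by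
  intro s hs
  have : f ⁻¹' s = ⋃ n, (Prod.map (Sigma.mk n) id) ''
      ((fun p : (Fin n → α) × δ => f (⟨n, p.1⟩, p.2)) ⁻¹' s) := by
    ext ⟨⟨n, x⟩, d⟩
    simp only [Set.mem_preimage, Set.mem_iUnion, Set.mem_image, Prod.exists, Prod.map_apply, id]
    constructor
    · intro h; exact ⟨n, x, d, h, rfl⟩
    · rintro ⟨m, y, d', h, he⟩
      rw [← he]; exact h
  rw [this]
  exact MeasurableSet.iUnion fun n =>
    ((measurableEmbedding_sigmaMk n).prodMap MeasurableEmbedding.id).measurableSet_image.2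
      (hf n hs)

variable (μ : Measure α)

theorem lintegral_setMeasure (f : (Σ n : ℕ, Fin n → α) → ℝ≥0∞) :
    ∫⁻ t, f t ∂setMeasure μ =
      ∑' n : ℕ, (n.factorial : ℝ≥0∞)⁻¹ * ∫⁻ x, f ⟨n, x⟩ ∂Measure.pi fun _ : Fin n => μ := by
  rw [setMeasure, lintegral_sum_measure]
  refine tsum_congr fun n => ?_
  rw [lintegral_smul_measure, (measurableEmbedding_sigmaMk n).lintegral_map, smul_eq_mul]

theorem ae_setMeasure {p : (Σ n : ℕ, Fin n → α) → Prop}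
    (h : ∀ n, ∀ᵐ x ∂Measure.pi fun _ : Fin n => μ, p ⟨n, x⟩) : ∀ᵐ t ∂setMeasure μ, p t := by
  rw [setMeasure, ae_iff, Measure.sum_apply_eq_zero]
  intro n
  rw [← ae_iff]
  exact Measure.ae_smul_measure ((measurableEmbedding_sigmaMk n).ae_map_iff.2 (h n)) _

/-- Exhaustion by the sequences of length at most `k` with all entries in the `k`-th spanning set of
`μ`. -/
instance [SigmaFinite μ] : SigmaFinite (setMeasure μ) := by
  refine ⟨⟨⟨fun k => ⋃ n ∈ Finset.range (k + 1),
    Sigma.mk n '' (Set.univ.pi fun _ : Fin n => spanningSets μ k), fun _ => trivial, ?_, ?_⟩⟩⟩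
  · intro k
    refine (measure_biUnion_finset_le _ _).trans_lt (ENNReal.sum_lt_top.2 fun n _ => ?_)
    rw [setMeasure, Measure.sum_apply _ ((measurableEmbedding_sigmaMk n).measurableSet_image.2
      (MeasurableSet.univ_pi fun _ => measurableSet_spanningSets μ k)), tsum_eq_single n]
    · rw [Measure.smul_apply, (measurableEmbedding_sigmaMk n).map_apply,
        Set.preimage_image_eq _ sigma_mk_injective, Measure.pi_pi, smul_eq_mul]
      refine ENNReal.mul_lt_top ?_ (ENNReal.prod_lt_top fun _ _ => measure_spanningSets_lt_top μ k)
      simp [pos_iff_ne_zero, Nat.factorial_ne_zero]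
    · intro m hm
      rw [Measure.smul_apply, (measurableEmbedding_sigmaMk m).map_apply,
        Set.preimage_image_sigmaMk_of_ne hm]
      simp
  · rw [Set.eq_univ_iff_forall]
    rintro ⟨n, x⟩
    have hx : ∀ i, ∃ k, x i ∈ spanningSets μ k := fun i => by
      have : x i ∈ ⋃ k, spanningSets μ k := by rw [iUnion_spanningSets]; trivial
      exact Set.mem_iUnion.1 this
    choose k hk using hx
    -- A single index that bounds the length and every `k i` at once.
    have hle : ∀ i, k i ≤ n + ∑ j, k j := fun i =>
      (Finset.single_le_sum (f := k) (fun _ _ => Nat.zero_le _) (Finset.mem_univ i)).trans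
        (Nat.le_add_left _ _)
    refine Set.mem_iUnion.2 ⟨n + ∑ j, k j, Set.mem_biUnion (x := n) (by simp) ⟨x, ?_, rfl⟩⟩
    exact fun i _ => monotone_spanningSets μ (hle i) (hk i)

variable [SigmaFinite μ] [NullSingletonClass μ] [MeasurableEq α]

/-- Every diagonal `x i = x j` is null: once the other coordinates are fixed, `x i` is confined to a
single point. Set functions may therefore be evaluated on sequences without repetition. -/
theorem ae_pi_injective (n : ℕ) :
    ∀ᵐ x ∂Measure.pi fun _ : Fin n => μ, Function.Injective x := by
  have key : ∀ i j : Fin n, i ≠ j → ∀ᵐ x ∂Measure.pi fun _ : Fin n => μ, x i ≠ x j := by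
    intro i j hij
    obtain _ | n := n
    · exact i.elim0
    obtain ⟨k, rfl⟩ := Fin.exists_succAbove_eq hij.symm
    have hmp := measurePreserving_piFinSuccAbove (α := fun _ => α) (fun _ : Fin (n + 1) => μ) i
    have : ∀ᵐ p ∂(μ.prod (Measure.pi fun _ : Fin n => μ)), p.1 ≠ p.2 k := by
      have hm : MeasurableSet {p : α × (Fin n → α) | p.1 ≠ p.2 k} :=
        (measurableSet_eq_fun measurable_fst
          (g := fun p : α × (Fin n → α) => p.2 k) (by fun_prop)).compl
      refine (Measure.ae_prod_iff_ae_ae hm).2 ((Measure.ae_ae_comm hm).2 ?_)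
      exact Filter.Eventually.of_forall fun y => by simp [ae_iff]
    exact hmp.quasiMeasurePreserving.ae this
  have : ∀ᵐ x ∂Measure.pi fun _ : Fin n => μ, ∀ i j : Fin n, i ≠ j → x i ≠ x j := by
    rw [ae_all_iff]; intro i
    rw [ae_all_iff]; intro j
    by_cases h : i = j
    · simp [h]
    · filter_upwards [key i j h] with x hx _ using hx
  filter_upwards [this] with x hx i j hij
  by_contra h
  exact hx i j h hij

theorem ae_setMeasure_injective : ∀ᵐ t ∂setMeasure μ, Function.Injective t.2 :=
  ae_setMeasure μ fun n => ae_pi_injective μ n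

end SetIntegrals

/-! ### Rules of calculation for set integrals of nonnegative functions. -/

section SetIntegrals

open scoped Classical

variable {α : Type*} [MeasurableSpace α]

theorem lintegral_fin_prod (μ : Measure α) [SigmaFinite μ] {n : ℕ} {f : Fin n → α → ℝ≥0∞}
    (hf : ∀ i, AEMeasurable (f i) μ) :
    ∫⁻ x, ∏ i, f i (x i) ∂(Measure.pi fun _ : Fin n => μ) = ∏ i, ∫⁻ x, f i x ∂μ := by
  induction n with
  | zero => simp
  | succ n ih =>
    have hmp := (measurePreserving_piFinSuccAbove (α := fun _ => α) (fun _ : Fin (n + 1) => μ) 0)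
    rw [Fin.prod_univ_succ, ← ih fun i => hf _, ← lintegral_prod_mul (hf 0),
      ← hmp.lintegral_comp_emb (MeasurableEquiv.measurableEmbedding _)]
    · simp only [Fin.prod_univ_succ]
      rfl
    · refine Finset.aemeasurable_fun_prod _ fun i _ => ?_
      exact (hf _).comp_quasiMeasurePreserving (Measure.quasiMeasurePreserving_eval _ i)

theorem lintegral_fintype_prod {ι : Type*} [Fintype ι] (μ : Measure α) [SigmaFinite μ]
    {f : ι → α → ℝ≥0∞} (hf : ∀ i, AEMeasurable (f i) μ) :
    ∫⁻ x, ∏ i, f i (x i) ∂(Measure.pi fun _ : ι => μ) = ∏ i, ∫⁻ x, f i x ∂μ := by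
  let e := (Fintype.equivFin ι).symm
  rw [← (measurePreserving_piCongrLeft (fun _ : ι => μ) e).lintegral_comp_emb
    (MeasurableEquiv.measurableEmbedding _)]
  simp_rw [← e.prod_comp, MeasurableEquiv.coe_piCongrLeft, Equiv.piCongrLeft_apply_apply]
  exact lintegral_fin_prod μ fun i => hf _

/-- A function of finite sets that is, on sequences without repetition, a measurable function of
the sequence of elements. -/
def SetMeasurable (F : Finset α → ℝ) : Prop :=
  ∃ G : ∀ n, (Fin n → α) → ℝ, (∀ n, Measurable (G n)) ∧
    ∀ n x, Function.Injective x → F (toSet ⟨n, x⟩) = G n x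

theorem toSet_erase {n : ℕ} {x : Fin (n + 1) → α} (hx : Function.Injective x) (k : Fin (n + 1)) :
    (toSet ⟨n + 1, x⟩).erase (x k) = toSet ⟨n, fun j => x (k.succAbove j)⟩ := by
  ext a
  simp only [toSet, Finset.mem_erase, Finset.mem_image, Finset.mem_univ, true_and]
  constructor
  · rintro ⟨hne, j, rfl⟩
    obtain ⟨i, rfl⟩ := Fin.exists_succAbove_eq (fun h : j = k => hne (h ▸ rfl))
    exact ⟨i, rfl⟩
  · rintro ⟨i, rfl⟩
    exact ⟨fun h => Fin.succAbove_ne k i (hx h), _, rfl⟩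

theorem sum_toSet {n : ℕ} {x : Fin n → α} (hx : Function.Injective x) {γ : Type*}
    [AddCommMonoid γ] (f : α → γ) : ∑ a ∈ toSet ⟨n, x⟩, f a = ∑ k, f (x k) :=
  Finset.sum_image fun _ _ _ _ h => hx h

theorem prod_toSet {n : ℕ} {x : Fin n → α} (hx : Function.Injective x) {γ : Type*}
    [CommMonoid γ] (f : α → γ) : ∏ a ∈ toSet ⟨n, x⟩, f a = ∏ k, f (x k) :=
  Finset.prod_image fun _ _ _ _ h => hx h

namespace SetMeasurable

theorem const (c : ℝ) : SetMeasurable fun _ : Finset α => c :=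
  ⟨fun _ _ => c, fun _ => measurable_const, fun _ _ _ => rfl⟩

theorem add {F G : Finset α → ℝ} (hF : SetMeasurable F) (hG : SetMeasurable G) :
    SetMeasurable fun X => F X + G X := by
  obtain ⟨F', hF', hF⟩ := hF
  obtain ⟨G', hG', hG⟩ := hG
  exact ⟨fun n x => F' n x + G' n x, fun n => (hF' n).add (hG' n),
    fun n x hx => by beta_reduce; rw [hF n x hx, hG n x hx]⟩

theorem mul {F G : Finset α → ℝ} (hF : SetMeasurable F) (hG : SetMeasurable G) :
    SetMeasurable fun X => F X * G X := by
  obtain ⟨F', hF', hF⟩ := hF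
  obtain ⟨G', hG', hG⟩ := hG
  exact ⟨fun n x => F' n x * G' n x, fun n => (hF' n).mul (hG' n),
    fun n x hx => by beta_reduce; rw [hF n x hx, hG n x hx]⟩

theorem prod {φ : α → ℝ} (hφ : Measurable φ) : SetMeasurable fun X => ∏ x ∈ X, φ x :=
  ⟨fun _ x => ∏ k, φ (x k),
    fun _ => Finset.measurable_fun_prod _ fun k _ => hφ.comp (measurable_pi_apply k),
    fun _ _ hx => prod_toSet hx φ⟩

theorem sum_erase {f : α → ℝ} (hf : Measurable f) {F : Finset α → ℝ} (hF : SetMeasurable F) :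
    SetMeasurable fun X => ∑ l ∈ X, f l * F (X.erase l) := by
  obtain ⟨G, hG, hF⟩ := hF
  refine ⟨fun n => match n with
    | 0 => fun _ => 0
    | n + 1 => fun x => ∑ k : Fin (n + 1), f (x k) * G n (fun j => x (k.succAbove j)), ?_, ?_⟩
  · rintro (_ | n)
    · exact measurable_const
    · refine Finset.measurable_fun_sum _ fun k _ => ?_
      exact (hf.comp (measurable_pi_apply k)).mul
        ((hG n).comp (measurable_pi_lambda _ fun j => measurable_pi_apply _))
  · rintro (_ | n) x hx
    · simp [toSet]
    · beta_reduce
      rw [sum_toSet hx]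
      refine Finset.sum_congr rfl fun k _ => ?_
      rw [toSet_erase hx, hF]
      exact hx.comp Fin.succAbove_right_injective

variable (μ : Measure α) [SigmaFinite μ] [NullSingletonClass μ] [MeasurableEq α]

theorem aemeasurable {F : Finset α → ℝ} (hF : SetMeasurable F) :
    AEMeasurable (fun t => F (toSet t)) (setMeasure μ) := by
  obtain ⟨G, hG, hF⟩ := hF
  refine ⟨fun t => G t.1 t.2, measurable_sigma hG, ?_⟩
  filter_upwards [ae_setMeasure_injective μ] with t ht using hF t.1 t.2 ht

end SetMeasurable

variable (μ : Measure α)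

/-- `F` is a nonnegative function with the finite set integral `v`. -/
structure HasSetIntegral (F : Finset α → ℝ) (v : ℝ) : Prop where
  meas : SetMeasurable F
  nonneg : ∀ X, 0 ≤ F X
  value_nonneg : 0 ≤ v
  lintegral_eq : ∫⁻ t, ENNReal.ofReal (F (toSet t)) ∂setMeasure μ = ENNReal.ofReal v

variable {μ} [SigmaFinite μ] [NullSingletonClass μ] [MeasurableEq α]

/-- Integration over the first element of a finite set. -/
theorem lintegral_sum_erase {f : α → ℝ≥0∞} (hf : Measurable f)
    {F : (Σ n : ℕ, Fin n → α) → ℝ≥0∞} (hF : Measurable F)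
    {H : (Σ n : ℕ, Fin n → α) → ℝ≥0∞} (h0 : ∀ x, H ⟨0, x⟩ = 0)
    (hH : ∀ n x, H ⟨n + 1, x⟩ =
      ∑ k : Fin (n + 1), f (x k) * F ⟨n, fun j => x (k.succAbove j)⟩) :
    ∫⁻ t, H t ∂setMeasure μ = (∫⁻ l, f l ∂μ) * ∫⁻ t, F t ∂setMeasure μ := by
  have hFn : ∀ n, Measurable fun x => F ⟨n, x⟩ := fun n =>
    hF.comp (measurableEmbedding_sigmaMk n).measurable
  rw [lintegral_setMeasure, lintegral_setMeasure, tsum_eq_zero_add' ENNReal.summable,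
    ← ENNReal.tsum_mul_left]
  simp only [h0, lintegral_zero, mul_zero, zero_add, hH]
  refine tsum_congr fun n => ?_
  rw [lintegral_finsetSum]
  · have : ∀ k : Fin (n + 1), ∫⁻ x, f (x k) * F ⟨n, fun j => x (k.succAbove j)⟩
        ∂(Measure.pi fun _ : Fin (n + 1) => μ) =
        (∫⁻ l, f l ∂μ) * ∫⁻ x, F ⟨n, x⟩ ∂(Measure.pi fun _ : Fin n => μ) := by
      intro k
      rw [← lintegral_prod_mul hf.aemeasurable (hFn n).aemeasurable]
      exact (measurePreserving_piFinSuccAbove (α := fun _ => α)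
        (fun _ : Fin (n + 1) => μ) k).lintegral_comp_emb
        (MeasurableEquiv.measurableEmbedding _) (fun p => f p.1 * F ⟨n, p.2⟩)
    rw [Finset.sum_congr rfl fun k _ => this k, Finset.sum_const, Finset.card_univ,
      Fintype.card_fin, nsmul_eq_mul, Nat.factorial_succ]
    push_cast
    rw [ENNReal.mul_inv (by simp) (by simp)]
    -- There are `n + 1` equal summands, and `(n + 1) / (n + 1)! = 1 / n!`.
    have h1 : ((n : ℝ≥0∞) + 1)⁻¹ * ((n : ℝ≥0∞) + 1) = 1 :=
      ENNReal.inv_mul_cancel (by simp) (by finiteness)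
    calc _ = (((n : ℝ≥0∞) + 1)⁻¹ * ((n : ℝ≥0∞) + 1)) * ((n.factorial : ℝ≥0∞)⁻¹ *
          ((∫⁻ l, f l ∂μ) * ∫⁻ x, F ⟨n, x⟩ ∂(Measure.pi fun _ : Fin n => μ))) := by ring
      _ = _ := by rw [h1]; ring
  · intro k _
    exact (hf.comp (measurable_pi_apply k)).mul
      ((hFn n).comp (measurable_pi_lambda _ fun j => measurable_pi_apply _))

namespace HasSetIntegral

theorem congr {F G : Finset α → ℝ} {v w : ℝ} (hF : HasSetIntegral μ F v) (h : ∀ X, F X = G X)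
    (hv : v = w) : HasSetIntegral μ G w := by
  obtain rfl : F = G := funext h
  exact hv ▸ hF

theorem setIntegral_eq {F : Finset α → ℝ} {v : ℝ} (hF : HasSetIntegral μ F v) :
    setIntegral μ F = v := by
  rw [setIntegral, integral_eq_lintegral_of_nonneg_ae
    (Filter.Eventually.of_forall fun t => hF.nonneg _) (hF.meas.aemeasurable μ).aestronglyMeasurable,
    hF.lintegral_eq, ENNReal.toReal_ofReal hF.value_nonneg]

theorem add {F G : Finset α → ℝ} {v w : ℝ} (hF : HasSetIntegral μ F v)
    (hG : HasSetIntegral μ G w) : HasSetIntegral μ (fun X => F X + G X) (v + w) where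
  meas := hF.meas.add hG.meas
  nonneg X := add_nonneg (hF.nonneg X) (hG.nonneg X)
  value_nonneg := add_nonneg hF.value_nonneg hG.value_nonneg
  lintegral_eq := by
    rw [ENNReal.ofReal_add hF.value_nonneg hG.value_nonneg, ← hF.lintegral_eq, ← hG.lintegral_eq,
      ← lintegral_add_left' (hF.meas.aemeasurable μ).ennreal_ofReal]
    simp only [ENNReal.ofReal_add (hF.nonneg _) (hG.nonneg _)]

theorem const_mul {F : Finset α → ℝ} {v : ℝ} (hF : HasSetIntegral μ F v) {c : ℝ} (hc : 0 ≤ c) :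
    HasSetIntegral μ (fun X => c * F X) (c * v) where
  meas := (SetMeasurable.const c).mul hF.meas
  nonneg X := mul_nonneg hc (hF.nonneg X)
  value_nonneg := mul_nonneg hc hF.value_nonneg
  lintegral_eq := by
    simp only [ENNReal.ofReal_mul hc]
    rw [← hF.lintegral_eq, lintegral_const_mul' _ _ ENNReal.ofReal_ne_top]

theorem zero : HasSetIntegral μ (fun _ => 0) 0 where
  meas := SetMeasurable.const 0
  nonneg _ := le_rfl
  value_nonneg := le_rfl
  lintegral_eq := by simp

theorem sum {ι : Type*} (s : Finset ι) {F : ι → Finset α → ℝ} {v : ι → ℝ}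
    (hF : ∀ i ∈ s, HasSetIntegral μ (F i) (v i)) :
    HasSetIntegral μ (fun X => ∑ i ∈ s, F i X) (∑ i ∈ s, v i) := by
  induction s using Finset.induction_on with
  | empty => simpa using zero
  | insert i s hi ih =>
    simp only [Finset.sum_insert hi]
    exact (hF i (by simp)).add (ih fun j hj => hF j (by simp [hj]))

/-- On sequences of length `n` the integrand factorises, so the set integral is the exponential
series in `∫ φ`. -/
theorem prod {φ : α → ℝ} (hφ : IsIntensity μ φ) :
    HasSetIntegral μ (fun X => ∏ x ∈ X, φ x) (Real.exp (∫ x, φ x ∂μ)) where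
  meas := SetMeasurable.prod hφ.measurable
  nonneg X := Finset.prod_nonneg fun x _ => hφ.nonneg x
  value_nonneg := (Real.exp_pos _).le
  lintegral_eq := by
    have h0 : 0 ≤ ∫ x, φ x ∂μ := integral_nonneg hφ.nonneg
    rw [lintegral_setMeasure, Real.exp_eq_exp_ℝ, NormedSpace.exp_eq_tsum_div,
      ENNReal.ofReal_tsum_of_nonneg (fun n => by positivity)
        (NormedSpace.expSeries_div_summable _)]
    refine tsum_congr fun n => ?_
    have : ∫⁻ x, ENNReal.ofReal (∏ a ∈ toSet ⟨n, x⟩, φ a) ∂(Measure.pi fun _ : Fin n => μ) =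
        ∫⁻ x, ∏ k, ENNReal.ofReal (φ (x k)) ∂(Measure.pi fun _ : Fin n => μ) := by
      refine lintegral_congr_ae ?_
      filter_upwards [ae_pi_injective μ n] with x hx
      rw [prod_toSet hx, ENNReal.ofReal_prod_of_nonneg fun _ _ => hφ.nonneg _]
    rw [this, lintegral_fin_prod μ fun _ => hφ.measurable.ennreal_ofReal.aemeasurable,
      Finset.prod_const, Finset.card_univ, Fintype.card_fin,
      ← ofReal_integral_eq_lintegral_ofReal hφ.integrable
        (Filter.Eventually.of_forall hφ.nonneg), div_eq_inv_mul, ENNReal.ofReal_mul (by positivity),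
      ENNReal.ofReal_inv_of_pos (by positivity), ENNReal.ofReal_natCast, ENNReal.ofReal_pow h0]

theorem poisson {φ : α → ℝ} (hφ : IsIntensity μ φ) : HasSetIntegral μ (poisson μ φ) 1 :=
  ((prod hφ).const_mul (Real.exp_pos (-∫ x, φ x ∂μ)).le).congr (fun _ => rfl)
    (by rw [← Real.exp_add]; simp)

/-- The indicator is the product over `X` of the zero function, whence the value `exp 0`. -/
theorem indicator_empty : HasSetIntegral μ (fun X => if X = ∅ then 1 else 0) 1 := by
  refine (prod (μ := μ) (φ := fun _ => 0) ⟨measurable_const, fun _ => le_rfl, by simp⟩).congr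
    (fun X => ?_) (by simp)
  split_ifs with h
  · simp [h]
  · obtain ⟨x, hx⟩ := Finset.nonempty_iff_ne_empty.2 h
    exact Finset.prod_eq_zero hx rfl

/-- Together with linearity and `prod` this evaluates all set integrals of the update: one element
is singled out and integrated separately from the rest of the set. -/
theorem sum_erase {f : α → ℝ} (hf : IsIntensity μ f) {F : Finset α → ℝ} {v : ℝ}
    (hF : HasSetIntegral μ F v) :
    HasSetIntegral μ (fun X => ∑ l ∈ X, f l * F (X.erase l)) ((∫ l, f l ∂μ) * v) where
  meas := SetMeasurable.sum_erase hf.measurable hF.meas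
  nonneg X := Finset.sum_nonneg fun l _ => mul_nonneg (hf.nonneg l) (hF.nonneg _)
  value_nonneg := mul_nonneg (integral_nonneg hf.nonneg) hF.value_nonneg
  lintegral_eq := by
    -- `lintegral_sum_erase` asks for a measurable function of sequences. `G` is one, and it agrees
    -- with `F` off the null set of sequences with repetitions.
    obtain ⟨G, hG, hFG⟩ := hF.meas
    have hFl : ∫⁻ t, ENNReal.ofReal (G t.1 t.2) ∂setMeasure μ = ENNReal.ofReal v := by
      rw [← hF.lintegral_eq]
      refine lintegral_congr_ae ?_
      filter_upwards [ae_setMeasure_injective μ] with t ht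
      rw [← hFG t.1 t.2 ht]
    rw [ENNReal.ofReal_mul (integral_nonneg hf.nonneg), ← hFl,
      ofReal_integral_eq_lintegral_ofReal hf.integrable (Filter.Eventually.of_forall hf.nonneg),
      ← lintegral_sum_erase (μ := μ) hf.measurable.ennreal_ofReal
        (F := fun t => ENNReal.ofReal (G t.1 t.2))
        (measurable_sigma fun n => (hG n).ennreal_ofReal)
        (H := fun t => match t with
          | ⟨0, _⟩ => 0
          | ⟨n + 1, x⟩ => ∑ k : Fin (n + 1), ENNReal.ofReal (f (x k)) *
              ENNReal.ofReal (G n fun j => x (k.succAbove j))) (fun _ => rfl) (fun _ _ => rfl)]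
    refine lintegral_congr_ae ?_
    filter_upwards [ae_setMeasure_injective μ] with t ht
    obtain ⟨_ | n, x⟩ := t
    · simp [toSet]
    · rw [sum_toSet ht, ENNReal.ofReal_sum_of_nonneg
        fun k _ => mul_nonneg (hf.nonneg _) (hF.nonneg _)]
      refine Finset.sum_congr rfl fun k _ => ?_
      rw [toSet_erase ht, hFG, ENNReal.ofReal_mul (hf.nonneg _)]
      exact ht.comp Fin.succAbove_right_injective

end HasSetIntegral

end SetIntegrals

/-! ### Measurement update of Poisson and Bernoulli components. -/

section Update

open scoped Classical

variable {α β : Type*} [MeasurableSpace α] {μ : Measure α}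

/-- The integral of a non-integrable function is `0` by convention, which is incompatible with the
value `1`. -/
theorem IsDensity.integrable {f : α → ℝ} (hf : IsDensity μ f) : Integrable f μ := by
  by_contra h
  have := hf.integral_eq_one
  rw [integral_undef h] at this
  exact zero_ne_one this

theorem IsDensity.isIntensity {f : α → ℝ} (hf : IsDensity μ f) : IsIntensity μ f :=
  ⟨hf.measurable, hf.nonneg, hf.integrable⟩

theorem IsIntensity.const_mul {f : α → ℝ} (hf : IsIntensity μ f) {c : ℝ} (hc : 0 ≤ c) :
    IsIntensity μ fun x => c * f x :=
  ⟨hf.measurable.const_mul c, fun x => mul_nonneg hc (hf.nonneg x), hf.integrable.const_mul c⟩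

theorem IsIntensity.mul_bounded {f g : α → ℝ} (hf : IsIntensity μ f) (hg : Measurable g)
    (hg0 : ∀ x, 0 ≤ g x) (hgb : ∃ C, ∀ x, g x ≤ C) : IsIntensity μ fun x => f x * g x := by
  obtain ⟨C, hC⟩ := hgb
  refine ⟨hf.measurable.mul hg, fun x => mul_nonneg (hf.nonneg x) (hg0 x),
    hf.integrable.mul_bdd (c := C) hg.aestronglyMeasurable (Filter.Eventually.of_forall fun x => ?_)⟩
  rw [Real.norm_of_nonneg (hg0 x)]
  exact hC x

/-- Density of the measurement set of clutter `K` and of the elements of `X`. -/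
def unionDensity (K : SetFn β) (φ : α → SetFn β) (X : Finset α) : SetFn β := K * ∏ l ∈ X, φ l

section Algebra

variable {K : SetFn β} {φ : α → SetFn β}

theorem unionDensity_insert {l : α} {X : Finset α} (hl : l ∉ X) :
    unionDensity K φ (insert l X) = φ l * unionDensity K φ X := by
  rw [unionDensity, Finset.prod_insert hl, unionDensity, mul_left_comm]

theorem SetFn.mul_empty (F G : SetFn β) : (F * G) ∅ = F ∅ * G ∅ := by
  simp [SetFn.mul_apply]

theorem unionDensity_empty (X : Finset α) :
    unionDensity K φ X ∅ = K ∅ * ∏ l ∈ X, φ l ∅ := by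
  rw [unionDensity, SetFn.mul_empty]
  congr 1
  induction X using Finset.induction_on with
  | empty => simp [SetFn.one_apply]
  | insert l X hl ih => rw [Finset.prod_insert hl, SetFn.mul_empty, ih, Finset.prod_insert hl]

/-- A product rule: the measurement `z` is either clutter, which splits off `c z`, or it comes from
one landmark `l`, which then produces nothing else and can be removed from `X`. The induction adds
landmarks, and each occurrence of the new landmark is expanded according to whether it is missed or
detected. -/
theorem unionDensity_insert_measurement {c : β → ℝ}
    (hK : ∀ z W, z ∉ W → K (insert z W) = c z * K W)
    (hφ : ∀ l W, 1 < W.card → φ l W = 0) {z : β} (X : Finset α) :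
    ∀ W : Finset β, z ∉ W → unionDensity K φ X (insert z W) =
      c z * unionDensity K φ X W +
        ∑ l ∈ X, φ l {z} * unionDensity K φ (X.erase l) W := by
  induction X using Finset.induction_on with
  | empty => intro W hz; simp [unionDensity, hK z W hz]
  | insert l X hl ih =>
    intro W hz
    have h1 : ∀ w ∈ W, (insert z W).erase w = insert z (W.erase w) := fun w hw =>
      Finset.erase_insert_of_ne (by rintro rfl; exact hz hw)
    have h2 : ∀ l' ∈ X, unionDensity K φ ((insert l X).erase l') W =
        φ l ∅ * unionDensity K φ (X.erase l') W +
          ∑ w ∈ W, φ l {w} * unionDensity K φ (X.erase l') (W.erase w) := by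
      intro l' hl'
      rw [Finset.erase_insert_of_ne (by rintro rfl; exact hl hl'),
        unionDensity_insert (fun h => hl (Finset.mem_of_mem_erase h)),
        SetFn.mul_of_card_le_one (hφ l)]
    have h3 : ∀ w ∈ W, unionDensity K φ X ((insert z W).erase w) =
        c z * unionDensity K φ X (W.erase w) +
          ∑ l' ∈ X, φ l' {z} * unionDensity K φ (X.erase l') (W.erase w) := by
      intro w hw
      rw [h1 w hw, ih _ fun h => hz (Finset.mem_of_mem_erase h)]
    rw [unionDensity_insert hl, SetFn.mul_of_card_le_one (hφ l), SetFn.mul_of_card_le_one (hφ l),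
      Finset.sum_insert hz, Finset.sum_insert hl, Finset.erase_insert hz, Finset.erase_insert hl,
      ih W hz, Finset.sum_congr rfl fun w hw => congrArg (φ l {w} * ·) (h3 w hw),
      Finset.sum_congr rfl fun l' hl' => congrArg (φ l' {z} * ·) (h2 l' hl')]
    simp only [mul_add, Finset.sum_add_distrib, Finset.mul_sum]
    -- The terms on both sides agree up to order; the double sums over `X` and `W` are traversed in
    -- opposite orders.
    rw [Finset.sum_comm (s := X) (t := W)]
    have e1 : ∀ w l', φ l {w} * (φ l' {z} * unionDensity K φ (X.erase l') (W.erase w)) =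
        φ l' {z} * (φ l {w} * unionDensity K φ (X.erase l') (W.erase w)) := fun _ _ => by ring
    have e2 : ∀ l', φ l ∅ * (φ l' {z} * unionDensity K φ (X.erase l') W) =
        φ l' {z} * (φ l ∅ * unionDensity K φ (X.erase l') W) := fun _ => by ring
    have e3 : ∀ w, φ l {w} * (c z * unionDensity K φ X (W.erase w)) =
        c z * (φ l {w} * unionDensity K φ X (W.erase w)) := fun _ => by ring
    simp only [e1, e2, e3]
    ring

end Algebra

variable {K : SetFn β} {φ : α → SetFn β}
  (hK0 : ∀ W, 0 ≤ K W) (hφ1 : ∀ l W, 1 < W.card → φ l W = 0) (hφ0 : ∀ l W, 0 ≤ φ l W)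
  (hφm : ∀ W, Measurable fun l => φ l W) (hφb : ∀ W, ∃ C, ∀ l, φ l W ≤ C)

theorem poisson_insert {γ : Type*} [MeasurableSpace γ] (ν : Measure γ) (lam : γ → ℝ) {l : γ}
    {X : Finset γ} (hl : l ∉ X) : poisson ν lam (insert l X) = lam l * poisson ν lam X := by
  rw [poisson, poisson, Finset.prod_insert hl]; ring

/-- Density of the measurement set of a Bernoulli process. -/
def bernoulliUpdate (μ : Measure α) (φ : α → SetFn β) (r : ℝ) (f : α → ℝ) : SetFn β :=
  ⟨fun W => (1 - r) * (if W = ∅ then 1 else 0) + ∫ l, r * f l * φ l W ∂μ⟩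

include hφ1 in
theorem bernoulliUpdate_of_one_lt (r : ℝ) (f : α → ℝ) (W : Finset β) (hW : 1 < W.card) :
    bernoulliUpdate μ φ r f W = 0 := by
  have : W ≠ ∅ := by rintro rfl; simp at hW
  simp [bernoulliUpdate, this, hφ1 _ W hW]

variable [SigmaFinite μ] [NullSingletonClass μ] [MeasurableEq α]

include hK0 hφ1 hφ0 hφm hφb in
/-- Update of a Poisson prior. -/
theorem hasSetIntegral_poisson_update {c : β → ℝ} (hc : ∀ z, 0 ≤ c z)
    (hK : ∀ z W, z ∉ W → K (insert z W) = c z * K W)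
    {lam : α → ℝ} (hlam : IsIntensity μ lam) (W : Finset β) :
    HasSetIntegral μ (fun X => poisson μ lam X * unionDensity K φ X W)
      (K ∅ * Real.exp (∫ l, lam l * φ l ∅ ∂μ - ∫ l, lam l ∂μ) *
        ∏ z ∈ W, (c z + ∫ l, lam l * φ l {z} ∂μ)) := by
  -- Without measurements the integrand is a product function, which supplies the exponential; each
  -- further measurement multiplies the integral by one factor.
  induction W using Finset.induction_on with
  | empty =>
    refine (((HasSetIntegral.prod (hlam.mul_bounded (hφm ∅) (fun l => hφ0 l ∅)
      (hφb ∅))).const_mul (Real.exp_pos (-∫ x, lam x ∂μ)).le).const_mul (hK0 ∅)).congr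
      (fun X => ?_) ?_
    · rw [unionDensity_empty, poisson, Finset.prod_mul_distrib]; ring
    · rw [Finset.prod_empty, ← Real.exp_add, mul_one, neg_add_eq_sub]
  | insert z W hz ih =>
    refine ((ih.const_mul (hc z)).add (ih.sum_erase (hlam.mul_bounded (hφm {z})
      (fun l => hφ0 l {z}) (hφb {z})))).congr (fun X => ?_) ?_
    · rw [unionDensity_insert_measurement hK hφ1 X W hz, mul_add, Finset.mul_sum]
      congr 1
      · ring
      · refine Finset.sum_congr rfl fun l hl => ?_
        -- Removing the detected landmark `l` from a Poisson density leaves the factor `lam l` and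
        -- the Poisson density of the rest.
        conv_rhs => rw [← Finset.insert_erase hl, poisson_insert μ lam (Finset.notMem_erase l X),
          Finset.erase_insert (Finset.notMem_erase l X)]
        ring
    · rw [Finset.prod_insert hz]; ring

theorem bernoulli_of_one_lt {γ : Type*} (r : ℝ) (f : γ → ℝ) (X : Finset γ) (hX : 1 < X.card) :
    bernoulli r f X = 0 := by
  rw [bernoulli, if_neg (by omega), if_neg (by omega)]

theorem bernoulli_empty {γ : Type*} (r : ℝ) (f : γ → ℝ) : bernoulli r f ∅ = 1 - r := by
  simp [bernoulli]

theorem bernoulli_singleton {γ : Type*} (r : ℝ) (f : γ → ℝ) (x : γ) :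
    bernoulli r f {x} = r * f x := by
  simp [bernoulli]

theorem bernoulli_nonneg {γ : Type*} {r : ℝ} (hr : r ∈ Set.Icc (0 : ℝ) 1) {f : γ → ℝ}
    (hf : ∀ x, 0 ≤ f x) (X : Finset γ) : 0 ≤ bernoulli r f X := by
  unfold bernoulli
  split_ifs
  · linarith [hr.2]
  · exact mul_nonneg hr.1 (Finset.prod_nonneg fun x _ => hf x)
  · exact le_rfl

include hφ1 hφ0 hφm hφb in
/-- Update of a process with an additional Bernoulli component. -/
theorem hasSetIntegral_mul_bernoulli_update {r : ℝ} (hr : r ∈ Set.Icc (0 : ℝ) 1) {f : α → ℝ}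
    (hf : IsIntensity μ f) {F : SetFn α} {v : SetFn β}
    (hF : ∀ W, HasSetIntegral μ (fun X => F X * unionDensity K φ X W) (v W)) (W : Finset β) :
    HasSetIntegral μ (fun X => (⟨bernoulli r f⟩ * F : SetFn α) X * unionDensity K φ X W)
      ((bernoulliUpdate μ φ r f * v) W) := by
  have hint : ∀ W, IsIntensity μ fun l => r * f l * φ l W := fun W =>
    (hf.const_mul hr.1).mul_bounded (hφm W) (fun l => hφ0 l W) (hφb W)
  -- Three cases for the new component: it is empty, it is a missed landmark, or it is a landmark
  -- that produced some `z ∈ W`.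
  refine (((hF W).const_mul (sub_nonneg.2 hr.2)).add (((hF W).sum_erase (hint ∅)).add
    (HasSetIntegral.sum W fun z _ => (hF (W.erase z)).sum_erase (hint {z})))).congr
    (fun X => ?_) ?_
  · rw [SetFn.mul_of_card_le_one (b := ⟨bernoulli r f⟩) (bernoulli_of_one_lt r f)]
    dsimp only
    rw [bernoulli_empty, add_mul,
      Finset.sum_comm, ← Finset.sum_add_distrib, Finset.sum_mul]
    congr 1
    · ring
    · refine Finset.sum_congr rfl fun l hl => ?_
      conv_rhs => rw [← Finset.insert_erase hl, unionDensity_insert (Finset.notMem_erase l X),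
        Finset.erase_insert (Finset.notMem_erase l X), SetFn.mul_of_card_le_one (hφ1 l),
        bernoulli_singleton]
      rw [mul_add, Finset.mul_sum]
      congr 1
      · ring
      · exact Finset.sum_congr rfl fun z _ => by ring
  · rw [SetFn.mul_of_card_le_one (bernoulliUpdate_of_one_lt hφ1 r f)]
    simp only [bernoulliUpdate, Finset.singleton_ne_empty, if_true, if_false, mul_zero, zero_add]
    ring

include hφ1 hφ0 hφm hφb in
/-- Update of a multi-Bernoulli mixture with an arbitrary further component. -/
theorem hasSetIntegral_prod_bernoulli_update {ι : Type*} (s : Finset ι) {r : ι → ℝ}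
    (hr : ∀ i, r i ∈ Set.Icc (0 : ℝ) 1) {f : ι → α → ℝ} (hf : ∀ i, IsIntensity μ (f i))
    {F : SetFn α} {v : SetFn β}
    (hF : ∀ W, HasSetIntegral μ (fun X => F X * unionDensity K φ X W) (v W)) (W : Finset β) :
    HasSetIntegral μ
      (fun X => (F * ∏ i ∈ s, ⟨bernoulli (r i) (f i)⟩ : SetFn α) X * unionDensity K φ X W)
      ((v * ∏ i ∈ s, bernoulliUpdate μ φ (r i) (f i)) W) := by
  induction s using Finset.induction_on generalizing W with
  | empty => simpa using hF W
  | insert i s hi ih =>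
    refine (hasSetIntegral_mul_bernoulli_update hφ1 hφ0 hφm hφb (hr i) (hf i) ih W).congr
      (fun X => ?_) ?_
    · rw [Finset.prod_insert hi, mul_left_comm]
    · rw [Finset.prod_insert hi, mul_left_comm]

include hφ0 hφm hφb in
/-- Update of a single Bernoulli component, without clutter. -/
theorem hasSetIntegral_bernoulli_update {r : ℝ} (hr : r ∈ Set.Icc (0 : ℝ) 1) {f : α → ℝ}
    (hf : IsIntensity μ f) (W : Finset β) :
    HasSetIntegral μ
      (fun X => bernoulli r f X * if X.card = 0 then (if W.card = 0 then 1 else 0)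
        else if X.card = 1 then ∏ l ∈ X, φ l W else 0)
      (bernoulliUpdate μ φ r f W) := by
  have hint : IsIntensity μ fun l => r * f l * φ l W :=
    (hf.const_mul hr.1).mul_bounded (hφm W) (fun l => hφ0 l W) (hφb W)
  have hW : (0 : ℝ) ≤ if W = ∅ then 1 else 0 := by split_ifs <;> norm_num
  -- A function carried by sets of at most one element is a multiple of the indicator of `∅` plus a
  -- `sum_erase` term built on that indicator.
  refine ((HasSetIntegral.indicator_empty.const_mul
    (mul_nonneg (sub_nonneg.2 hr.2) hW)).add (HasSetIntegral.indicator_empty.sum_erase hint)).congr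
    (fun X => ?_) (by rw [bernoulliUpdate]; ring)
  by_cases h0 : X.card = 0
  · obtain rfl := Finset.card_eq_zero.1 h0
    simp [bernoulli_empty]
  · rw [if_neg h0]
    have h0' : X ≠ ∅ := fun h => h0 (by simp [h])
    by_cases h1 : X.card = 1
    · obtain ⟨l, rfl⟩ := Finset.card_eq_one.1 h1
      simp [bernoulli_singleton]
    · rw [if_neg h1, if_neg h0', mul_zero, mul_zero, zero_add]
      refine Finset.sum_eq_zero fun l hl => ?_
      rw [if_neg, mul_zero]
      intro h
      have := Finset.card_erase_of_mem hl
      rw [h, Finset.card_empty] at this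
      omega

end Update

/-! ### Integration over landmarks and its exchange with the average over vehicle states. -/

section Landmarks

variable {nx : ℕ} {M : Type*} [Fintype M] [MeasurableSpace M] [DiscreteMeasurableSpace M]

instance : SigmaFinite (landmarkMeasure nx M) := by unfold landmarkMeasure; infer_instance

instance [NeZero nx] : NullSingletonClass (landmarkMeasure nx M) := by
  unfold landmarkMeasure; infer_instance

theorem integral_landmarkMeasure {F : Landmark nx M → ℝ}
    (hF : Integrable F (landmarkMeasure nx M)) :
    ∫ l, F l ∂landmarkMeasure nx M = ∑ m, ∫ x, F (x, m) := by
  rw [landmarkMeasure] at hF ⊢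
  rw [integral_prod_symm F hF, integral_count]

/-- The integrand is dominated by the constant `C` times the integrable product of `f` and `w`. -/
theorem IsIntensity.integrable_mul_prod {α β : Type*} [MeasurableSpace α] [MeasurableSpace β]
    {μ : Measure α} {ν : Measure β} [SFinite μ] [SFinite ν] {f : α → ℝ} {w : β → ℝ}
    (hf : IsIntensity μ f) (hw : IsIntensity ν w) {h : α → β → ℝ}
    (hm : Measurable fun p : α × β => h p.1 p.2) (h0 : ∀ a b, 0 ≤ h a b)
    (hb : ∃ C, ∀ a b, h a b ≤ C) :
    Integrable (fun p : α × β => f p.1 * (w p.2 * h p.1 p.2)) (μ.prod ν) := by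
  obtain ⟨C, hC⟩ := hb
  refine ((hf.integrable.mul_prod hw.integrable).mul_bdd (c := C) hm.aestronglyMeasurable
    (Filter.Eventually.of_forall fun p => ?_)).congr
    (Filter.Eventually.of_forall fun p => mul_assoc _ _ _)
  rw [Real.norm_of_nonneg (h0 _ _)]
  exact hC _ _

/-- Averaging over the vehicle state commutes with integration over landmarks. -/
theorem integral_mul_integral_landmark {S : Type*} [MeasurableSpace S] {ν : Measure S} [SFinite ν]
    {f : S → ℝ} {w : Landmark nx M → ℝ}
    (hf : IsIntensity ν f) (hw : IsIntensity (landmarkMeasure nx M) w)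
    {h : S → Landmark nx M → ℝ}
    (hm : Measurable fun p : S × Landmark nx M => h p.1 p.2) (h0 : ∀ a b, 0 ≤ h a b)
    (hb : ∃ C, ∀ a b, h a b ≤ C) :
    ∫ s, f s * ∫ l, w l * h s l ∂landmarkMeasure nx M ∂ν =
      ∑ m, ∫ x, ∫ s, f s * (w (x, m) * h s (x, m)) ∂ν := by
  have hint := hf.integrable_mul_prod hw hm h0 hb
  rw [← integral_landmarkMeasure (F := fun l => ∫ s, f s * (w l * h s l) ∂ν) hint.integral_prod_right,
    ← integral_integral_swap (f := fun s l => f s * (w l * h s l)) hint]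
  simp only [integral_const_mul]

end Landmarks

/-! ### The update functions of the model: bounds, measurability and closed forms. -/

namespace SlamModel

open scoped Classical

variable {ns nx nz I J : ℕ} {M : Type*} [Fintype M] [MeasurableSpace M] [DiscreteMeasurableSpace M]
  (𝓜 : SlamModel ns nx nz I M)

theorem g_nonneg (s : Vec ns) (l : Landmark nx M) (y : Vec nz) : 0 ≤ 𝓜.g s l y :=
  (𝓜.g_density s l).nonneg y

theorem detLik_nonneg (s : Vec ns) (l : Landmark nx M) (y : Vec nz) :
    0 ≤ 𝓜.pD s l * 𝓜.g s l y := mul_nonneg (𝓜.pD_mem s l).1 (𝓜.g_nonneg s l y)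

/-- The bound at a fixed measurement is uniform in state and landmark; it makes the integrals of the
detection likelihood over landmarks finite, uniformly in the state. -/
theorem detLik_bounded (y : Vec nz) : ∃ C, 0 ≤ C ∧ ∀ s l, 𝓜.pD s l * 𝓜.g s l y ≤ C := by
  obtain ⟨C, hC⟩ := 𝓜.g_bounded y
  refine ⟨max C 0, le_max_right _ _, fun s l => ?_⟩
  calc 𝓜.pD s l * 𝓜.g s l y ≤ 1 * 𝓜.g s l y :=
        mul_le_mul_of_nonneg_right (𝓜.pD_mem s l).2 (𝓜.g_nonneg s l y)
    _ ≤ max C 0 := by rw [one_mul]; exact (hC s l).trans (le_max_left _ _)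

theorem measurable_detLik : Measurable fun p : (Vec ns × Vec nz) × Landmark nx M =>
    𝓜.pD p.1.1 p.2 * 𝓜.g p.1.1 p.2 p.1.2 :=
  (𝓜.pD_measurable.comp (measurable_fst.fst.prodMk measurable_snd)).mul
    (𝓜.g_measurable.comp (measurable_fst.fst.prodMk (measurable_snd.prodMk measurable_fst.snd)))

theorem measurable_detLik_left (y : Vec nz) : Measurable fun p : Vec ns × Landmark nx M =>
    𝓜.pD p.1 p.2 * 𝓜.g p.1 p.2 y :=
  𝓜.measurable_detLik.comp
    ((measurable_fst.prodMk measurable_const).prodMk measurable_snd)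

theorem measurable_detLik_landmark (s : Vec ns) (y : Vec nz) :
    Measurable fun l => 𝓜.pD s l * 𝓜.g s l y :=
  (𝓜.measurable_detLik_left y).comp (measurable_const.prodMk measurable_id)

theorem misLik_nonneg (s : Vec ns) (l : Landmark nx M) : 0 ≤ 1 - 𝓜.pD s l :=
  sub_nonneg.2 (𝓜.pD_mem s l).2

theorem misLik_le_one (s : Vec ns) (l : Landmark nx M) : 1 - 𝓜.pD s l ≤ 1 :=
  sub_le_self _ (𝓜.pD_mem s l).1

theorem measurable_misLik : Measurable fun p : Vec ns × Landmark nx M => 1 - 𝓜.pD p.1 p.2 :=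
  measurable_const.sub 𝓜.pD_measurable

theorem measurable_misLik_landmark (s : Vec ns) : Measurable fun l => 1 - 𝓜.pD s l :=
  𝓜.measurable_misLik.comp (measurable_const.prodMk measurable_id)

variable {𝓜} in
theorem isIntensity_detLik {w : Landmark nx M → ℝ} (hw : IsIntensity (landmarkMeasure nx M) w)
    (s : Vec ns) (y : Vec nz) :
    IsIntensity (landmarkMeasure nx M) fun l => w l * (𝓜.pD s l * 𝓜.g s l y) :=
  hw.mul_bounded (𝓜.measurable_detLik_landmark s y) (fun l => 𝓜.detLik_nonneg s l y)
    ((𝓜.detLik_bounded y).imp fun _ h => h.2 s)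

variable {𝓜} in
theorem isIntensity_misLik {w : Landmark nx M → ℝ} (hw : IsIntensity (landmarkMeasure nx M) w)
    (s : Vec ns) : IsIntensity (landmarkMeasure nx M) fun l => w l * (1 - 𝓜.pD s l) :=
  hw.mul_bounded (𝓜.measurable_misLik_landmark s) (fun l => 𝓜.misLik_nonneg s l)
    ⟨1, 𝓜.misLik_le_one s⟩

theorem f_intensity (i : Fin I) : IsIntensity (landmarkMeasure nx M) (𝓜.f i) :=
  (𝓜.f_density i).isIntensity

theorem fp_intensity : IsIntensity volume 𝓜.fp := 𝓜.fp_density.isIntensity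

/-! #### The functions `ψ` and `q` as integrals over landmarks -/

theorem psi_eq (y : Vec nz) (s : Vec ns) :
    𝓜.psi y s = 𝓜.c y + ∫ l, 𝓜.lam l * (𝓜.pD s l * 𝓜.g s l y) ∂landmarkMeasure nx M := by
  rw [integral_landmarkMeasure (isIntensity_detLik 𝓜.lam_intensity s y).integrable, psi]
  simp only [mul_assoc, mul_left_comm (𝓜.lam _)]

theorem qDet_eq (i : Fin I) (y : Vec nz) (s : Vec ns) :
    𝓜.qDet i y s =
      𝓜.r i * ∫ l, 𝓜.f i l * (𝓜.pD s l * 𝓜.g s l y) ∂landmarkMeasure nx M := by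
  rw [integral_landmarkMeasure (isIntensity_detLik (𝓜.f_intensity i) s y).integrable, qDet]
  simp only [mul_assoc, mul_left_comm (𝓜.f _ _)]

theorem qMis_eq (i : Fin I) (s : Vec ns) :
    𝓜.qMis i s =
      𝓜.r i * (∫ l, 𝓜.f i l * (1 - 𝓜.pD s l) ∂landmarkMeasure nx M) + 1 - 𝓜.r i := by
  rw [integral_landmarkMeasure (isIntensity_misLik (𝓜.f_intensity i) s).integrable, qMis]
  simp only [mul_comm]

theorem psi_nonneg (y : Vec nz) (s : Vec ns) : 0 ≤ 𝓜.psi y s := by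
  rw [psi_eq]
  exact add_nonneg (𝓜.c_intensity.nonneg y)
    (integral_nonneg (isIntensity_detLik 𝓜.lam_intensity s y).nonneg)

theorem qDet_nonneg (i : Fin I) (y : Vec nz) (s : Vec ns) : 0 ≤ 𝓜.qDet i y s := by
  rw [qDet_eq]
  exact mul_nonneg (𝓜.r_mem i).1
    (integral_nonneg (isIntensity_detLik (𝓜.f_intensity i) s y).nonneg)

theorem qMis_nonneg (i : Fin I) (s : Vec ns) : 0 ≤ 𝓜.qMis i s := by
  rw [qMis_eq, add_sub_assoc]
  exact add_nonneg (mul_nonneg (𝓜.r_mem i).1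
    (integral_nonneg (isIntensity_misLik (𝓜.f_intensity i) s).nonneg))
    (sub_nonneg.2 (𝓜.r_mem i).2)

theorem q_nonneg (i : Fin I) (W : Finset (Vec nz)) (s : Vec ns) : 0 ≤ 𝓜.q i W s := by
  unfold q
  split_ifs
  · exact 𝓜.qMis_nonneg i s
  · exact Finset.prod_nonneg fun y _ => 𝓜.qDet_nonneg i y s
  · exact le_rfl

theorem integral_detLik_le {w : Landmark nx M → ℝ} (hw : IsIntensity (landmarkMeasure nx M) w)
    (y : Vec nz) : ∃ C, ∀ s, ∫ l, w l * (𝓜.pD s l * 𝓜.g s l y) ∂landmarkMeasure nx M ≤ C := by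
  obtain ⟨C, hC0, hC⟩ := 𝓜.detLik_bounded y
  refine ⟨∫ l, w l * C ∂landmarkMeasure nx M, fun s => ?_⟩
  exact integral_mono (isIntensity_detLik hw s y).integrable (hw.integrable.mul_const C)
    fun l => mul_le_mul_of_nonneg_left (hC s l) (hw.nonneg l)

theorem psi_bounded (y : Vec nz) : ∃ C, ∀ s, 𝓜.psi y s ≤ C := by
  obtain ⟨C, hC⟩ := 𝓜.integral_detLik_le 𝓜.lam_intensity y
  exact ⟨𝓜.c y + C, fun s => by rw [psi_eq]; linarith [hC s]⟩

theorem qDet_bounded (i : Fin I) (y : Vec nz) : ∃ C, ∀ s, 𝓜.qDet i y s ≤ C := by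
  obtain ⟨C, hC⟩ := 𝓜.integral_detLik_le (𝓜.f_intensity i) y
  exact ⟨𝓜.r i * C, fun s => by
    rw [qDet_eq]; exact mul_le_mul_of_nonneg_left (hC s) (𝓜.r_mem i).1⟩

theorem qMis_le_one (i : Fin I) (s : Vec ns) : 𝓜.qMis i s ≤ 1 := by
  have h : ∫ l, 𝓜.f i l * (1 - 𝓜.pD s l) ∂landmarkMeasure nx M ≤ 1 := by
    refine le_of_le_of_eq ?_ (𝓜.f_density i).integral_eq_one
    exact integral_mono (isIntensity_misLik (𝓜 := 𝓜) (𝓜.f_intensity i) s).integrable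
      (𝓜.f_intensity i).integrable fun l =>
      mul_le_of_le_one_right ((𝓜.f_intensity i).nonneg l) (𝓜.misLik_le_one s l)
  rw [qMis_eq]
  nlinarith [(𝓜.r_mem i).1]

theorem q_bounded (i : Fin I) (W : Finset (Vec nz)) : ∃ C, ∀ s, 𝓜.q i W s ≤ C := by
  unfold q
  split_ifs with h0 h1
  · exact ⟨1, 𝓜.qMis_le_one i⟩
  · obtain ⟨y, rfl⟩ := Finset.card_eq_one.1 h1
    simpa using 𝓜.qDet_bounded i y
  · exact ⟨0, fun _ => le_rfl⟩

theorem measurable_integral_detLik {w : Landmark nx M → ℝ} (hw : Measurable w) :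
    Measurable fun p : Vec ns × Vec nz =>
      ∫ l, w l * (𝓜.pD p.1 l * 𝓜.g p.1 l p.2) ∂landmarkMeasure nx M :=
  (StronglyMeasurable.integral_prod_right' (f := fun p : (Vec ns × Vec nz) × Landmark nx M =>
    w p.2 * (𝓜.pD p.1.1 p.2 * 𝓜.g p.1.1 p.2 p.1.2))
    ((hw.comp measurable_snd).mul 𝓜.measurable_detLik).stronglyMeasurable).measurable

theorem measurable_psi : Measurable fun p : Vec ns × Vec nz => 𝓜.psi p.2 p.1 := by
  simp only [psi_eq]
  exact (𝓜.c_intensity.measurable.comp measurable_snd).add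
    (𝓜.measurable_integral_detLik 𝓜.lam_intensity.measurable)

theorem measurable_qDet (i : Fin I) : Measurable fun p : Vec ns × Vec nz => 𝓜.qDet i p.2 p.1 := by
  simp only [qDet_eq]
  exact (𝓜.measurable_integral_detLik (𝓜.f_intensity i).measurable).const_mul _

theorem measurable_qMis (i : Fin I) : Measurable (𝓜.qMis i) := by
  have : 𝓜.qMis i = fun s => 𝓜.r i *
      (∫ l, 𝓜.f i l * (1 - 𝓜.pD s l) ∂landmarkMeasure nx M) + 1 - 𝓜.r i :=
    funext (𝓜.qMis_eq i)
  rw [this]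
  refine Measurable.sub_const (Measurable.add_const (Measurable.const_mul ?_ _) _) _
  exact (StronglyMeasurable.integral_prod_right' (f := fun p : Vec ns × Landmark nx M =>
    𝓜.f i p.2 * (1 - 𝓜.pD p.1 p.2)) (((𝓜.f_intensity i).measurable.comp measurable_snd).mul
      𝓜.measurable_misLik).stronglyMeasurable).measurable

theorem measurable_psi_left (y : Vec nz) : Measurable (𝓜.psi y) :=
  𝓜.measurable_psi.comp (measurable_id.prodMk measurable_const)

theorem measurable_psi_right (s : Vec ns) : Measurable fun y => 𝓜.psi y s :=
  𝓜.measurable_psi.comp (measurable_const.prodMk measurable_id)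

theorem measurable_q (i : Fin I) (W : Finset (Vec nz)) : Measurable (𝓜.q i W) := by
  unfold q
  split_ifs with h0 h1
  · exact 𝓜.measurable_qMis i
  · exact Finset.measurable_fun_prod _ fun y _ =>
      (𝓜.measurable_qDet i).comp (measurable_id.prodMk measurable_const)
  · exact measurable_const

/-- Integration over measurements of the detection part of the intensity. -/
theorem integral_detLik_measurement {w : Landmark nx M → ℝ}
    (hw : IsIntensity (landmarkMeasure nx M) w) (s : Vec ns) :
    Integrable (fun y => ∫ l, w l * (𝓜.pD s l * 𝓜.g s l y) ∂landmarkMeasure nx M) ∧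
    ∫ y, ∫ l, w l * (𝓜.pD s l * 𝓜.g s l y) ∂landmarkMeasure nx M =
      ∫ l, w l * 𝓜.pD s l ∂landmarkMeasure nx M := by
  have hpD : Measurable (𝓜.pD s) := 𝓜.pD_measurable.comp (measurable_const.prodMk measurable_id)
  have hwp : IsIntensity (landmarkMeasure nx M) fun l => w l * 𝓜.pD s l :=
    hw.mul_bounded hpD (fun l => (𝓜.pD_mem s l).1) ⟨1, fun l => (𝓜.pD_mem s l).2⟩
  have hm : Measurable fun p : Landmark nx M × Vec nz =>
      w p.1 * (𝓜.pD s p.1 * 𝓜.g s p.1 p.2) :=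
    (hw.measurable.comp measurable_fst).mul (𝓜.measurable_detLik.comp
      ((measurable_const.prodMk measurable_snd).prodMk measurable_fst))
  -- The likelihood is a density in the measurement, so only `w * pD` survives; integrability on the
  -- product space reduces to that of this function.
  have hval : ∀ l, ∫ y, w l * (𝓜.pD s l * 𝓜.g s l y) = w l * 𝓜.pD s l := fun l => by
    rw [integral_const_mul, integral_const_mul, (𝓜.g_density s l).integral_eq_one, mul_one]
  have hint : Integrable (fun p : Landmark nx M × Vec nz =>
      w p.1 * (𝓜.pD s p.1 * 𝓜.g s p.1 p.2)) ((landmarkMeasure nx M).prod volume) := by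
    refine (integrable_prod_iff hm.aestronglyMeasurable).2 ⟨Filter.Eventually.of_forall fun l => ?_,
      hwp.integrable.congr (Filter.Eventually.of_forall fun l => ?_)⟩
    · exact ((𝓜.g_density s l).integrable.const_mul (𝓜.pD s l)).const_mul (w l)
    · dsimp only
      rw [← hval l]
      refine integral_congr_ae (Filter.Eventually.of_forall fun y => ?_)
      exact (Real.norm_of_nonneg (mul_nonneg (hw.nonneg l) (𝓜.detLik_nonneg s l y))).symm
  refine ⟨hint.integral_prod_right, ?_⟩
  rw [← integral_integral_swap (f := fun l y => w l * (𝓜.pD s l * 𝓜.g s l y)) hint]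
  simp only [hval]

theorem psi_intensity (s : Vec ns) : IsIntensity volume fun y => 𝓜.psi y s := by
  refine ⟨𝓜.measurable_psi_right s, fun y => 𝓜.psi_nonneg y s, ?_⟩
  simp only [psi_eq]
  exact 𝓜.c_intensity.integrable.add (𝓜.integral_detLik_measurement 𝓜.lam_intensity s).1

/-- The mean number of measurements from clutter and from the Poisson landmarks, the total that
appears in the exponent of the Poisson update. -/
theorem integral_psi (s : Vec ns) :
    ∫ y, 𝓜.psi y s = (∫ y, 𝓜.c y) + ∫ l, 𝓜.lam l * 𝓜.pD s l ∂landmarkMeasure nx M := by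
  simp only [psi_eq]
  rw [integral_add 𝓜.c_intensity.integrable
    (𝓜.integral_detLik_measurement 𝓜.lam_intensity s).1,
    (𝓜.integral_detLik_measurement 𝓜.lam_intensity s).2]

theorem measurable_integral_psi : Measurable fun s => ∫ y, 𝓜.psi y s :=
  (StronglyMeasurable.integral_prod_right' 𝓜.measurable_psi.stronglyMeasurable).measurable

theorem integral_psi_nonneg (s : Vec ns) : 0 ≤ ∫ y, 𝓜.psi y s :=
  integral_nonneg fun y => 𝓜.psi_nonneg y s

/-! #### Set integrals of the update -/

/-- Measurement set density of one landmark as an element of the convolution algebra. -/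
def singleFn (s : Vec ns) (l : Landmark nx M) : SetFn (Vec nz) := ⟨𝓜.single s l⟩

theorem single_empty (s : Vec ns) (l : Landmark nx M) : 𝓜.single s l ∅ = 1 - 𝓜.pD s l := by
  simp [single]

theorem single_singleton (s : Vec ns) (l : Landmark nx M) (y : Vec nz) :
    𝓜.single s l {y} = 𝓜.pD s l * 𝓜.g s l y := by
  simp [single]

theorem single_of_one_lt (s : Vec ns) (l : Landmark nx M) (W : Finset (Vec nz))
    (hW : 1 < W.card) : 𝓜.single s l W = 0 := by
  rw [single, if_neg (by omega), if_neg (by omega)]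

theorem empty_or_singleton_or_one_lt {γ : Type*} (W : Finset γ) :
    W = ∅ ∨ (∃ y, W = {y}) ∨ 1 < W.card := by
  rw [← Finset.card_eq_zero, ← Finset.card_eq_one]; omega

theorem single_nonneg (s : Vec ns) (l : Landmark nx M) (W : Finset (Vec nz)) :
    0 ≤ 𝓜.single s l W := by
  rcases empty_or_singleton_or_one_lt W with rfl | ⟨y, rfl⟩ | h
  · rw [single_empty]; exact 𝓜.misLik_nonneg s l
  · rw [single_singleton]; exact 𝓜.detLik_nonneg s l y
  · rw [single_of_one_lt _ _ _ _ h]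

theorem measurable_single (s : Vec ns) (W : Finset (Vec nz)) :
    Measurable fun l => 𝓜.single s l W := by
  rcases empty_or_singleton_or_one_lt W with rfl | ⟨y, rfl⟩ | h
  · simp only [single_empty]; exact 𝓜.measurable_misLik_landmark s
  · simp only [single_singleton]; exact 𝓜.measurable_detLik_landmark s y
  · simp only [single_of_one_lt _ _ _ _ h]; exact measurable_const

theorem single_bounded (s : Vec ns) (W : Finset (Vec nz)) : ∃ C, ∀ l, 𝓜.single s l W ≤ C := by
  rcases empty_or_singleton_or_one_lt W with rfl | ⟨y, rfl⟩ | h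
  · simp only [single_empty]; exact ⟨1, 𝓜.misLik_le_one s⟩
  · simp only [single_singleton]; exact (𝓜.detLik_bounded y).imp fun _ h => h.2 s
  · simp only [single_of_one_lt _ _ _ _ h]; exact ⟨0, fun _ => le_rfl⟩

theorem likelihood_eq (Z : Finset (Vec nz)) (s : Vec ns) (X : Finset (Landmark nx M)) :
    𝓜.likelihood Z s X = unionDensity ⟨poisson volume 𝓜.c⟩ (𝓜.singleFn s) X Z := by
  rw [unionDensity, ← Finset.prod_coe_sort]
  exact sum_decomps_option_prod (poisson volume 𝓜.c)
    (fun l : {l // l ∈ X} => 𝓜.single s l.1) Z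

theorem prior_eq (X : Finset (Landmark nx M)) :
    𝓜.prior X = (⟨poisson (landmarkMeasure nx M) 𝓜.lam⟩ *
      ∏ i, ⟨bernoulli (𝓜.r i) (𝓜.f i)⟩ : SetFn (Landmark nx M)) X :=
  sum_decomps_option_prod (poisson (landmarkMeasure nx M) 𝓜.lam)
    (fun i => bernoulli (𝓜.r i) (𝓜.f i)) X

theorem bernoulliUpdate_eq (i : Fin I) (W : Finset (Vec nz)) (s : Vec ns) :
    bernoulliUpdate (landmarkMeasure nx M) (𝓜.singleFn s) (𝓜.r i) (𝓜.f i) W = 𝓜.q i W s := by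
  rcases empty_or_singleton_or_one_lt W with rfl | ⟨y, rfl⟩ | h
  · simp only [bernoulliUpdate, singleFn, single_empty, q, Finset.card_empty, if_true, qMis_eq,
      mul_assoc, integral_const_mul]
    ring
  · simp only [bernoulliUpdate, singleFn, single_singleton, q, Finset.card_singleton, qDet_eq,
      mul_assoc, integral_const_mul]
    simp
  · rw [bernoulliUpdate_of_one_lt (fun l W => 𝓜.single_of_one_lt s l W) _ _ _ h, q,
      if_neg (by omega), if_neg (by omega)]

theorem poisson_nonneg {γ : Type*} [MeasurableSpace γ] {ν : Measure γ} {φ : γ → ℝ}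
    (hφ : ∀ x, 0 ≤ φ x) (X : Finset γ) : 0 ≤ poisson ν φ X :=
  mul_nonneg (Real.exp_pos _).le (Finset.prod_nonneg fun x _ => hφ x)

variable [NeZero nx]

/-- Clutter contributes `-∫ c` to the exponent, and the prior contributes `∫ lam * (1 - pD) - ∫ lam
= -∫ lam * pD`; by `integral_psi` the sum is `-∫ ψ`. -/
theorem hasSetIntegral_poisson (W : Finset (Vec nz)) (s : Vec ns) :
    HasSetIntegral (landmarkMeasure nx M)
      (fun X => poisson (landmarkMeasure nx M) 𝓜.lam X *
        unionDensity ⟨poisson volume 𝓜.c⟩ (𝓜.singleFn s) X W)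
      (Real.exp (-∫ y, 𝓜.psi y s) * ∏ y ∈ W, 𝓜.psi y s) := by
  refine (hasSetIntegral_poisson_update (poisson_nonneg 𝓜.c_intensity.nonneg)
    (fun l => 𝓜.single_of_one_lt s l) (fun l => 𝓜.single_nonneg s l) (𝓜.measurable_single s)
    (𝓜.single_bounded s) 𝓜.c_intensity.nonneg (fun z W hz => poisson_insert volume 𝓜.c hz)
    𝓜.lam_intensity W).congr (fun _ => rfl) ?_
  have hlp : Integrable (fun l => 𝓜.lam l * 𝓜.pD s l) (landmarkMeasure nx M) := by
    have := 𝓜.lam_intensity.integrable.sub (isIntensity_misLik (𝓜 := 𝓜) 𝓜.lam_intensity s).integrable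
    refine this.congr (Filter.Eventually.of_forall fun l => ?_)
    simp only [Pi.sub_apply]; ring
  simp only [singleFn, single_empty, single_singleton, psi_eq, mul_sub, mul_one, poisson,
    Finset.prod_empty]
  rw [integral_sub 𝓜.lam_intensity.integrable hlp, ← Real.exp_add]
  simp only [← psi_eq, integral_psi]
  congr 2
  ring

theorem qU_eq (W : Finset (Vec nz)) (s : Vec ns) :
    𝓜.qU W s = Real.exp (-∫ y, 𝓜.psi y s) * ∏ y ∈ W, 𝓜.psi y s := by
  rw [qU]
  simp only [likelihood_eq]
  exact (𝓜.hasSetIntegral_poisson W s).setIntegral_eq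

theorem qB_eq (i : Fin I) (W : Finset (Vec nz)) (s : Vec ns) : 𝓜.qB i W s = 𝓜.q i W s := by
  rw [← bernoulliUpdate_eq]
  exact (hasSetIntegral_bernoulli_update (φ := 𝓜.singleFn s) (fun l => 𝓜.single_nonneg s l) (𝓜.measurable_single s)
    (𝓜.single_bounded s) (𝓜.r_mem i) (𝓜.f_intensity i) W).setIntegral_eq

/-- The exponential factor depends on the state but not on the association, so it can be pulled out
of every sum over associations. -/
theorem condUnnorm_eq (A : Option (Fin I) → Finset (Vec nz)) (s : Vec ns) :
    𝓜.condUnnorm A s = Real.exp (-∫ y, 𝓜.psi y s) * 𝓜.Phi A s := by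
  simp only [condUnnorm, qU_eq, qB_eq, Phi]; ring

/-- Integration over landmarks turns the convolution of the prior components into the convolution of
their updates, and the value of the latter at `Z` is a sum over the decompositions of `Z`. -/
theorem postUnnorm_eq (Z : Finset (Vec nz)) (s : Vec ns) :
    𝓜.postUnnorm Z s = ∑ A ∈ decomps (Option (Fin I)) Z, 𝓜.condUnnorm A s := by
  have h := hasSetIntegral_prod_bernoulli_update (fun l => 𝓜.single_of_one_lt s l)
    (fun l => 𝓜.single_nonneg s l) (𝓜.measurable_single s) (𝓜.single_bounded s) Finset.univ
    𝓜.r_mem 𝓜.f_intensity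
    (F := ⟨poisson (landmarkMeasure nx M) 𝓜.lam⟩) (v := ⟨fun W => 𝓜.qU W s⟩)
    (fun W => (𝓜.hasSetIntegral_poisson W s).congr (fun _ => rfl) (𝓜.qU_eq W s).symm) Z
  rw [postUnnorm]
  simp only [likelihood_eq, prior_eq]
  have h' := sum_decomps_option_prod (fun W => 𝓜.qU W s) (fun i => (bernoulliUpdate
    (landmarkMeasure nx M) (𝓜.singleFn s) (𝓜.r i) (𝓜.f i)).toFun) Z
  rw [h.setIntegral_eq, ← h', Finset.mul_sum]
  refine Finset.sum_congr rfl fun A _ => ?_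
  simp only [bernoulliUpdate_eq, condUnnorm, qB_eq, mul_assoc]

end SlamModel

/-! ### Comparison of mixtures and of normalised weights. -/

theorem exists_prod_le {ι S : Type*} (t : Finset ι) {f : ι → S → ℝ} (h0 : ∀ i s, 0 ≤ f i s)
    (hb : ∀ i, ∃ C, ∀ s, f i s ≤ C) : ∃ C, ∀ s, ∏ i ∈ t, f i s ≤ C := by
  choose C hC using hb
  exact ⟨∏ i ∈ t, C i, fun s => Finset.prod_le_prod (fun i _ => h0 i s) fun i _ => hC i s⟩

/-- Two mixtures of the same normalised functions are as close as their weights. -/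
theorem integral_abs_mixture_sub_le {S ι : Type*} [MeasurableSpace S] {μ : Measure S}
    (t : Finset ι) {φ : ι → S → ℝ} (h0 : ∀ i s, 0 ≤ φ i s) (hi : ∀ i, Integrable (φ i) μ)
    (a b : ι → ℝ) :
    ∫ s, |(∑ i ∈ t, a i * (φ i s / ∫ s', φ i s' ∂μ)) -
        ∑ i ∈ t, b i * (φ i s / ∫ s', φ i s' ∂μ)| ∂μ ≤ ∑ i ∈ t, |a i - b i| := by
  have hn : ∀ i, 0 ≤ ∫ s', φ i s' ∂μ := fun i => integral_nonneg (h0 i)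
  -- Only an inequality: a component with vanishing integral is divided by zero and gets mass `0`.
  have hle : ∀ i, ∫ s, φ i s / ∫ s', φ i s' ∂μ ∂μ ≤ 1 := fun i => by
    rw [integral_div]; exact div_self_le_one _
  have hii : ∀ i, Integrable (fun s => |a i - b i| * (φ i s / ∫ s', φ i s' ∂μ)) μ := fun i =>
    ((hi i).div_const _).const_mul _
  calc _ ≤ ∫ s, ∑ i ∈ t, |a i - b i| * (φ i s / ∫ s', φ i s' ∂μ) ∂μ := by
        refine integral_mono_of_nonneg (Filter.Eventually.of_forall fun s => abs_nonneg _)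
          (integrable_finsetSum _ fun i _ => hii i) (Filter.Eventually.of_forall fun s => ?_)
        dsimp only
        rw [← Finset.sum_sub_distrib]
        refine (Finset.abs_sum_le_sum_abs _ _).trans_eq (Finset.sum_congr rfl fun i _ => ?_)
        rw [← sub_mul, abs_mul, abs_of_nonneg (div_nonneg (h0 i s) (hn i))]
    _ = ∑ i ∈ t, |a i - b i| * ∫ s, φ i s / ∫ s', φ i s' ∂μ ∂μ := by
        rw [integral_finsetSum _ fun i _ => hii i]
        simp only [integral_const_mul]
    _ ≤ ∑ i ∈ t, |a i - b i| := Finset.sum_le_sum fun i _ =>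
        mul_le_of_le_one_right (abs_nonneg _) (hle i)

/-- Normalised weights are close if the weights are relatively close up to a common factor. -/
theorem sum_abs_normalised_sub_le {ι : Type*} (t : Finset ι) {N W : ι → ℝ} (hW0 : ∀ i ∈ t, 0 ≤ W i)
    (hW : 0 < ∑ i ∈ t, W i) {K ε : ℝ} (hK : 0 < K) (hε : ε < 1)
    (h : ∀ i ∈ t, |N i - K * W i| ≤ ε * (K * W i)) :
    ∑ i ∈ t, |N i / (∑ j ∈ t, N j) - W i / ∑ j ∈ t, W j| ≤ 2 * ε / (1 - ε) := by
  set w := ∑ j ∈ t, W j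
  set n := ∑ j ∈ t, N j
  have hKw : 0 < K * w := mul_pos hK hW
  have hsum : ∑ i ∈ t, |N i - K * W i| ≤ ε * (K * w) := by
    rw [Finset.mul_sum, Finset.mul_sum]; exact Finset.sum_le_sum h
  -- Since `K * w > 0`, a negative `ε` would bound a sum of absolute values by a negative number.
  have hε0 : 0 ≤ ε := by
    by_contra hneg
    have := (Finset.sum_nonneg fun i (_ : i ∈ t) => abs_nonneg (N i - K * W i)).trans hsum
    nlinarith
  have hdiff : |n - K * w| ≤ ε * (K * w) := by
    rw [Finset.mul_sum, ← Finset.sum_sub_distrib, ← Finset.mul_sum]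
    exact (Finset.abs_sum_le_sum_abs _ _).trans hsum
  have hn : (1 - ε) * (K * w) ≤ n := by linarith [(abs_le.1 hdiff).1]
  have hn0 : 0 < n := lt_of_lt_of_le (mul_pos (by linarith) hKw) hn
  have key : ∀ i ∈ t, |N i / n - W i / w| ≤ |N i - K * W i| / n + W i / w * (|n - K * w| / n) := by
    intro i hi
    -- The error is split into that of the single weight and that of the normalisation; after
    -- summation each is at most `ε * (K * w) / n`.
    have e : N i / n - W i / w = (N i - K * W i) / n - W i / w * ((n - K * w) / n) := by
      field_simp; ring
    rw [e]
    refine (abs_sub _ _).trans_eq ?_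
    rw [abs_div, abs_mul, abs_div (n - K * w), abs_of_pos hn0,
      abs_of_nonneg (div_nonneg (hW0 i hi) hW.le)]
  calc _ ≤ ∑ i ∈ t, (|N i - K * W i| / n + W i / w * (|n - K * w| / n)) := Finset.sum_le_sum key
    _ = (∑ i ∈ t, |N i - K * W i|) / n + |n - K * w| / n := by
        rw [Finset.sum_add_distrib, ← Finset.sum_mul, ← Finset.sum_div, ← Finset.sum_div,
          div_self hW.ne', one_mul]
    _ ≤ ε * (K * w) / n + ε * (K * w) / n := by gcongr
    _ = 2 * ε * (K * w) / n := by ring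
    _ ≤ 2 * ε / (1 - ε) := by
        rw [div_le_div_iff₀ hn0 (by linarith)]
        nlinarith

/-! ### The posterior and the first form as mixtures over associations. -/

namespace SlamModel

variable {ns nx nz I J : ℕ} {M : Type*} [Fintype M] [MeasurableSpace M] [DiscreteMeasurableSpace M]
  (𝓜 : SlamModel ns nx nz I M)

/-! #### Averages over the predicted vehicle density -/

theorem integrable_fp_psi (y : Vec nz) : Integrable fun s => 𝓜.fp s * 𝓜.psi y s :=
  (𝓜.fp_intensity.mul_bounded (𝓜.measurable_psi_left y) (𝓜.psi_nonneg y)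
    (𝓜.psi_bounded y)).integrable

theorem integrable_fp_q (i : Fin I) (W : Finset (Vec nz)) :
    Integrable fun s => 𝓜.fp s * 𝓜.q i W s :=
  (𝓜.fp_intensity.mul_bounded (𝓜.measurable_q i W) (𝓜.q_nonneg i W)
    (𝓜.q_bounded i W)).integrable

theorem integral_fp_detLik {w : Landmark nx M → ℝ} (hw : IsIntensity (landmarkMeasure nx M) w)
    (y : Vec nz) :
    Integrable (fun s => 𝓜.fp s *
      ∫ l, w l * (𝓜.pD s l * 𝓜.g s l y) ∂landmarkMeasure nx M) ∧
    ∫ s, 𝓜.fp s * ∫ l, w l * (𝓜.pD s l * 𝓜.g s l y) ∂landmarkMeasure nx M =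
      ∑ m, ∫ x, ∫ s, 𝓜.pD s (x, m) * (𝓜.fp s * w (x, m)) * 𝓜.g s (x, m) y := by
  constructor
  · exact (𝓜.fp_intensity.mul_bounded ((𝓜.measurable_integral_detLik hw.measurable).comp
      (measurable_id.prodMk measurable_const))
      (fun s => integral_nonneg (isIntensity_detLik hw s y).nonneg)
      (𝓜.integral_detLik_le hw y)).integrable
  · rw [integral_mul_integral_landmark 𝓜.fp_intensity hw (𝓜.measurable_detLik_left y)
      (fun s l => 𝓜.detLik_nonneg s l y)
      ((𝓜.detLik_bounded y).imp fun _ h => h.2)]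
    simp only [mul_assoc, mul_left_comm (𝓜.fp _)]
    simp only [mul_left_comm (w _)]

theorem integral_fp_psi (y : Vec nz) : ∫ s, 𝓜.fp s * 𝓜.psi y s = 𝓜.nu y := by
  simp only [psi_eq, mul_add, nu]
  rw [integral_add (𝓜.fp_density.integrable.mul_const _)
    (𝓜.integral_fp_detLik 𝓜.lam_intensity y).1, integral_mul_const, 𝓜.fp_density.integral_eq_one,
    one_mul, (𝓜.integral_fp_detLik 𝓜.lam_intensity y).2, add_comm]

theorem integral_fp_qDet (i : Fin I) (y : Vec nz) :
    ∫ s, 𝓜.fp s * 𝓜.qDet i y s = 𝓜.nuDet i y := by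
  simp only [qDet_eq, mul_left_comm _ (𝓜.r i), nuDet]
  rw [integral_const_mul, (𝓜.integral_fp_detLik (𝓜.f_intensity i) y).2]

theorem integral_fp_qMis (i : Fin I) : ∫ s, 𝓜.fp s * 𝓜.qMis i s = 𝓜.nuMis i := by
  have hint : Integrable fun s => 𝓜.fp s *
      ∫ l, 𝓜.f i l * (1 - 𝓜.pD s l) ∂landmarkMeasure nx M :=
    ((𝓜.fp_intensity.integrable_mul_prod (𝓜.f_intensity i) 𝓜.measurable_misLik 𝓜.misLik_nonneg
      ⟨1, 𝓜.misLik_le_one⟩).integral_prod_left).congr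
      (Filter.Eventually.of_forall fun s => by simp only [integral_const_mul])
  have e : ∀ s, 𝓜.fp s * 𝓜.qMis i s = 𝓜.fp s * (1 - 𝓜.r i) +
      𝓜.r i * (𝓜.fp s * ∫ l, 𝓜.f i l * (1 - 𝓜.pD s l) ∂landmarkMeasure nx M) := fun s => by
    rw [qMis_eq]; ring
  simp only [e, nuMis]
  rw [integral_add (𝓜.fp_density.integrable.mul_const _) (hint.const_mul _), integral_mul_const,
    𝓜.fp_density.integral_eq_one, one_mul, integral_const_mul,
    integral_mul_integral_landmark 𝓜.fp_intensity (𝓜.f_intensity i) 𝓜.measurable_misLik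
      𝓜.misLik_nonneg ⟨1, 𝓜.misLik_le_one⟩]
  congr 3
  simp only [mul_comm, mul_left_comm]

theorem integral_fp_q (i : Fin I) (W : Finset (Vec nz)) :
    ∫ s, 𝓜.fp s * 𝓜.q i W s = 𝓜.nuB i W := by
  rcases empty_or_singleton_or_one_lt W with rfl | ⟨y, rfl⟩ | h
  · simpa [q, nuB] using 𝓜.integral_fp_qMis i
  · simpa [q, nuB] using 𝓜.integral_fp_qDet i y
  · have h0 : W.card ≠ 0 := by omega
    have h1 : W.card ≠ 1 := by omega
    simp [q, nuB, h0, h1]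

theorem nu_nonneg (y : Vec nz) : 0 ≤ 𝓜.nu y := by
  rw [← integral_fp_psi]
  exact integral_nonneg fun s => mul_nonneg (𝓜.fp_density.nonneg s) (𝓜.psi_nonneg y s)

theorem nuB_nonneg (i : Fin I) (W : Finset (Vec nz)) : 0 ≤ 𝓜.nuB i W := by
  rw [← integral_fp_q]
  exact integral_nonneg fun s => mul_nonneg (𝓜.fp_density.nonneg s) (𝓜.q_nonneg i W s)

theorem weight_nonneg (A : Option (Fin I) → Finset (Vec nz)) : 0 ≤ 𝓜.weight A :=
  mul_nonneg (Finset.prod_nonneg fun y _ => 𝓜.nu_nonneg y)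
    (Finset.prod_nonneg fun i _ => 𝓜.nuB_nonneg i _)

/-! #### Densities conditioned on an association -/

theorem Phi_intensity (A : Option (Fin I) → Finset (Vec nz)) : IsIntensity volume (𝓜.Phi A) := by
  have h1 : ∀ s, 0 ≤ ∏ z ∈ A none, 𝓜.psi z s := fun s =>
    Finset.prod_nonneg fun y _ => 𝓜.psi_nonneg y s
  have h2 : ∀ s, 0 ≤ ∏ i, 𝓜.q i (A (some i)) s := fun s =>
    Finset.prod_nonneg fun i _ => 𝓜.q_nonneg i _ s
  exact (𝓜.fp_intensity.mul_bounded
    (Finset.measurable_fun_prod _ fun y _ => 𝓜.measurable_psi_left y) h1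
    (exists_prod_le _ 𝓜.psi_nonneg 𝓜.psi_bounded)).mul_bounded
    (Finset.measurable_fun_prod _ fun i _ => 𝓜.measurable_q i _) h2
    (exists_prod_le _ (fun i s => 𝓜.q_nonneg i (A (some i)) s) fun i => 𝓜.q_bounded i _)

/-- Some factor `nu` or `nuB` of the weight is zero. It is the integral of the nonnegative function
`fp * psi` or `fp * q`, so that product vanishes almost everywhere, and `Phi` contains both of its
factors. -/
theorem Phi_ae_zero {A : Option (Fin I) → Finset (Vec nz)} (hA : 𝓜.weight A = 0) :
    ∀ᵐ s, 𝓜.Phi A s = 0 := by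
  rw [weight, mul_eq_zero, Finset.prod_eq_zero_iff, Finset.prod_eq_zero_iff] at hA
  rcases hA with ⟨y, hy, h0⟩ | ⟨i, hi, h0⟩
  · rw [← integral_fp_psi, integral_eq_zero_iff_of_nonneg (fun s => mul_nonneg
      (𝓜.fp_density.nonneg s) (𝓜.psi_nonneg y s)) (𝓜.integrable_fp_psi y)] at h0
    filter_upwards [h0] with s hs
    rcases mul_eq_zero.1 hs with h | h
    · simp [Phi, h]
    · rw [Phi, Finset.prod_eq_zero hy h, mul_zero, zero_mul]
  · rw [← integral_fp_q, integral_eq_zero_iff_of_nonneg (fun s => mul_nonneg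
      (𝓜.fp_density.nonneg s) (𝓜.q_nonneg i _ s)) (𝓜.integrable_fp_q i _)] at h0
    filter_upwards [h0] with s hs
    rcases mul_eq_zero.1 hs with h | h
    · simp [Phi, h]
    · rw [Phi, Finset.prod_eq_zero hi h, mul_zero]

variable [NeZero nx]

theorem condUnnorm_intensity (A : Option (Fin I) → Finset (Vec nz)) :
    IsIntensity volume (𝓜.condUnnorm A) := by
  have : 𝓜.condUnnorm A = fun s => 𝓜.Phi A s * Real.exp (-∫ y, 𝓜.psi y s) :=
    funext fun s => by rw [condUnnorm_eq, mul_comm]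
  rw [this]
  exact (𝓜.Phi_intensity A).mul_bounded 𝓜.measurable_integral_psi.neg.exp
    (fun s => (Real.exp_pos _).le)
    ⟨1, fun s => Real.exp_le_one_iff.2 (neg_nonpos.2 (𝓜.integral_psi_nonneg s))⟩

theorem normConst_nonneg (A : Option (Fin I) → Finset (Vec nz)) : 0 ≤ 𝓜.normConst A :=
  integral_nonneg (𝓜.condUnnorm_intensity A).nonneg

theorem normConst_eq_zero {A : Option (Fin I) → Finset (Vec nz)} (hA : 𝓜.weight A = 0) :
    𝓜.normConst A = 0 := by
  refine integral_eq_zero_of_ae ?_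
  filter_upwards [𝓜.Phi_ae_zero hA] with s hs
  rw [condUnnorm_eq, hs, mul_zero]; rfl

theorem weight_pos {A : Option (Fin I) → Finset (Vec nz)} (hA : 𝓜.normConst A ≠ 0) :
    0 < 𝓜.weight A :=
  (𝓜.weight_nonneg A).lt_of_ne fun h => hA (𝓜.normConst_eq_zero h.symm)

theorem condUnnorm_ae_zero {A : Option (Fin I) → Finset (Vec nz)} (hA : 𝓜.normConst A = 0) :
    ∀ᵐ s, 𝓜.condUnnorm A s = 0 :=
  (integral_eq_zero_iff_of_nonneg (𝓜.condUnnorm_intensity A).nonneg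
    (𝓜.condUnnorm_intensity A).integrable).1 hA

theorem isIntensity_cond (A : Option (Fin I) → Finset (Vec nz)) :
    IsIntensity volume (𝓜.cond A) := by
  have h := (𝓜.condUnnorm_intensity A).const_mul (inv_nonneg.2 (𝓜.normConst_nonneg A))
  have e : 𝓜.cond A = fun s => (𝓜.normConst A)⁻¹ * 𝓜.condUnnorm A s :=
    funext fun s => by rw [cond, div_eq_inv_mul]
  exact e ▸ h

theorem integral_cond {A : Option (Fin I) → Finset (Vec nz)} (hA : 𝓜.normConst A ≠ 0) :
    ∫ s, 𝓜.cond A s = 1 := by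
  simp only [cond, integral_div]
  exact div_self hA

theorem isDensity_cond {A : Option (Fin I) → Finset (Vec nz)} (hA : 𝓜.normConst A ≠ 0) :
    IsDensity volume (𝓜.cond A) :=
  ⟨(𝓜.isIntensity_cond A).measurable, (𝓜.isIntensity_cond A).nonneg, 𝓜.integral_cond hA⟩

/-- Only a zero constant needs an argument: the integrand is nonnegative with zero integral, hence
zero almost everywhere. -/
theorem normConst_mul_cond_ae :
    ∀ A : Option (Fin I) → Finset (Vec nz),
      ∀ᵐ s, 𝓜.normConst A * 𝓜.cond A s = 𝓜.condUnnorm A s := by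
  intro A
  by_cases hA : 𝓜.normConst A = 0
  · filter_upwards [𝓜.condUnnorm_ae_zero hA] with s hs
    rw [hs, hA, zero_mul]
  · exact Filter.Eventually.of_forall fun s => mul_div_cancel₀ _ hA

/-! #### The exact posterior -/

theorem integral_postUnnorm (Z : Finset (Vec nz)) :
    ∫ s, 𝓜.postUnnorm Z s = ∑ A ∈ decomps (Option (Fin I)) Z, 𝓜.normConst A := by
  simp only [postUnnorm_eq]
  exact integral_finsetSum _ fun A _ => (𝓜.condUnnorm_intensity A).integrable

theorem isDensity_posterior {Z : Finset (Vec nz)} (hZ : ∫ s, 𝓜.postUnnorm Z s ≠ 0) :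
    IsDensity volume (𝓜.posterior Z) where
  measurable := by
    unfold posterior
    simp only [postUnnorm_eq]
    exact (Finset.measurable_fun_sum _ fun A _ =>
      (𝓜.condUnnorm_intensity A).measurable).div_const _
  nonneg s := by
    have h : ∀ s, 0 ≤ 𝓜.postUnnorm Z s := fun s => by
      rw [postUnnorm_eq]
      exact Finset.sum_nonneg fun A _ => (𝓜.condUnnorm_intensity A).nonneg s
    exact div_nonneg (h s) (integral_nonneg h)
  integral_eq_one := by
    simp only [posterior, integral_div]
    exact div_self hZ

theorem posterior_ae_eq (Z : Finset (Vec nz)) :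
    ∀ᵐ s, 𝓜.posterior Z s =
      (∑ A ∈ decomps (Option (Fin I)) Z, 𝓜.normConst A * 𝓜.cond A s) /
        ∑ A ∈ decomps (Option (Fin I)) Z, 𝓜.normConst A := by
  have h : ∀ᵐ s, ∀ A ∈ decomps (Option (Fin I)) Z,
      𝓜.normConst A * 𝓜.cond A s = 𝓜.condUnnorm A s :=
    (Filter.eventually_all_finset _).2 fun A _ => 𝓜.normConst_mul_cond_ae A
  filter_upwards [h] with s hs
  rw [posterior, integral_postUnnorm, postUnnorm_eq, Finset.sum_congr rfl hs]

theorem sum_weight_pos {Z : Finset (Vec nz)} (hZ : ∫ s, 𝓜.postUnnorm Z s ≠ 0) :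
    0 < ∑ A ∈ decomps (Option (Fin I)) Z, 𝓜.weight A := by
  rw [integral_postUnnorm] at hZ
  obtain ⟨A, hA, h⟩ := Finset.exists_ne_zero_of_sum_ne_zero hZ
  exact Finset.sum_pos' (fun A _ => 𝓜.weight_nonneg A) ⟨A, hA, 𝓜.weight_pos h⟩

/-- A component whose exact constant vanishes is identically zero and would lose its share of the
mass; `h` excludes such components with positive weight. -/
theorem isDensity_mixture {Z : Finset (Vec nz)} (hZ : ∫ s, 𝓜.postUnnorm Z s ≠ 0)
    (h : ∀ A ∈ decomps (Option (Fin I)) Z, 𝓜.weight A ≠ 0 → 𝓜.normConst A ≠ 0) :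
    IsDensity volume (𝓜.mixture Z) where
  measurable := (Finset.measurable_fun_sum _ fun A _ =>
    (𝓜.isIntensity_cond A).measurable.const_mul _).div_const _
  nonneg s := div_nonneg (Finset.sum_nonneg fun A _ => mul_nonneg (𝓜.weight_nonneg A)
    ((𝓜.isIntensity_cond A).nonneg s)) (𝓜.sum_weight_pos hZ).le
  integral_eq_one := by
    simp only [mixture, integral_div]
    rw [integral_finsetSum _ fun A _ => (𝓜.isIntensity_cond A).integrable.const_mul _,
      div_eq_one_iff_eq (𝓜.sum_weight_pos hZ).ne']
    refine Finset.sum_congr rfl fun A hA => ?_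
    rw [integral_const_mul]
    by_cases hw : 𝓜.weight A = 0
    · rw [hw, zero_mul]
    · rw [𝓜.integral_cond (h A hA hw), mul_one]

/-- Both functions mix the same components `cond A`, so `integral_abs_mixture_sub_le` applies to the
two families of normalised weights. -/
theorem integral_abs_posterior_sub_mixture_le (Z : Finset (Vec nz)) :
    ∫ s, |𝓜.posterior Z s - 𝓜.mixture Z s| ≤
      ∑ A ∈ decomps (Option (Fin I)) Z,
        |𝓜.normConst A / (∑ B ∈ decomps (Option (Fin I)) Z, 𝓜.normConst B) -
          𝓜.weight A / (∑ B ∈ decomps (Option (Fin I)) Z, 𝓜.weight B)| := by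
  refine le_of_eq_of_le (integral_congr_ae ?_) (integral_abs_mixture_sub_le _
    (fun A => (𝓜.condUnnorm_intensity A).nonneg) (fun A => (𝓜.condUnnorm_intensity A).integrable)
    _ _)
  filter_upwards [𝓜.posterior_ae_eq Z] with s hs
  rw [hs, mixture, Finset.sum_div, Finset.sum_div]
  simp only [mul_div_right_comm, cond, normConst]

end SlamModel

/-! ### Global hypotheses as associations. -/

section GlobalHypotheses

variable {I J nz : ℕ} {z : Fin J → Vec nz}

theorem mem_globalHyps {a : Hyp I J} :
    a ∈ globalHyps I J ↔ ∀ i j, a.1 i = some j ↔ a.2 j = some i := by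
  simp [globalHyps]

theorem mem_measSet {x : Vec nz} : x ∈ measSet z ↔ ∃ j, z j = x := by
  simp [measSet]

theorem mem_measOf {o : Option (Fin J)} {x : Vec nz} :
    x ∈ measOf z o ↔ ∃ j, o = some j ∧ z j = x := by
  cases o <;> simp [measOf, eq_comm]

theorem mem_assoc_none {a : Hyp I J} {x : Vec nz} :
    x ∈ assoc z a none ↔ ∃ j, a.2 j = none ∧ z j = x := by
  simp [assoc, newMeas]

theorem mem_assoc_some {a : Hyp I J} {i : Fin I} {x : Vec nz} :
    x ∈ assoc z a (some i) ↔ ∃ j, a.1 i = some j ∧ z j = x := mem_measOf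

theorem card_measOf_le_one (o : Option (Fin J)) : (measOf z o).card ≤ 1 := by
  cases o <;> simp [measOf]

/-- Global hypotheses are the associations with at most one measurement per landmark. -/
theorem bijOn_assoc (hz : Function.Injective z) :
    Set.BijOn (assoc z) (globalHyps I J : Set (Hyp I J))
      {A | A ∈ decomps (Option (Fin I)) (measSet z) ∧ ∀ i, (A (some i)).card ≤ 1} := by
  classical
  refine ⟨fun a ha => ?_, fun a ha b hb hab => ?_, fun A hA => ?_⟩
  · rw [Finset.mem_coe, mem_globalHyps] at ha
    have hns : ∀ i, Disjoint (assoc z a none) (assoc z a (some i)) := fun i =>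
      Finset.disjoint_left.2 fun x hx hx' => by
        obtain ⟨j, hj, rfl⟩ := mem_assoc_none.1 hx
        obtain ⟨k, hk, hjk⟩ := mem_assoc_some.1 hx'
        rw [hz hjk, ha, hj] at hk
        exact absurd hk (by simp)
    refine ⟨mem_decomps_iff.2 ⟨?_, fun x => ?_⟩, fun i => card_measOf_le_one _⟩
    · rintro (_ | i) (_ | i') hne
      · exact absurd rfl hne
      · exact hns i'
      · exact (hns i).symm
      · refine Finset.disjoint_left.2 fun x hx hx' => hne ?_
        obtain ⟨j, hj, rfl⟩ := mem_assoc_some.1 hx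
        obtain ⟨k, hk, hjk⟩ := mem_assoc_some.1 hx'
        rw [ha] at hj hk
        rw [hz hjk, hj] at hk
        exact hk
    · rw [mem_measSet, Option.exists]
      simp only [mem_assoc_none, mem_assoc_some]
      constructor
      · rintro ⟨j, rfl⟩
        cases h : a.2 j with
        | none => exact Or.inl ⟨j, h, rfl⟩
        | some i => exact Or.inr ⟨i, j, (ha i j).2 h, rfl⟩
      · rintro (⟨j, -, hj⟩ | ⟨i, j, -, hj⟩) <;> exact ⟨j, hj⟩
  · rw [Finset.mem_coe, mem_globalHyps] at ha hb
    -- The measurements are distinct, so the sets determine `c`; validity of the hypothesis then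
    -- determines `d` from `c`.
    have h1 : a.1 = b.1 := by
      funext i
      refine Option.ext fun j => ?_
      have := Finset.ext_iff.1 (congrFun hab (some i)) (z j)
      rw [mem_assoc_some, mem_assoc_some] at this
      simpa [hz.eq_iff] using this
    refine Prod.ext h1 (funext fun j => Option.ext fun i => ?_)
    rw [← ha, ← hb, h1]
  · obtain ⟨hA, hcard⟩ := hA
    rw [mem_decomps_iff] at hA
    obtain ⟨hdisj, hmem⟩ := hA
    -- The choices are in fact unique: `hcard` leaves at most one measurement per landmark, and
    -- `hdisj` at most one landmark per measurement.
    let c : Fin I → Option (Fin J) := fun i =>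
      if h : ∃ j, z j ∈ A (some i) then some h.choose else none
    let d : Fin J → Option (Fin I) := fun j =>
      if h : ∃ i, z j ∈ A (some i) then some h.choose else none
    have hc : ∀ i j, c i = some j ↔ z j ∈ A (some i) := by
      intro i j
      by_cases h : ∃ j, z j ∈ A (some i)
      · simp only [c, dif_pos h, Option.some.injEq]
        refine ⟨fun e => e ▸ h.choose_spec, fun hj => hz ?_⟩
        exact Finset.card_le_one.1 (hcard i) _ h.choose_spec _ hj
      · simp only [c, dif_neg h, reduceCtorEq, false_iff]
        exact fun hj => h ⟨j, hj⟩
    have hd : ∀ i j, d j = some i ↔ z j ∈ A (some i) := by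
      intro i j
      by_cases h : ∃ i, z j ∈ A (some i)
      · simp only [d, dif_pos h, Option.some.injEq]
        refine ⟨fun e => e ▸ h.choose_spec, fun hj => ?_⟩
        by_contra hne
        exact Finset.disjoint_left.1 (hdisj (some h.choose) (some i) (by simpa using hne))
          h.choose_spec hj
      · simp only [d, dif_neg h, reduceCtorEq, false_iff]
        exact fun hj => h ⟨i, hj⟩
    refine ⟨(c, d), ?_, ?_⟩
    · rw [Finset.mem_coe, mem_globalHyps]
      exact fun i j => (hc i j).trans (hd i j).symm
    · funext o
      ext x
      cases o with
      | none =>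
        rw [mem_assoc_none]
        constructor
        · rintro ⟨j, hj, rfl⟩
          obtain ⟨o, ho⟩ := (hmem (z j)).1 (mem_measSet.2 ⟨j, rfl⟩)
          cases o with
          | none => exact ho
          | some i =>
            have h := (hd i j).2 ho
            change d j = none at hj
            rw [hj] at h
            exact absurd h (by simp)
        · intro hx
          obtain ⟨j, rfl⟩ := mem_measSet.1 ((hmem x).2 ⟨none, hx⟩)
          refine ⟨j, Option.eq_none_iff_forall_ne_some.2 fun i hi => ?_, rfl⟩
          exact Finset.disjoint_left.1 (hdisj none (some i) (by simp)) hx ((hd i j).1 hi)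
      | some i =>
        rw [mem_assoc_some]
        constructor
        · rintro ⟨j, hj, rfl⟩
          exact (hc i j).1 hj
        · intro hx
          obtain ⟨j, rfl⟩ := mem_measSet.1 ((hmem x).2 ⟨_, hx⟩)
          exact ⟨j, (hc i j).2 hx, rfl⟩

/-- The bijection `bijOn_assoc` reindexes the sum; the associations it misses assign several
measurements to one landmark. -/
theorem sum_decomps_eq_sum_globalHyps (hz : Function.Injective z)
    {f : (Option (Fin I) → Finset (Vec nz)) → ℝ} (hf : ∀ A, (∃ i, 1 < (A (some i)).card) → f A = 0) :
    ∑ A ∈ decomps (Option (Fin I)) (measSet z), f A = ∑ a ∈ globalHyps I J, f (assoc z a) := by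
  have h := bijOn_assoc (I := I) hz
  symm
  refine Finset.sum_of_injOn (assoc z) h.injOn (fun a ha => (h.mapsTo ha).1) (fun A hA hA' => ?_)
    fun _ _ => rfl
  by_contra hne
  refine hA' (h.surjOn ⟨hA, fun i => ?_⟩)
  by_contra hi
  exact hne (hf A ⟨i, not_le.1 hi⟩)

end GlobalHypotheses

/-! ### The second form and its two-sided bounds. -/

/-- Bounds on a quotient whose numerator and denominator are known up to factors. -/
theorem div_mem_bounds {x p n w T δ ε : ℝ} (hp : 0 ≤ p) (hw : 0 < w) (hε0 : 0 ≤ ε) (hε : ε < 1)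
    (hx1 : Real.exp (-T - δ) * p ≤ x) (hx2 : x ≤ Real.exp (-T + δ) * p)
    (hn1 : Real.exp (-T - δ) * ((1 - ε) * w) ≤ n) (hn2 : n ≤ Real.exp (-T + δ) * ((1 + ε) * w)) :
    Real.exp (-(2 * δ)) / (1 + ε) * (p / w) ≤ x / n ∧
      x / n ≤ Real.exp (2 * δ) / (1 - ε) * (p / w) := by
  have h1 : 0 < 1 - ε := sub_pos.2 hε
  have hn0 : 0 < n := lt_of_lt_of_le (by positivity) hn1
  -- The upper and the lower exponential factor differ by `exp (2 * δ)`, which is where the doubled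
  -- exponent comes from.
  have e1 : Real.exp (-(2 * δ)) * Real.exp (-T + δ) = Real.exp (-T - δ) := by
    rw [← Real.exp_add]; congr 1; ring
  have e2 : Real.exp (2 * δ) * Real.exp (-T - δ) = Real.exp (-T + δ) := by
    rw [← Real.exp_add]; congr 1; ring
  constructor
  · rw [le_div_iff₀ hn0]
    calc _ ≤ Real.exp (-(2 * δ)) / (1 + ε) * (p / w) * (Real.exp (-T + δ) * ((1 + ε) * w)) :=
          mul_le_mul_of_nonneg_left hn2 (by positivity)
      _ = Real.exp (-(2 * δ)) * Real.exp (-T + δ) * p := by field_simp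
      _ ≤ x := by rw [e1]; exact hx1
  · rw [div_le_iff₀ hn0]
    calc x ≤ Real.exp (2 * δ) * Real.exp (-T - δ) * p := by rw [e2]; exact hx2
      _ = Real.exp (2 * δ) / (1 - ε) * (p / w) * (Real.exp (-T - δ) * ((1 - ε) * w)) := by
          field_simp
      _ ≤ _ := mul_le_mul_of_nonneg_left hn1 (by positivity)

namespace SlamModel

variable {ns nx nz I J : ℕ} {M : Type*} [Fintype M] [MeasurableSpace M] [DiscreteMeasurableSpace M]
  (𝓜 : SlamModel ns nx nz I M) {z : Fin J → Vec nz}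

theorem weight_eq_zero {A : Option (Fin I) → Finset (Vec nz)}
    (h : ∃ i, 1 < (A (some i)).card) : 𝓜.weight A = 0 := by
  obtain ⟨i, hi⟩ := h
  rw [weight, Finset.prod_eq_zero (Finset.mem_univ i), mul_zero]
  rw [nuB, if_neg (by omega), if_neg (by omega)]

theorem Phi_eq_zero {A : Option (Fin I) → Finset (Vec nz)}
    (h : ∃ i, 1 < (A (some i)).card) (s : Vec ns) : 𝓜.Phi A s = 0 := by
  obtain ⟨i, hi⟩ := h
  rw [Phi, Finset.prod_eq_zero (Finset.mem_univ i), mul_zero]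
  rw [q, if_neg (by omega), if_neg (by omega)]

theorem weight_assoc (hz : Function.Injective z) (a : Hyp I J) :
    𝓜.weight (assoc z a) = 𝓜.hypWeight z a := by
  rw [weight, hypWeight, mul_comm]
  congr 1
  exact Finset.prod_image fun _ _ _ _ h => hz h

theorem Phi_assoc (hz : Function.Injective z) (a : Hyp I J) (s : Vec ns) :
    𝓜.Phi (assoc z a) s = 𝓜.fp s * (∏ j ∈ newMeas a, 𝓜.psi (z j) s) *
      ∏ i, 𝓜.q i (measOf z (a.1 i)) s := by
  rw [Phi]
  congr 2
  exact Finset.prod_image fun _ _ _ _ h => hz h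

theorem hypWeight_nonneg (hz : Function.Injective z) (a : Hyp I J) : 0 ≤ 𝓜.hypWeight z a := by
  rw [← 𝓜.weight_assoc hz]; exact 𝓜.weight_nonneg _

theorem sum_weight_eq (hz : Function.Injective z) :
    ∑ A ∈ decomps (Option (Fin I)) (measSet z), 𝓜.weight A =
      ∑ a ∈ globalHyps I J, 𝓜.hypWeight z a := by
  rw [sum_decomps_eq_sum_globalHyps hz fun A => 𝓜.weight_eq_zero]
  simp only [𝓜.weight_assoc hz]

theorem hypProb_nonneg (hz : Function.Injective z) (a : Hyp I J) : 0 ≤ 𝓜.hypProb z a :=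
  div_nonneg (𝓜.hypWeight_nonneg hz a) (Finset.sum_nonneg fun b _ => 𝓜.hypWeight_nonneg hz b)

theorem mixture_eq (hz : Function.Injective z) (s : Vec ns) :
    𝓜.mixture (measSet z) s =
      ∑ a ∈ globalHyps I J, 𝓜.hypProb z a * 𝓜.cond (assoc z a) s := by
  rw [mixture, 𝓜.sum_weight_eq hz, sum_decomps_eq_sum_globalHyps hz
    (fun A hA => by rw [𝓜.weight_eq_zero hA, zero_mul]), Finset.sum_div]
  simp only [𝓜.weight_assoc hz, hypProb, div_mul_eq_mul_div]

/-- The weight in `hypProb` is the product of all the denominators, so they cancel. -/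
theorem hypMixture_term (hz : Function.Injective z) {a : Hyp I J} (ha : 𝓜.hypWeight z a ≠ 0)
    (s : Vec ns) :
    𝓜.hypProb z a * 𝓜.fp s * (∏ j ∈ newMeas a, 𝓜.psi (z j) s / 𝓜.nu (z j)) *
      ∏ i, 𝓜.q i (measOf z (a.1 i)) s / 𝓜.nuB i (measOf z (a.1 i)) =
    𝓜.Phi (assoc z a) s / ∑ b ∈ globalHyps I J, 𝓜.hypWeight z b := by
  have h1 := left_ne_zero_of_mul ha
  have h2 := right_ne_zero_of_mul ha
  rw [hypProb, hypWeight, Finset.prod_div_distrib, Finset.prod_div_distrib, 𝓜.Phi_assoc hz]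
  field_simp

/-- For hypotheses of weight zero nothing cancels, but there `hypProb` is zero and so is `Phi`,
almost everywhere. -/
theorem hypMixture_ae_eq (hz : Function.Injective z) :
    ∀ᵐ s, 𝓜.hypMixture z s = (∑ a ∈ globalHyps I J, 𝓜.Phi (assoc z a) s) /
      ∑ a ∈ globalHyps I J, 𝓜.hypWeight z a := by
  have h : ∀ᵐ s, ∀ a ∈ globalHyps I J, 𝓜.hypWeight z a = 0 → 𝓜.Phi (assoc z a) s = 0 := by
    refine (Filter.eventually_all_finset _).2 fun a _ => ?_
    by_cases ha : 𝓜.hypWeight z a = 0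
    · filter_upwards [𝓜.Phi_ae_zero ((𝓜.weight_assoc hz a).trans ha)] with s hs _ using hs
    · exact Filter.Eventually.of_forall fun s h => absurd h ha
  filter_upwards [h] with s hs
  rw [hypMixture, Finset.sum_div]
  refine Finset.sum_congr rfl fun a ha => ?_
  by_cases h0 : 𝓜.hypWeight z a = 0
  · rw [hs a ha h0, hypProb, h0]; simp
  · exact 𝓜.hypMixture_term hz h0 s

variable [NeZero nx]

theorem postUnnorm_eq_sum_Phi (hz : Function.Injective z) (s : Vec ns) :
    𝓜.postUnnorm (measSet z) s =
      Real.exp (-∫ y, 𝓜.psi y s) * ∑ a ∈ globalHyps I J, 𝓜.Phi (assoc z a) s := by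
  rw [postUnnorm_eq, sum_decomps_eq_sum_globalHyps hz
    (fun A hA => by rw [condUnnorm_eq, 𝓜.Phi_eq_zero hA, mul_zero]), Finset.mul_sum]
  simp only [condUnnorm_eq]

theorem sum_hypWeight_pos (hz : Function.Injective z)
    (hZ : ∫ s, 𝓜.postUnnorm (measSet z) s ≠ 0) :
    0 < ∑ a ∈ globalHyps I J, 𝓜.hypWeight z a := by
  rw [← 𝓜.sum_weight_eq hz]; exact 𝓜.sum_weight_pos hZ

theorem sum_hypProb (hz : Function.Injective z)
    (hZ : ∫ s, 𝓜.postUnnorm (measSet z) s ≠ 0) :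
    ∑ a ∈ globalHyps I J, 𝓜.hypProb z a = 1 := by
  simp only [hypProb]
  rw [← Finset.sum_div, div_self (𝓜.sum_hypWeight_pos hz hZ).ne']

/-- The numerator is the unnormalised posterior divided by the total weight, a constant that cancels
in the quotient. -/
theorem posterior_ae_eq_hypMixture (hz : Function.Injective z)
    (hZ : ∫ s, 𝓜.postUnnorm (measSet z) s ≠ 0) :
    ∀ᵐ s, 𝓜.posterior (measSet z) s =
      Real.exp (-∫ y, 𝓜.psi y s) * 𝓜.hypMixture z s /
        ∫ s', Real.exp (-∫ y, 𝓜.psi y s') * 𝓜.hypMixture z s' := by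
  have hχ := (𝓜.sum_hypWeight_pos hz hZ).ne'
  have h : ∀ᵐ s, Real.exp (-∫ y, 𝓜.psi y s) * 𝓜.hypMixture z s =
      𝓜.postUnnorm (measSet z) s / ∑ a ∈ globalHyps I J, 𝓜.hypWeight z a := by
    filter_upwards [𝓜.hypMixture_ae_eq hz] with s hs
    rw [hs, 𝓜.postUnnorm_eq_sum_Phi hz, mul_div_assoc]
  filter_upwards [h] with s hs
  rw [hs, integral_congr_ae h, integral_div, posterior, div_div_div_cancel_right₀ hχ]

/-- Replacing `∫ ψ` by `T` costs factors `exp (±δ)`, and replacing the integral of `Phi` by the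
weight costs `1 ± ε`. For the posterior, `div_mem_bounds` is applied to the sums over all
hypotheses; for the mixture, to each component before averaging. -/
theorem posterior_mixture_bounds (hz : Function.Injective z)
    (hZ : ∫ s, 𝓜.postUnnorm (measSet z) s ≠ 0) {T δ ε : ℝ} (hε : ε < 1)
    (hT : ∀ᵐ s, 𝓜.fp s ≠ 0 → |(∫ y, 𝓜.psi y s) - T| ≤ δ)
    (hW : ∀ a ∈ globalHyps I J,
      |(∫ s, 𝓜.Phi (assoc z a) s) - 𝓜.hypWeight z a| ≤ ε * 𝓜.hypWeight z a) :
    ∀ᵐ s,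
      (Real.exp (-(2 * δ)) / (1 + ε) * 𝓜.hypMixture z s ≤ 𝓜.posterior (measSet z) s ∧
        𝓜.posterior (measSet z) s ≤ Real.exp (2 * δ) / (1 - ε) * 𝓜.hypMixture z s) ∧
      (Real.exp (-(2 * δ)) / (1 + ε) * 𝓜.hypMixture z s ≤ 𝓜.mixture (measSet z) s ∧
        𝓜.mixture (measSet z) s ≤ Real.exp (2 * δ) / (1 - ε) * 𝓜.hypMixture z s) := by
  have hχ := 𝓜.sum_hypWeight_pos hz hZ
  -- Some hypothesis has positive weight, and for it the assumed bound forces `ε` to be nonnegative.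
  have hε0 : 0 ≤ ε := by
    obtain ⟨a, ha, h⟩ := Finset.exists_ne_zero_of_sum_ne_zero hχ.ne'
    have hpos := (𝓜.hypWeight_nonneg hz a).lt_of_ne h.symm
    exact nonneg_of_mul_nonneg_left ((abs_nonneg _).trans (hW a ha)) hpos
  have hbd : ∀ᵐ s, ∀ A, Real.exp (-T - δ) * 𝓜.Phi A s ≤ 𝓜.condUnnorm A s ∧
      𝓜.condUnnorm A s ≤ Real.exp (-T + δ) * 𝓜.Phi A s := by
    filter_upwards [hT] with s hs A
    rw [condUnnorm_eq]
    -- Where `fp` vanishes nothing is assumed about `ψ`, but all terms are zero.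
    by_cases h0 : 𝓜.fp s = 0
    · simp [Phi, h0]
    · have := abs_le.1 (hs h0)
      exact ⟨mul_le_mul_of_nonneg_right (Real.exp_le_exp.2 (by linarith))
        ((𝓜.Phi_intensity A).nonneg s), mul_le_mul_of_nonneg_right
        (Real.exp_le_exp.2 (by linarith)) ((𝓜.Phi_intensity A).nonneg s)⟩
  have hN : ∀ a ∈ globalHyps I J,
      Real.exp (-T - δ) * ((1 - ε) * 𝓜.hypWeight z a) ≤ 𝓜.normConst (assoc z a) ∧
      𝓜.normConst (assoc z a) ≤ Real.exp (-T + δ) * ((1 + ε) * 𝓜.hypWeight z a) := by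
    intro a ha
    have h1 := integral_mono_ae ((𝓜.Phi_intensity (assoc z a)).integrable.const_mul _)
      (𝓜.condUnnorm_intensity (assoc z a)).integrable (hbd.mono fun s hs => (hs _).1)
    have h2 := integral_mono_ae (𝓜.condUnnorm_intensity (assoc z a)).integrable
      ((𝓜.Phi_intensity (assoc z a)).integrable.const_mul _) (hbd.mono fun s hs => (hs _).2)
    rw [integral_const_mul] at h1 h2
    have h3 := abs_le.1 (hW a ha)
    exact ⟨(mul_le_mul_of_nonneg_left (by linarith) (Real.exp_pos _).le).trans h1,
      h2.trans (mul_le_mul_of_nonneg_left (by linarith) (Real.exp_pos _).le)⟩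
  filter_upwards [hbd, 𝓜.hypMixture_ae_eq hz] with s hs hmix
  constructor
  · rw [hmix]
    refine div_mem_bounds (Finset.sum_nonneg fun a _ => (𝓜.Phi_intensity _).nonneg s) hχ hε0 hε
      (T := T) ?_ ?_ ?_ ?_
    · rw [𝓜.postUnnorm_eq_sum_Phi hz, Finset.mul_sum, Finset.mul_sum]
      exact Finset.sum_le_sum fun a _ => by rw [← condUnnorm_eq]; exact (hs _).1
    · rw [𝓜.postUnnorm_eq_sum_Phi hz, Finset.mul_sum, Finset.mul_sum]
      exact Finset.sum_le_sum fun a _ => by rw [← condUnnorm_eq]; exact (hs _).2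
    all_goals
      rw [integral_postUnnorm, sum_decomps_eq_sum_globalHyps hz
        (fun A hA => 𝓜.normConst_eq_zero (𝓜.weight_eq_zero hA)), Finset.mul_sum, Finset.mul_sum]
    · exact Finset.sum_le_sum fun a ha => (hN a ha).1
    · exact Finset.sum_le_sum fun a ha => (hN a ha).2
  · have key : ∀ a ∈ globalHyps I J, 𝓜.hypWeight z a ≠ 0 →
        Real.exp (-(2 * δ)) / (1 + ε) * (𝓜.Phi (assoc z a) s / 𝓜.hypWeight z a) ≤
          𝓜.cond (assoc z a) s ∧
        𝓜.cond (assoc z a) s ≤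
          Real.exp (2 * δ) / (1 - ε) * (𝓜.Phi (assoc z a) s / 𝓜.hypWeight z a) := fun a ha h0 =>
      div_mem_bounds ((𝓜.Phi_intensity _).nonneg s)
        ((𝓜.hypWeight_nonneg hz a).lt_of_ne h0.symm) hε0 hε (hs _).1 (hs _).2 (hN a ha).1
        (hN a ha).2
    have e : ∀ C : ℝ, ∀ a, 𝓜.hypWeight z a ≠ 0 →
        C * (𝓜.Phi (assoc z a) s / ∑ b ∈ globalHyps I J, 𝓜.hypWeight z b) =
        𝓜.hypProb z a * (C * (𝓜.Phi (assoc z a) s / 𝓜.hypWeight z a)) := fun C a ha => by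
      rw [hypProb]; field_simp
    rw [𝓜.mixture_eq hz, hypMixture, Finset.mul_sum, Finset.mul_sum]
    constructor <;> refine Finset.sum_le_sum fun a ha => ?_
    all_goals
      by_cases h0 : 𝓜.hypWeight z a = 0
      · simp [hypProb, h0]
      · rw [𝓜.hypMixture_term hz h0, e _ a h0]
        refine mul_le_mul_of_nonneg_left ?_ (𝓜.hypProb_nonneg hz a)
        first
          | exact (key a ha h0).1
          | exact (key a ha h0).2

end SlamModel

/-! ### Log-likelihood ratios, Gibbs' inequality and mixtures of product densities. -/

section KullbackLeibler

open InformationTheory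

variable {Ω : Type*} [MeasurableSpace Ω]

/-- The chain rule for densities with respect to `μ` gives `dP/dQ * q = p`; where `p ≠ 0` this also
forces `q ≠ 0`. -/
theorem llr_withDensity {μ : Measure Ω} [SigmaFinite μ] {p q : Ω → ℝ}
    (hp : AEMeasurable p μ) (hq : AEMeasurable q μ) (hp0 : ∀ x, 0 ≤ p x) (hq0 : ∀ x, 0 ≤ q x)
    [SigmaFinite (μ.withDensity fun x => ENNReal.ofReal (p x))]
    [SigmaFinite (μ.withDensity fun x => ENNReal.ofReal (q x))]
    (hpq : (μ.withDensity fun x => ENNReal.ofReal (p x)) ≪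
      μ.withDensity fun x => ENNReal.ofReal (q x)) :
    ∀ᵐ x ∂(μ.withDensity fun x => ENNReal.ofReal (p x)), p x ≠ 0 ∧ q x ≠ 0 ∧
      llr (μ.withDensity fun x => ENNReal.ofReal (p x))
        (μ.withDensity fun x => ENNReal.ofReal (q x)) x = Real.log (p x) - Real.log (q x) := by
  rw [ae_withDensity_iff' hp.ennreal_ofReal]
  filter_upwards [Measure.rnDeriv_mul_rnDeriv (κ := μ) hpq,
    Measure.rnDeriv_withDensity₀ μ hp.ennreal_ofReal,
    Measure.rnDeriv_withDensity₀ μ hq.ennreal_ofReal] with x h1 h2 h3 hx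
  have hpx : p x ≠ 0 := fun h => hx (by rw [h, ENNReal.ofReal_zero])
  rw [Pi.mul_apply, h2, h3] at h1
  have h4 := congrArg ENNReal.toReal h1
  rw [ENNReal.toReal_mul, ENNReal.toReal_ofReal (hp0 x), ENNReal.toReal_ofReal (hq0 x)] at h4
  have hqx : q x ≠ 0 := fun h => hpx (by rw [← h4, h, mul_zero])
  refine ⟨hpx, hqx, ?_⟩
  rw [llr, ← h4, Real.log_mul (fun h => hpx (by rw [← h4, h, zero_mul])) hqx, add_sub_cancel_right]

/-- For the density `x` of `P` with respect to `Q`, `log x ≥ 1 - 1 / x` gives `-x * log x ≤ 1 - x ≤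
1`. After the change of measure to the finite measure `Q` the integrand is bounded. -/
theorem integrable_negPart_llr {P Q : Measure Ω} [IsFiniteMeasure P] [IsFiniteMeasure Q]
    (hPQ : P ≪ Q) : Integrable (fun x => max (-llr P Q x) 0) P := by
  rw [← integrable_rnDeriv_smul_iff hPQ]
  refine (integrable_const (1 : ℝ)).mono' ?_ (Filter.Eventually.of_forall fun x => ?_)
  · exact ((Measure.measurable_rnDeriv P Q).ennreal_toReal.mul
      ((measurable_llr P Q).neg.max measurable_const)).aestronglyMeasurable
  · have h0 : 0 ≤ (P.rnDeriv Q x).toReal := ENNReal.toReal_nonneg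
    rw [smul_eq_mul, llr, Real.norm_of_nonneg (mul_nonneg h0 (le_max_right _ _))]
    rcases h0.eq_or_lt with h | h
    · rw [← h, zero_mul]; exact zero_le_one
    · rw [mul_max_of_nonneg _ _ h0, mul_zero]
      refine max_le ?_ zero_le_one
      have := Real.one_sub_inv_le_log_of_pos h
      have h2 := mul_le_mul_of_nonneg_left this h0
      rw [mul_sub, mul_one, mul_inv_cancel₀ h.ne'] at h2
      linarith

/-- Comparison of two divergences whose log-likelihood ratios differ by `S - T`. -/
theorem klDiv_le_klDiv {P Q R : Measure Ω} [IsProbabilityMeasure P] [IsProbabilityMeasure Q]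
    [IsProbabilityMeasure R] (hPR : P ≪ R)
    (h : P ≪ Q → ∃ S T : Ω → ℝ, (∀ x, 0 ≤ S x) ∧ Integrable T P ∧
      (∀ᵐ x ∂P, llr P Q x + T x = llr P R x + S x) ∧
      (Integrable S P → ∫ x, T x ∂P ≤ ∫ x, S x ∂P)) :
    klDiv P R ≤ klDiv P Q := by
  by_cases hfin : klDiv P Q = ∞
  · rw [hfin]; exact le_top
  obtain ⟨hPQ, hint⟩ := klDiv_ne_top_iff.1 hfin
  obtain ⟨S, T, hS0, hT, hST, hle⟩ := h hPQ
  -- From above `llr P R` is at most `llr P Q + T`, because `S` is nonnegative; from below its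
  -- negative part is integrable in any case.
  have hR : Integrable (llr P R) P := by
    refine ((hint.abs.add hT.abs).add (integrable_negPart_llr hPR)).mono'
      (measurable_llr P R).aestronglyMeasurable ?_
    filter_upwards [hST] with x hx
    simp only [Pi.add_apply, Real.norm_eq_abs]
    have h1 := le_abs_self (llr P Q x)
    have h2 := le_abs_self (T x)
    have h3 := le_max_left (-llr P R x) 0
    have h4 := le_max_right (-llr P R x) 0
    have h5 := abs_nonneg (llr P Q x)
    have h6 := abs_nonneg (T x)
    refine abs_le.2 ⟨by linarith, by linarith [hS0 x]⟩
  have hS : Integrable S P := by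
    refine ((hint.add hT).sub hR).congr ?_
    filter_upwards [hST] with x hx
    simp only [Pi.add_apply, Pi.sub_apply]
    linarith
  have hsum : ∫ x, llr P Q x ∂P + ∫ x, T x ∂P = ∫ x, llr P R x ∂P + ∫ x, S x ∂P := by
    rw [← integral_add hint hT, ← integral_add hR hS]
    exact integral_congr_ae hST
  rw [klDiv_of_ac_of_integrable hPR hR, klDiv_of_ac_of_integrable hPQ hint]
  refine ENNReal.ofReal_le_ofReal ?_
  simp only [probReal_univ]
  linarith [hle hS]

/-- This is `log t ≤ t - 1` at `t = b / a`, multiplied by `a`. The logarithm is split into positive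
and negative parts so that the inequality can be integrated in `ℝ≥0∞`, without differences of
infinite terms. -/
theorem neg_log_ratio_le {a b : ℝ} (ha : 0 ≤ a) (hb : 0 ≤ b) (hab : a ≠ 0 → b ≠ 0) :
    max (Real.log b - Real.log a) 0 * a ≤ b ∧
      max (Real.log b - Real.log a) 0 * a + a ≤ max (Real.log a - Real.log b) 0 * a + b := by
  rcases ha.eq_or_lt with rfl | ha'
  · simp [hb]
  have hb' : 0 < b := hb.lt_of_ne (hab ha'.ne').symm
  have h1 : Real.log b - Real.log a ≤ b / a - 1 := by
    rw [← Real.log_div hb'.ne' ha'.ne']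
    exact Real.log_le_sub_one_of_pos (div_pos hb' ha')
  have h2 : (Real.log b - Real.log a) * a ≤ b - a := by
    have := mul_le_mul_of_nonneg_right h1 ha
    rwa [sub_mul (b / a), div_mul_cancel₀ _ ha'.ne', one_mul] at this
  rcases le_total (Real.log b) (Real.log a) with h | h
  · rw [max_eq_right (by linarith), max_eq_left (by linarith)]
    constructor <;> nlinarith
  · rw [max_eq_left (by linarith), max_eq_right (by linarith)]
    constructor <;> nlinarith

/-- Gibbs' inequality, without subtraction. -/
theorem lintegral_log_ratio_le {μ : Measure Ω} {a b : Ω → ℝ} (ham : AEMeasurable a μ)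
    (hbm : AEMeasurable b μ) (ha : ∀ x, 0 ≤ a x) (hb : ∀ x, 0 ≤ b x)
    (hab : ∀ᵐ x ∂μ, a x ≠ 0 → b x ≠ 0) :
    ∫⁻ x, ENNReal.ofReal (max (Real.log (b x) - Real.log (a x)) 0) * ENNReal.ofReal (a x) ∂μ ≤
        ∫⁻ x, ENNReal.ofReal (b x) ∂μ ∧
      ∫⁻ x, ENNReal.ofReal (max (Real.log (b x) - Real.log (a x)) 0) * ENNReal.ofReal (a x) ∂μ +
          ∫⁻ x, ENNReal.ofReal (a x) ∂μ ≤
        ∫⁻ x, ENNReal.ofReal (max (Real.log (a x) - Real.log (b x)) 0) * ENNReal.ofReal (a x) ∂μ +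
          ∫⁻ x, ENNReal.ofReal (b x) ∂μ := by
  have hm : ∀ x y : ℝ, 0 ≤ max (x - y) 0 := fun _ _ => le_max_right _ _
  rw [← lintegral_add_right' _ ham.ennreal_ofReal, ← lintegral_add_right' _ hbm.ennreal_ofReal]
  constructor
  · refine lintegral_mono_ae ?_
    filter_upwards [hab] with x hx
    rw [← ENNReal.ofReal_mul (hm _ _)]
    exact ENNReal.ofReal_le_ofReal (neg_log_ratio_le (ha x) (hb x) hx).1
  · refine lintegral_mono_ae ?_
    filter_upwards [hab] with x hx
    rw [← ENNReal.ofReal_mul (hm _ _), ← ENNReal.ofReal_mul (hm _ _),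
      ← ENNReal.ofReal_add (mul_nonneg (hm _ _) (ha x)) (ha x),
      ← ENNReal.ofReal_add (mul_nonneg (hm _ _) (ha x)) (hb x)]
    exact ENNReal.ofReal_le_ofReal (neg_log_ratio_le (ha x) (hb x) hx).2

/-- Expectation of a function of one component under a mixture of product densities. -/
theorem lintegral_mixture_component {O S T : Type*} [Fintype O] [MeasurableSpace S]
    [MeasurableSpace T] {ν : Measure S} [SFinite ν] {μ : Measure T} [SigmaFinite μ]
    {w : S → ℝ≥0∞} (hw : Measurable w) {F : O → S → T → ℝ≥0∞}
    (hF : ∀ o, Measurable fun p : S × T => F o p.1 p.2) (hF1 : ∀ o s, ∫⁻ t, F o s t ∂μ = 1)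
    {φ : T → ℝ≥0∞} (hφ : AEMeasurable φ μ) (o₀ : O) :
    ∫⁻ ω, φ (ω o₀) * ∫⁻ s, w s * ∏ o, F o s (ω o) ∂ν ∂(Measure.pi fun _ : O => μ) =
      ∫⁻ s, w s * ∫⁻ t, φ t * F o₀ s t ∂μ ∂ν := by
  classical
  have hφ' : AEMeasurable (fun ω : O → T => φ (ω o₀)) (Measure.pi fun _ : O => μ) :=
    hφ.comp_quasiMeasurePreserving (Measure.quasiMeasurePreserving_eval _ o₀)
  have hprod : Measurable fun p : (O → T) × S => w p.2 * ∏ o, F o p.2 (p.1 o) :=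
    (hw.comp measurable_snd).mul (Finset.measurable_fun_prod _ fun o _ =>
      (hF o).comp (measurable_snd.prodMk ((measurable_pi_apply o).comp measurable_fst)))
  have hs : ∀ ω : O → T, φ (ω o₀) * ∫⁻ s, w s * ∏ o, F o s (ω o) ∂ν =
      ∫⁻ s, φ (ω o₀) * (w s * ∏ o, F o s (ω o)) ∂ν := fun ω =>
    (lintegral_const_mul _ (hprod.comp (measurable_const.prodMk measurable_id))).symm
  simp only [hs]
  rw [lintegral_lintegral_swap
    ((hφ'.comp_fst (ν := ν)).mul hprod.aemeasurable)]
  refine lintegral_congr fun s => ?_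
  have hFs : ∀ o, Measurable (F o s) := fun o => (hF o).comp (measurable_const.prodMk measurable_id)
  -- `φ` becomes an additional factor of component `o₀`; the product integral then factorises, and
  -- all other components contribute `1`.
  have hre : ∀ ω : O → T, φ (ω o₀) * (w s * ∏ o, F o s (ω o)) =
      w s * ∏ o, (if o = o₀ then φ (ω o) else 1) * F o s (ω o) := fun ω => by
    rw [Finset.prod_mul_distrib, Finset.prod_ite_eq' Finset.univ o₀ fun o => φ (ω o),
      if_pos (Finset.mem_univ _), mul_left_comm]
  have hgm : ∀ o, AEMeasurable (fun t => (if o = o₀ then φ t else 1) * F o s t) μ := fun o => by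
    split_ifs
    · exact hφ.mul (hFs o).aemeasurable
    · exact aemeasurable_const.mul (hFs o).aemeasurable
  simp only [hre]
  rw [lintegral_const_mul'', lintegral_fintype_prod μ hgm, Finset.prod_eq_single o₀]
  · simp
  · intro o _ ho
    simp [ho, hF1]
  · intro h; exact absurd (Finset.mem_univ _) h
  · exact Finset.aemeasurable_fun_prod _ fun o _ =>
      (hgm o).comp_quasiMeasurePreserving (Measure.quasiMeasurePreserving_eval _ o)

end KullbackLeibler

/-! ### Set functions carried by sets of at most one element; Campbell's formula. -/

section CardLeOne

open scoped Classical

variable {α : Type*} [MeasurableSpace α]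

/-- On sequences, a function of finite sets that vanishes on sets with more than one element. -/
def onTuple (F : Finset α → ℝ) : (Σ n : ℕ, Fin n → α) → ℝ
  | ⟨0, _⟩ => F ∅
  | ⟨1, x⟩ => F {x 0}
  | ⟨_ + 2, _⟩ => 0

/-- `onTuple` is explicit at each length, which makes joint measurability in sequence and vehicle
state accessible. -/
theorem onTuple_eq {F : Finset α → ℝ} (hF : ∀ X, 1 < X.card → F X = 0)
    {t : Σ n : ℕ, Fin n → α} (ht : Function.Injective t.2) : F (toSet t) = onTuple F t := by
  obtain ⟨_ | _ | n, x⟩ := t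
  · simp [toSet, onTuple]
  · simp [toSet, onTuple]
  · rw [onTuple, hF]
    rw [toSet, Finset.card_image_of_injective _ ht]
    simp

variable {μ : Measure α} [SigmaFinite μ] [NullSingletonClass μ] [MeasurableEq α]

theorem hasSetIntegral_of_card_le_one {F : Finset α → ℝ} (h0 : 0 ≤ F ∅)
    (h1 : IsIntensity μ fun x => F {x}) (hF : ∀ X, 1 < X.card → F X = 0) :
    HasSetIntegral μ F (F ∅ + ∫ x, F {x} ∂μ) := by
  refine ((HasSetIntegral.indicator_empty.const_mul h0).add
    (HasSetIntegral.indicator_empty.sum_erase h1)).congr (fun X => ?_) (by simp)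
  by_cases hX : X.card ≤ 1
  · obtain h | h : X.card = 0 ∨ X.card = 1 := by omega
    · obtain rfl := Finset.card_eq_zero.1 h
      simp
    · obtain ⟨l, rfl⟩ := Finset.card_eq_one.1 h
      simp
  · rw [hF X (not_le.1 hX), if_neg (by rintro rfl; simp at hX), mul_zero, zero_add]
    refine Finset.sum_eq_zero fun l hl => ?_
    rw [if_neg, mul_zero]
    intro h
    have := Finset.card_erase_of_mem hl
    rw [h, Finset.card_empty] at this
    omega

theorem hasSetIntegral_bernoulli {r : ℝ} (hr : r ∈ Set.Icc (0 : ℝ) 1) {f : α → ℝ}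
    (hf : IsDensity μ f) : HasSetIntegral μ (bernoulli r f) 1 := by
  refine (hasSetIntegral_of_card_le_one (F := bernoulli r f) ?_ ?_
    (bernoulli_of_one_lt r f)).congr (fun _ => rfl) ?_
  · rw [bernoulli_empty]; exact sub_nonneg.2 hr.2
  · simp only [bernoulli_singleton]; exact hf.isIntensity.const_mul hr.1
  · simp only [bernoulli_singleton]
    rw [bernoulli_empty, integral_const_mul, hf.integral_eq_one]; ring

/-- Campbell's formula for a Poisson process. -/
theorem lintegral_sum_mul_poisson {g : α → ℝ≥0∞} (hg : Measurable g) {φ : α → ℝ}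
    (hφ : IsIntensity μ φ) :
    ∫⁻ t, (∑ k, g (t.2 k)) * ENNReal.ofReal (Real.exp (-∫ x, φ x ∂μ) * ∏ k, φ (t.2 k))
      ∂setMeasure μ = ∫⁻ x, g x * ENNReal.ofReal (φ x) ∂μ := by
  have hone : ∫⁻ t, ENNReal.ofReal (Real.exp (-∫ x, φ x ∂μ) * ∏ k, φ (t.2 k)) ∂setMeasure μ =
      1 := by
    rw [← ENNReal.ofReal_one, ← (HasSetIntegral.poisson hφ).lintegral_eq]
    refine lintegral_congr_ae ?_
    filter_upwards [ae_setMeasure_injective μ] with t ht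
    rw [poisson, prod_toSet ht]
  rw [lintegral_sum_erase (μ := μ) (f := fun x => g x * ENNReal.ofReal (φ x))
    (hg.mul hφ.measurable.ennreal_ofReal)
    (F := fun t => ENNReal.ofReal (Real.exp (-∫ x, φ x ∂μ) * ∏ k, φ (t.2 k))), hone, mul_one]
  · refine measurable_sigma fun n => ?_
    have h : Measurable fun x : Fin n → α => ∏ k, φ (x k) :=
      Finset.measurable_fun_prod _ fun k _ => hφ.measurable.comp (measurable_pi_apply k)
    exact (h.const_mul _).ennreal_ofReal
  · intro x; simp
  · intro n x
    -- Taking out entry `k` splits the Poisson density into `φ (x k)` and the Poisson density of the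
    -- remaining entries, which has total mass one.
    rw [Finset.sum_mul]
    refine Finset.sum_congr rfl fun k _ => ?_
    dsimp only
    rw [Fin.prod_univ_succAbove _ k, mul_left_comm, ENNReal.ofReal_mul (hφ.nonneg _), mul_assoc]

end CardLeOne

/-! ### Labelled PMB densities. -/

section Labelled

variable {α : Type*} [MeasurableSpace α] {μ : Measure α} [SigmaFinite μ] [NullSingletonClass μ]
  [MeasurableEq α] {I : ℕ}

theorem ae_pi_toSet_injective :
    ∀ᵐ ω ∂(Measure.pi fun _ : Option (Fin I) => setMeasure μ),
      ∀ o, Function.Injective (ω o).2 := by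
  rw [ae_all_iff]
  exact fun o => (Measure.quasiMeasurePreserving_eval (fun _ : Option (Fin I) => setMeasure μ)
    o).ae (ae_setMeasure_injective μ)

theorem aemeasurable_component {F : Finset α → ℝ} (hF : SetMeasurable F) (o : Option (Fin I)) :
    AEMeasurable (fun ω : Option (Fin I) → Σ n : ℕ, Fin n → α => F (toSet (ω o)))
      (Measure.pi fun _ => setMeasure μ) :=
  (hF.aemeasurable μ).comp_quasiMeasurePreserving (Measure.quasiMeasurePreserving_eval _ o)

variable {lam : α → ℝ} {r : Fin I → ℝ} {f : Fin I → α → ℝ}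

theorem labelledPMB_nonneg (hlam : IsIntensity μ lam) (hr : ∀ i, r i ∈ Set.Icc (0 : ℝ) 1)
    (hf : ∀ i, IsDensity μ (f i)) (A : Option (Fin I) → Finset α) : 0 ≤ labelledPMB μ lam r f A :=
  mul_nonneg ((HasSetIntegral.poisson hlam).nonneg _)
    (Finset.prod_nonneg fun i _ => bernoulli_nonneg (hr i) (hf i).nonneg _)

theorem aemeasurable_labelledPMB (hlam : IsIntensity μ lam) (hr : ∀ i, r i ∈ Set.Icc (0 : ℝ) 1)
    (hf : ∀ i, IsDensity μ (f i)) :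
    AEMeasurable (fun ω : Option (Fin I) → Σ n : ℕ, Fin n → α =>
      labelledPMB μ lam r f fun o => toSet (ω o)) (Measure.pi fun _ => setMeasure μ) :=
  (aemeasurable_component (HasSetIntegral.poisson hlam).meas none).mul
    (Finset.aemeasurable_fun_prod _ fun i _ =>
      aemeasurable_component (hasSetIntegral_bernoulli (hr i) (hf i)).meas (some i))

theorem isProbabilityMeasure_labelledLaw_labelledPMB (hlam : IsIntensity μ lam)
    (hr : ∀ i, r i ∈ Set.Icc (0 : ℝ) 1) (hf : ∀ i, IsDensity μ (f i)) :
    IsProbabilityMeasure (labelledLaw μ (labelledPMB μ lam r f)) := by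
  refine ⟨?_⟩
  rw [labelledLaw, withDensity_apply _ MeasurableSet.univ, Measure.restrict_univ]
  let F : Option (Fin I) → (Σ n : ℕ, Fin n → α) → ℝ≥0∞ := fun o t =>
    ENNReal.ofReal (o.elim (poisson μ lam (toSet t)) fun i => bernoulli (r i) (f i) (toSet t))
  have hF : ∀ o, AEMeasurable (F o) (setMeasure μ) := by
    rintro (_ | i)
    · exact ((HasSetIntegral.poisson hlam).meas.aemeasurable μ).ennreal_ofReal
    · exact ((hasSetIntegral_bernoulli (hr i) (hf i)).meas.aemeasurable μ).ennreal_ofReal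
  have h1 : ∀ o, ∫⁻ t, F o t ∂setMeasure μ = 1 := by
    rintro (_ | i)
    · exact (HasSetIntegral.poisson hlam).lintegral_eq.trans ENNReal.ofReal_one
    · exact (hasSetIntegral_bernoulli (hr i) (hf i)).lintegral_eq.trans ENNReal.ofReal_one
  have h := lintegral_fintype_prod (setMeasure μ) hF
  simp only [h1, Finset.prod_const_one] at h
  rw [← h]
  refine lintegral_congr fun ω => ?_
  rw [Fintype.prod_option, labelledPMB, ENNReal.ofReal_mul ((HasSetIntegral.poisson hlam).nonneg _),
    ENNReal.ofReal_prod_of_nonneg fun i _ => bernoulli_nonneg (hr i) (hf i).nonneg _]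
  rfl

end Labelled

/-! ### The averaged constants as a Poisson intensity and Bernoulli densities. -/

namespace SlamModel

variable {ns nx nz I : ℕ} {M : Type*} [Fintype M] [MeasurableSpace M] [DiscreteMeasurableSpace M]
  (𝓜 : SlamModel ns nx nz I M)

theorem q_of_one_lt (i : Fin I) (s : Vec ns) (W : Finset (Vec nz)) (hW : 1 < W.card) :
    𝓜.q i W s = 0 := by
  rw [q, if_neg (by omega), if_neg (by omega)]

theorem nuB_of_one_lt (i : Fin I) (W : Finset (Vec nz)) (hW : 1 < W.card) : 𝓜.nuB i W = 0 := by
  rw [nuB, if_neg (by omega), if_neg (by omega)]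

theorem q_empty (i : Fin I) (s : Vec ns) : 𝓜.q i ∅ s = 𝓜.qMis i s := by simp [q]

theorem q_singleton (i : Fin I) (s : Vec ns) (y : Vec nz) : 𝓜.q i {y} s = 𝓜.qDet i y s := by
  simp [q]

theorem nuB_empty (i : Fin I) : 𝓜.nuB i ∅ = 𝓜.nuMis i := by simp [nuB]

theorem nuB_singleton (i : Fin I) (y : Vec nz) : 𝓜.nuB i {y} = 𝓜.nuDet i y := by simp [nuB]

theorem qDet_intensity (i : Fin I) (s : Vec ns) : IsIntensity volume fun y => 𝓜.qDet i y s := by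
  refine ⟨(𝓜.measurable_qDet i).comp (measurable_const.prodMk measurable_id),
    fun y => 𝓜.qDet_nonneg i y s, ?_⟩
  simp only [qDet_eq]
  exact (𝓜.integral_detLik_measurement (𝓜.f_intensity i) s).1.const_mul _

/-- Absence, missed detection and detection exhaust the cases: given the state, `q i` is the density
of a Bernoulli measurement set. -/
theorem qMis_add_integral_qDet (i : Fin I) (s : Vec ns) :
    𝓜.qMis i s + ∫ y, 𝓜.qDet i y s = 1 := by
  have hlp : Integrable (fun l => 𝓜.f i l * 𝓜.pD s l) (landmarkMeasure nx M) := by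
    have := (𝓜.f_intensity i).integrable.sub
      (isIntensity_misLik (𝓜 := 𝓜) (𝓜.f_intensity i) s).integrable
    refine this.congr (Filter.Eventually.of_forall fun l => ?_)
    simp only [Pi.sub_apply]; ring
  simp only [qDet_eq, qMis_eq]
  rw [integral_const_mul, (𝓜.integral_detLik_measurement (𝓜.f_intensity i) s).2]
  simp only [mul_sub, mul_one]
  rw [integral_sub (𝓜.f_intensity i).integrable hlp, (𝓜.f_density i).integral_eq_one]
  ring

theorem measurable_nu : Measurable 𝓜.nu := by
  have : 𝓜.nu = fun y => ∫ s, 𝓜.fp s * 𝓜.psi y s := funext fun y => (𝓜.integral_fp_psi y).symm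
  rw [this]
  exact (StronglyMeasurable.integral_prod_left' (f := fun p : Vec ns × Vec nz =>
    𝓜.fp p.1 * 𝓜.psi p.2 p.1)
    ((𝓜.fp_density.measurable.comp measurable_fst).mul 𝓜.measurable_psi).stronglyMeasurable).measurable

theorem measurable_nuDet (i : Fin I) : Measurable (𝓜.nuDet i) := by
  have : 𝓜.nuDet i = fun y => ∫ s, 𝓜.fp s * 𝓜.qDet i y s :=
    funext fun y => (𝓜.integral_fp_qDet i y).symm
  rw [this]
  exact (StronglyMeasurable.integral_prod_left' (f := fun p : Vec ns × Vec nz =>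
    𝓜.fp p.1 * 𝓜.qDet i p.2 p.1) ((𝓜.fp_density.measurable.comp measurable_fst).mul
      (𝓜.measurable_qDet i)).stronglyMeasurable).measurable

theorem nuDet_nonneg (i : Fin I) (y : Vec nz) : 0 ≤ 𝓜.nuDet i y := by
  rw [← nuB_singleton]; exact 𝓜.nuB_nonneg i _

theorem nuMis_nonneg (i : Fin I) : 0 ≤ 𝓜.nuMis i := by
  rw [← nuB_empty]; exact 𝓜.nuB_nonneg i _

/-- Tonelli for an average of intensities over the vehicle state. -/
theorem lintegral_average {h : Vec nz → Vec ns → ℝ}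
    (hm : Measurable fun p : Vec ns × Vec nz => h p.2 p.1) (h0 : ∀ y s, 0 ≤ h y s)
    (hi : ∀ y, Integrable fun s => 𝓜.fp s * h y s) {g : Vec nz → ℝ≥0∞} (hg : Measurable g) :
    ∫⁻ y, g y * ENNReal.ofReal (∫ s, 𝓜.fp s * h y s) =
      ∫⁻ s, ENNReal.ofReal (𝓜.fp s) * ∫⁻ y, g y * ENNReal.ofReal (h y s) := by
  have hfpm : Measurable fun s => ENNReal.ofReal (𝓜.fp s) := 𝓜.fp_density.measurable.ennreal_ofReal
  have e1 : ∀ y, g y * ENNReal.ofReal (∫ s, 𝓜.fp s * h y s) =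
      ∫⁻ s, g y * (ENNReal.ofReal (𝓜.fp s) * ENNReal.ofReal (h y s)) := fun y => by
    rw [ofReal_integral_eq_lintegral_ofReal (hi y) (Filter.Eventually.of_forall fun s =>
      mul_nonneg (𝓜.fp_density.nonneg s) (h0 y s)), lintegral_const_mul]
    · simp only [ENNReal.ofReal_mul (𝓜.fp_density.nonneg _)]
    · exact hfpm.mul (hm.comp (measurable_id.prodMk measurable_const)).ennreal_ofReal
  have e2 : ∀ s, ENNReal.ofReal (𝓜.fp s) * ∫⁻ y, g y * ENNReal.ofReal (h y s) =
      ∫⁻ y, g y * (ENNReal.ofReal (𝓜.fp s) * ENNReal.ofReal (h y s)) := fun s => by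
    rw [← lintegral_const_mul]
    · simp only [mul_left_comm]
    · exact hg.mul (hm.comp (measurable_const.prodMk measurable_id)).ennreal_ofReal
  simp only [e1, e2]
  rw [lintegral_lintegral_swap]
  exact ((hg.comp measurable_fst).mul ((hfpm.comp measurable_snd).mul
    (hm.comp measurable_swap).ennreal_ofReal)).aemeasurable

theorem lintegral_fp : ∫⁻ s, ENNReal.ofReal (𝓜.fp s) = 1 := by
  rw [← ofReal_integral_eq_lintegral_ofReal 𝓜.fp_density.integrable
    (Filter.Eventually.of_forall 𝓜.fp_density.nonneg), 𝓜.fp_density.integral_eq_one,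
    ENNReal.ofReal_one]

theorem nu_intensity : IsIntensity volume 𝓜.nu := by
  refine ⟨𝓜.measurable_nu, 𝓜.nu_nonneg, ?_⟩
  rw [← lintegral_ofReal_ne_top_iff_integrable 𝓜.measurable_nu.aestronglyMeasurable
    (Filter.Eventually.of_forall 𝓜.nu_nonneg)]
  have h := 𝓜.lintegral_average 𝓜.measurable_psi 𝓜.psi_nonneg 𝓜.integrable_fp_psi
    (g := fun _ => 1) measurable_const
  simp only [one_mul, integral_fp_psi] at h
  rw [h]
  -- The mean number of measurements is at most that for detection probability one, uniformly in the
  -- state, and hence so is its average.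
  have hb : ∀ s, ∫⁻ y, ENNReal.ofReal (𝓜.psi y s) ≤
      ENNReal.ofReal ((∫ y, 𝓜.c y) + ∫ l, 𝓜.lam l ∂landmarkMeasure nx M) := fun s => by
    rw [← ofReal_integral_eq_lintegral_ofReal (𝓜.psi_intensity s).integrable
      (Filter.Eventually.of_forall (𝓜.psi_intensity s).nonneg), integral_psi]
    refine ENNReal.ofReal_le_ofReal (add_le_add le_rfl ?_)
    refine integral_mono_of_nonneg (Filter.Eventually.of_forall fun l =>
      mul_nonneg (𝓜.lam_intensity.nonneg l) (𝓜.pD_mem s l).1) 𝓜.lam_intensity.integrable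
      (Filter.Eventually.of_forall fun l => mul_le_of_le_one_right (𝓜.lam_intensity.nonneg l)
        (𝓜.pD_mem s l).2)
  refine ne_top_of_le_ne_top (b := 1 * ENNReal.ofReal
    ((∫ y, 𝓜.c y) + ∫ l, 𝓜.lam l ∂landmarkMeasure nx M)) (by finiteness) ?_
  rw [← 𝓜.lintegral_fp, ← lintegral_mul_const _ 𝓜.fp_density.measurable.ennreal_ofReal]
  exact lintegral_mono fun s => mul_le_mul_right (hb s) _

theorem lintegral_nuDet (i : Fin I) :
    ∫⁻ y, ENNReal.ofReal (𝓜.nuDet i y) = ENNReal.ofReal (1 - 𝓜.nuMis i) := by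
  have h := 𝓜.lintegral_average (𝓜.measurable_qDet i) (𝓜.qDet_nonneg i)
    (fun y => by simpa only [q_singleton] using 𝓜.integrable_fp_q i {y})
    (g := fun _ => 1) measurable_const
  simp only [one_mul, integral_fp_qDet] at h
  have e : ∀ s, ENNReal.ofReal (𝓜.fp s) * ∫⁻ y, ENNReal.ofReal (𝓜.qDet i y s) =
      ENNReal.ofReal (𝓜.fp s * (1 - 𝓜.qMis i s)) := fun s => by
    rw [← ofReal_integral_eq_lintegral_ofReal (𝓜.qDet_intensity i s).integrable
      (Filter.Eventually.of_forall (𝓜.qDet_intensity i s).nonneg),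
      ← 𝓜.qMis_add_integral_qDet i s, ENNReal.ofReal_mul (𝓜.fp_density.nonneg s),
      add_sub_cancel_left]
  have hm : Integrable fun s => 𝓜.fp s * 𝓜.qMis i s := by
    simpa only [q_empty] using 𝓜.integrable_fp_q i ∅
  rw [h]
  simp only [e, mul_sub, mul_one]
  rw [← ofReal_integral_eq_lintegral_ofReal
    (f := fun s => 𝓜.fp s - 𝓜.fp s * 𝓜.qMis i s) (𝓜.fp_density.integrable.sub hm)
    (Filter.Eventually.of_forall fun s => by
      have := mul_le_of_le_one_right (𝓜.fp_density.nonneg s) (𝓜.qMis_le_one i s)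
      simpa using this)]
  rw [integral_sub 𝓜.fp_density.integrable hm, 𝓜.fp_density.integral_eq_one, integral_fp_qMis]

theorem nuMis_le_one (i : Fin I) : 𝓜.nuMis i ≤ 1 := by
  rw [← integral_fp_qMis, ← 𝓜.fp_density.integral_eq_one]
  have hm : Integrable fun s => 𝓜.fp s * 𝓜.qMis i s := by
    simpa only [q_empty] using 𝓜.integrable_fp_q i ∅
  exact integral_mono hm 𝓜.fp_density.integrable fun s =>
    mul_le_of_le_one_right (𝓜.fp_density.nonneg s) (𝓜.qMis_le_one i s)

theorem integral_nuDet (i : Fin I) : ∫ y, 𝓜.nuDet i y = 1 - 𝓜.nuMis i := by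
  rw [integral_eq_lintegral_of_nonneg_ae (Filter.Eventually.of_forall (𝓜.nuDet_nonneg i))
    (𝓜.measurable_nuDet i).aestronglyMeasurable, lintegral_nuDet,
    ENNReal.toReal_ofReal (sub_nonneg.2 (𝓜.nuMis_le_one i))]

/-- If the component is almost surely not detected, its detection constants vanish everywhere. -/
theorem nuDet_eq_zero {i : Fin I} (h : 𝓜.nuMis i = 1) (y : Vec nz) : 𝓜.nuDet i y = 0 := by
  have hm : Integrable fun s => 𝓜.fp s * 𝓜.qMis i s := by
    simpa only [q_empty] using 𝓜.integrable_fp_q i ∅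
  -- The integrand is nonnegative with zero integral, so `qMis = 1` at almost every state with `fp ≠
  -- 0`.
  have h0 : ∫ s, (𝓜.fp s - 𝓜.fp s * 𝓜.qMis i s) = 0 := by
    rw [integral_sub 𝓜.fp_density.integrable hm, 𝓜.fp_density.integral_eq_one, integral_fp_qMis, h,
      sub_self]
  rw [integral_eq_zero_iff_of_nonneg (fun s => sub_nonneg.2 (mul_le_of_le_one_right
    (𝓜.fp_density.nonneg s) (𝓜.qMis_le_one i s))) (𝓜.fp_density.integrable.sub hm)] at h0
  rw [← integral_fp_qDet]
  refine integral_eq_zero_of_ae ?_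
  filter_upwards [h0] with s hs
  simp only [Pi.zero_apply] at hs ⊢
  by_cases hfp : 𝓜.fp s = 0
  · rw [hfp, zero_mul]
  have hq : 𝓜.qMis i s = 1 := by
    rw [sub_eq_zero] at hs
    exact (mul_left_cancel₀ hfp (by rw [← hs, mul_one]))
  have hlp : Integrable (fun l => 𝓜.f i l * 𝓜.pD s l) (landmarkMeasure nx M) := by
    have := (𝓜.f_intensity i).integrable.sub
      (isIntensity_misLik (𝓜 := 𝓜) (𝓜.f_intensity i) s).integrable
    refine this.congr (Filter.Eventually.of_forall fun l => ?_)
    simp only [Pi.sub_apply]; ring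
  rw [qMis_eq] at hq
  simp only [mul_sub, mul_one] at hq
  rw [integral_sub (𝓜.f_intensity i).integrable hlp, (𝓜.f_density i).integral_eq_one] at hq
  -- Either `r i = 0` or `f i * pD` vanishes at almost every landmark. Both make `qDet` zero at
  -- every measurement, not merely at almost every one.
  have hz : 𝓜.r i * ∫ l, 𝓜.f i l * 𝓜.pD s l ∂landmarkMeasure nx M = 0 := by linarith
  rw [qDet_eq]
  rcases mul_eq_zero.1 hz with hr | hi
  · rw [hr, zero_mul, mul_zero]
  · rw [integral_eq_zero_iff_of_nonneg (fun l => mul_nonneg ((𝓜.f_intensity i).nonneg l)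
      (𝓜.pD_mem s l).1) hlp] at hi
    rw [integral_eq_zero_of_ae, mul_zero, mul_zero]
    filter_upwards [hi] with l hl
    simp only [Pi.zero_apply] at hl ⊢
    rw [← mul_assoc, hl, zero_mul]

include 𝓜 in
theorem exists_density (i : Fin I) : ∃ h : Vec nz → ℝ, IsDensity volume h := by
  have : Nonempty (Landmark nx M) := by
    by_contra hne
    rw [not_nonempty_iff] at hne
    have := (𝓜.f_density i).integral_eq_one
    rw [Measure.eq_zero_of_isEmpty (landmarkMeasure nx M), integral_zero_measure] at this
    exact zero_ne_one this
  exact ⟨𝓜.g 0 this.some, 𝓜.g_density 0 this.some⟩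

/-- The product weights are, up to a common factor, the values of a labelled PMB density. -/
theorem exists_bernoulli_eq_nuB : ∃ (ρ : Fin I → ℝ) (h : Fin I → Vec nz → ℝ),
    (∀ i, ρ i ∈ Set.Icc (0 : ℝ) 1) ∧ (∀ i, IsDensity volume (h i)) ∧
    (∀ i W, bernoulli (ρ i) (h i) W = 𝓜.nuB i W) := by
  have key : ∀ i, ∃ (ρ : ℝ) (h : Vec nz → ℝ), ρ ∈ Set.Icc (0 : ℝ) 1 ∧ IsDensity volume h ∧
      ∀ W, bernoulli ρ h W = 𝓜.nuB i W := by
    intro i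
    have main : ∀ h : Vec nz → ℝ, (∀ y, (1 - 𝓜.nuMis i) * h y = 𝓜.nuDet i y) →
        ∀ W, bernoulli (1 - 𝓜.nuMis i) h W = 𝓜.nuB i W := by
      intro h hh W
      rcases empty_or_singleton_or_one_lt W with rfl | ⟨y, rfl⟩ | hW
      · rw [bernoulli_empty, nuB_empty]; ring
      · rw [bernoulli_singleton, nuB_singleton, hh]
      · rw [bernoulli_of_one_lt _ _ _ hW, 𝓜.nuB_of_one_lt _ _ hW]
    refine ⟨1 - 𝓜.nuMis i, ?_⟩
    have hmem : 1 - 𝓜.nuMis i ∈ Set.Icc (0 : ℝ) 1 :=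
      ⟨sub_nonneg.2 (𝓜.nuMis_le_one i), sub_le_self _ (𝓜.nuMis_nonneg i)⟩
    by_cases h1 : 𝓜.nuMis i = 1
    · obtain ⟨h, hd⟩ := 𝓜.exists_density i
      refine ⟨h, hmem, hd, main h fun y => ?_⟩
      rw [𝓜.nuDet_eq_zero h1, h1, sub_self, zero_mul]
    · have hne : 1 - 𝓜.nuMis i ≠ 0 := fun h => h1 (by linarith)
      refine ⟨fun y => 𝓜.nuDet i y / (1 - 𝓜.nuMis i), hmem,
        ⟨(𝓜.measurable_nuDet i).div_const _, fun y => div_nonneg (𝓜.nuDet_nonneg i y) hmem.1, ?_⟩,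
        main _ fun y => mul_div_cancel₀ _ hne⟩
      rw [integral_div, integral_nuDet, div_self hne]
  choose ρ h h1 h2 h3 using key
  exact ⟨ρ, h, h1, h2, h3⟩

end SlamModel

theorem labelledPMB_factors_ne_zero {α : Type*} [MeasurableSpace α] {μ : Measure α} {I : ℕ}
    {lam : α → ℝ} {r : Fin I → ℝ} {f : Fin I → α → ℝ} {A : Option (Fin I) → Finset α}
    (h : labelledPMB μ lam r f A ≠ 0) :
    (∀ x ∈ A none, lam x ≠ 0) ∧ ∀ i, bernoulli (r i) (f i) (A (some i)) ≠ 0 :=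
  ⟨fun x hx => Finset.prod_ne_zero_iff.1 (right_ne_zero_of_mul (left_ne_zero_of_mul h)) x hx,
    fun i => Finset.prod_ne_zero_iff.1 (right_ne_zero_of_mul h) i (Finset.mem_univ i)⟩

theorem log_labelledPMB {α : Type*} [MeasurableSpace α] {μ : Measure α} {I : ℕ}
    {lam : α → ℝ} {r : Fin I → ℝ} {f : Fin I → α → ℝ} {A : Option (Fin I) → Finset α}
    (h : labelledPMB μ lam r f A ≠ 0) :
    Real.log (labelledPMB μ lam r f A) = -∫ x, lam x ∂μ + ∑ x ∈ A none, Real.log (lam x) +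
      ∑ i, Real.log (bernoulli (r i) (f i) (A (some i))) := by
  obtain ⟨h1, h2⟩ := labelledPMB_factors_ne_zero h
  rw [labelledPMB, Real.log_mul (left_ne_zero_of_mul h) (right_ne_zero_of_mul h), poisson,
    Real.log_mul (Real.exp_pos _).ne' (right_ne_zero_of_mul (left_ne_zero_of_mul h)), Real.log_exp,
    Real.log_prod h1, Real.log_prod fun i _ => h2 i]

theorem withDensity_ofReal_absolutelyContinuous {Ω : Type*} [MeasurableSpace Ω] {μ : Measure Ω}
    {p q : Ω → ℝ} (hp : AEMeasurable p μ) (hq : AEMeasurable q μ)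
    (h : ∀ x, 0 < p x → 0 < q x) :
    (μ.withDensity fun x => ENNReal.ofReal (p x)) ≪ μ.withDensity fun x => ENNReal.ofReal (q x) := by
  intro s hs
  rw [withDensity_apply_eq_zero' hq.ennreal_ofReal] at hs
  rw [withDensity_apply_eq_zero' hp.ennreal_ofReal]
  refine measure_mono_null ?_ hs
  rintro x ⟨hx, hxs⟩
  refine ⟨?_, hxs⟩
  simp only [Set.mem_ofPred_eq, ne_eq, ENNReal.ofReal_eq_zero, not_le] at hx ⊢
  exact h x hx

/-! ### The law of the labelled measurement sets and minimality of the divergence. -/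

namespace SlamModel

variable {ns nx nz I : ℕ} {M : Type*} [Fintype M] [MeasurableSpace M] [DiscreteMeasurableSpace M]
  (𝓜 : SlamModel ns nx nz I M)

/-- Given the vehicle state, the densities of the labelled measurement sets on sequences. -/
def partDensity : Option (Fin I) → Vec ns → (Σ n : ℕ, Fin n → Vec nz) → ℝ≥0∞
  | none, s, t => ENNReal.ofReal (Real.exp (-∫ y, 𝓜.psi y s) * ∏ k, 𝓜.psi (t.2 k) s)
  | some i, s, t => ENNReal.ofReal (onTuple (fun W => 𝓜.q i W s) t)

theorem measurable_partDensity (o : Option (Fin I)) :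
    Measurable fun p : Vec ns × (Σ n : ℕ, Fin n → Vec nz) => 𝓜.partDensity o p.1 p.2 := by
  suffices h : Measurable fun p : (Σ n : ℕ, Fin n → Vec nz) × Vec ns =>
      𝓜.partDensity o p.2 p.1 from h.comp measurable_swap
  refine measurable_sigma_prod fun n => ?_
  cases o with
  | none =>
    refine Measurable.ennreal_ofReal (Measurable.mul ?_ ?_)
    · exact (𝓜.measurable_integral_psi.comp measurable_snd).neg.exp
    · have h : Measurable fun p : (Fin n → Vec nz) × Vec ns => ∏ k, 𝓜.psi (p.1 k) p.2 :=
        Finset.measurable_fun_prod _ fun k _ => 𝓜.measurable_psi.comp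
          (measurable_snd.prodMk ((measurable_pi_apply k).comp measurable_fst))
      exact h
  | some i =>
    refine Measurable.ennreal_ofReal ?_
    obtain _ | _ | n := n
    · exact (𝓜.measurable_q i ∅).comp measurable_snd
    · simp only [onTuple, q_singleton]
      exact (𝓜.measurable_qDet i).comp
        (measurable_snd.prodMk ((measurable_pi_apply 0).comp measurable_fst))
    · exact measurable_const

theorem labelledPMB_eq_weight {ρ : Fin I → ℝ} {h : Fin I → Vec nz → ℝ}
    (hB : ∀ i W, bernoulli (ρ i) (h i) W = 𝓜.nuB i W) (A : Option (Fin I) → Finset (Vec nz)) :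
    labelledPMB volume 𝓜.nu ρ h A = Real.exp (-∫ y, 𝓜.nu y) * 𝓜.weight A := by
  simp only [labelledPMB, poisson, weight, hB, mul_assoc]

section Measurements

variable [NeZero nz]

theorem partDensity_some_eq (i : Fin I) (s : Vec ns) {t : Σ n : ℕ, Fin n → Vec nz}
    (ht : Function.Injective t.2) :
    𝓜.partDensity (some i) s t = ENNReal.ofReal (𝓜.q i (toSet t) s) := by
  rw [partDensity, ← onTuple_eq (F := fun W => 𝓜.q i W s) (𝓜.q_of_one_lt i s) ht]

theorem lintegral_partDensity (o : Option (Fin I)) (s : Vec ns) :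
    ∫⁻ t, 𝓜.partDensity o s t ∂setMeasure volume = 1 := by
  cases o with
  | none =>
    rw [← ENNReal.ofReal_one, ← (HasSetIntegral.poisson (𝓜.psi_intensity s)).lintegral_eq]
    refine lintegral_congr_ae ?_
    filter_upwards [ae_setMeasure_injective (volume : Measure (Vec nz))] with t ht
    rw [partDensity, poisson, prod_toSet ht]
  | some i =>
    have h := hasSetIntegral_of_card_le_one (μ := volume) (F := fun W => 𝓜.q i W s)
      (𝓜.q_nonneg i ∅ s) (by simpa only [q_singleton] using 𝓜.qDet_intensity i s)
      (𝓜.q_of_one_lt i s)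
    simp only [q_empty, q_singleton, qMis_add_integral_qDet] at h
    rw [← ENNReal.ofReal_one, ← h.lintegral_eq]
    refine lintegral_congr_ae ?_
    filter_upwards [ae_setMeasure_injective (volume : Measure (Vec nz))] with t ht
    rw [𝓜.partDensity_some_eq i s ht]

variable [NeZero nx]

/-- The exact constants form a mixture, over the vehicle state, of product densities. Sequences with
repetitions are excluded because there the product over the set differs from the product over the
entries. -/
theorem ofReal_normConst_ae :
    ∀ᵐ ω ∂(Measure.pi fun _ : Option (Fin I) => setMeasure (volume : Measure (Vec nz))),
      ENNReal.ofReal (𝓜.normConst fun o => toSet (ω o)) =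
        ∫⁻ s, ENNReal.ofReal (𝓜.fp s) * ∏ o, 𝓜.partDensity o s (ω o) := by
  filter_upwards [ae_pi_toSet_injective] with ω hω
  rw [normConst, ofReal_integral_eq_lintegral_ofReal (𝓜.condUnnorm_intensity _).integrable
    (Filter.Eventually.of_forall (𝓜.condUnnorm_intensity _).nonneg)]
  refine lintegral_congr fun s => ?_
  have h1 : 0 ≤ 𝓜.fp s * 𝓜.qU (toSet (ω none)) s := by
    rw [qU_eq]
    exact mul_nonneg (𝓜.fp_density.nonneg s) (mul_nonneg (Real.exp_pos _).le
      (Finset.prod_nonneg fun y _ => 𝓜.psi_nonneg y s))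
  rw [condUnnorm, Fintype.prod_option, ENNReal.ofReal_mul h1,
    ENNReal.ofReal_mul (𝓜.fp_density.nonneg s), mul_assoc,
    ENNReal.ofReal_prod_of_nonneg fun i _ => by rw [qB_eq]; exact 𝓜.q_nonneg _ _ _, qU_eq,
    prod_toSet (hω none)]
  simp only [qB_eq, 𝓜.partDensity_some_eq _ _ (hω _)]
  rfl

theorem aemeasurable_normConst :
    AEMeasurable (fun ω : Option (Fin I) → Σ n : ℕ, Fin n → Vec nz =>
      𝓜.normConst fun o => toSet (ω o)) (Measure.pi fun _ => setMeasure volume) := by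
  have hm : Measurable fun ω : Option (Fin I) → Σ n : ℕ, Fin n → Vec nz =>
      ∫⁻ s, ENNReal.ofReal (𝓜.fp s) * ∏ o, 𝓜.partDensity o s (ω o) := by
    refine Measurable.lintegral_prod_right' (f := fun p : (Option (Fin I) →
      Σ n : ℕ, Fin n → Vec nz) × Vec ns => ENNReal.ofReal (𝓜.fp p.2) *
        ∏ o, 𝓜.partDensity o p.2 (p.1 o)) ?_
    exact (𝓜.fp_density.measurable.comp measurable_snd).ennreal_ofReal.mul
      (Finset.measurable_fun_prod _ fun o _ => (𝓜.measurable_partDensity o).comp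
        (measurable_snd.prodMk ((measurable_pi_apply o).comp measurable_fst)))
  refine ⟨_, hm.ennreal_toReal, ?_⟩
  filter_upwards [𝓜.ofReal_normConst_ae] with ω hω
  rw [← hω, ENNReal.toReal_ofReal (𝓜.normConst_nonneg _)]

/-- Given the state the components are independent with mass one, so all components other than `o`
integrate out. -/
theorem lintegral_labelledLaw_component {φ : (Σ n : ℕ, Fin n → Vec nz) → ℝ≥0∞}
    (hφ : AEMeasurable φ (setMeasure volume)) (o : Option (Fin I)) :
    ∫⁻ ω, φ (ω o) ∂labelledLaw volume 𝓜.normConst =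
      ∫⁻ s, ENNReal.ofReal (𝓜.fp s) * ∫⁻ t, φ t * 𝓜.partDensity o s t ∂setMeasure volume := by
  rw [← lintegral_mixture_component 𝓜.fp_density.measurable.ennreal_ofReal
    𝓜.measurable_partDensity 𝓜.lintegral_partDensity hφ o, labelledLaw,
    lintegral_withDensity_eq_lintegral_mul_non_measurable₀ _
      𝓜.aemeasurable_normConst.ennreal_ofReal
      (Filter.Eventually.of_forall fun _ => ENNReal.ofReal_lt_top)]
  refine lintegral_congr_ae ?_
  filter_upwards [𝓜.ofReal_normConst_ae] with ω hω
  rw [Pi.mul_apply, hω, mul_comm]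

theorem isProbabilityMeasure_labelledLaw_normConst :
    IsProbabilityMeasure (labelledLaw volume 𝓜.normConst) := by
  refine ⟨?_⟩
  have h := 𝓜.lintegral_labelledLaw_component (φ := fun _ => 1) aemeasurable_const none
  simpa only [lintegral_const, one_mul, lintegral_partDensity, mul_one, lintegral_fp] using h

/-- Since `nuB i` is the average of `q i` under `fp`, the marginal law of a Bernoulli part has
exactly the density `nuB i`. -/
theorem lintegral_labelledLaw_some {φ : (Σ n : ℕ, Fin n → Vec nz) → ℝ≥0∞}
    (hφ : AEMeasurable φ (setMeasure volume)) (i : Fin I) :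
    ∫⁻ ω, φ (ω (some i)) ∂labelledLaw volume 𝓜.normConst =
      ∫⁻ t, φ t * ENNReal.ofReal (𝓜.nuB i (toSet t)) ∂setMeasure volume := by
  have hfpm : Measurable fun s => ENNReal.ofReal (𝓜.fp s) := 𝓜.fp_density.measurable.ennreal_ofReal
  have hpm : Measurable fun p : Vec ns × (Σ n : ℕ, Fin n → Vec nz) =>
      𝓜.partDensity (some i) p.1 p.2 := 𝓜.measurable_partDensity (some i)
  rw [lintegral_labelledLaw_component _ hφ]
  have e1 : ∀ s, ENNReal.ofReal (𝓜.fp s) * ∫⁻ t, φ t * 𝓜.partDensity (some i) s t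
      ∂setMeasure volume = ∫⁻ t, φ t * (ENNReal.ofReal (𝓜.fp s) * 𝓜.partDensity (some i) s t)
        ∂setMeasure volume := fun s => by
    have h : AEMeasurable (fun t => φ t * 𝓜.partDensity (some i) s t) (setMeasure volume) :=
      hφ.mul (hpm.comp (measurable_prodMk_left (x := s))).aemeasurable
    rw [← lintegral_const_mul'' _ h]
    simp only [mul_left_comm]
  simp only [e1]
  rw [lintegral_lintegral_swap]
  · refine lintegral_congr_ae ?_
    filter_upwards [ae_setMeasure_injective (volume : Measure (Vec nz))] with t ht
    have hpt : Measurable fun s => 𝓜.partDensity (some i) s t := hpm.of_uncurry_right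
    have h := hfpm.mul hpt
    have h2 : ENNReal.ofReal (𝓜.nuB i (toSet t)) =
        ∫⁻ s, ENNReal.ofReal (𝓜.fp s) * 𝓜.partDensity (some i) s t := by
      rw [← integral_fp_q, ofReal_integral_eq_lintegral_ofReal (𝓜.integrable_fp_q i _)
        (Filter.Eventually.of_forall fun s =>
          mul_nonneg (𝓜.fp_density.nonneg s) (𝓜.q_nonneg i _ s))]
      refine lintegral_congr fun s => ?_
      rw [𝓜.partDensity_some_eq i s ht, ENNReal.ofReal_mul (𝓜.fp_density.nonneg s)]
    rw [h2]
    exact lintegral_const_mul _ h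
  · have h1 : AEMeasurable (fun p : Vec ns × (Σ n : ℕ, Fin n → Vec nz) => φ p.2)
        (volume.prod (setMeasure volume)) :=
      hφ.comp_quasiMeasurePreserving Measure.quasiMeasurePreserving_snd
    have h2 : Measurable fun p : Vec ns × (Σ n : ℕ, Fin n → Vec nz) =>
        ENNReal.ofReal (𝓜.fp p.1) * 𝓜.partDensity (some i) p.1 p.2 :=
      (hfpm.comp measurable_fst).mul hpm
    exact h1.mul h2.aemeasurable

/-- The part `none` is a mixture of Poisson processes and need not be Poisson, but its intensity is
`nu`: Campbell's formula holds given the state and is then averaged. -/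
theorem lintegral_labelledLaw_none {g : Vec nz → ℝ≥0∞} (hg : Measurable g) :
    ∫⁻ ω, ∑ k, g ((ω none).2 k) ∂labelledLaw volume 𝓜.normConst =
      ∫⁻ y, g y * ENNReal.ofReal (𝓜.nu y) := by
  have hφ : Measurable fun t : Σ n : ℕ, Fin n → Vec nz => ∑ k, g (t.2 k) := by
    refine measurable_sigma fun n => ?_
    have h : Measurable fun x : Fin n → Vec nz => ∑ k, g (x k) :=
      Finset.measurable_fun_sum _ fun k _ => hg.comp (measurable_pi_apply k)
    exact h
  rw [𝓜.lintegral_labelledLaw_component hφ.aemeasurable none]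
  simp only [← integral_fp_psi]
  rw [𝓜.lintegral_average 𝓜.measurable_psi 𝓜.psi_nonneg 𝓜.integrable_fp_psi hg]
  refine lintegral_congr fun s => ?_
  rw [← lintegral_sum_mul_poisson hg (𝓜.psi_intensity s)]
  rfl

/-- Expectation of a sum of functions of the components. -/
theorem lintegral_labelledLaw_sum {l : Vec nz → ℝ} (hl : Measurable l) (hl0 : ∀ y, 0 ≤ l y)
    {u : Fin I → Finset (Vec nz) → ℝ}
    (hu : ∀ i, AEMeasurable (fun t => u i (toSet t)) (setMeasure volume)) (hu0 : ∀ i W, 0 ≤ u i W)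
    {c : ℝ} (hc : 0 ≤ c) :
    AEMeasurable (fun ω : Option (Fin I) → Σ n : ℕ, Fin n → Vec nz =>
      ∑ k, l ((ω none).2 k) + ∑ i, u i (toSet (ω (some i))) + c)
        (labelledLaw volume 𝓜.normConst) ∧
    ∫⁻ ω, ENNReal.ofReal (∑ k, l ((ω none).2 k) + ∑ i, u i (toSet (ω (some i))) + c)
        ∂labelledLaw volume 𝓜.normConst =
      (∫⁻ y, ENNReal.ofReal (l y) * ENNReal.ofReal (𝓜.nu y)) +
        (∑ i, ∫⁻ t, ENNReal.ofReal (u i (toSet t)) * ENNReal.ofReal (𝓜.nuB i (toSet t))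
          ∂setMeasure volume) + ENNReal.ofReal c := by
  have hP := 𝓜.isProbabilityMeasure_labelledLaw_normConst
  have hac : labelledLaw volume 𝓜.normConst ≪
      Measure.pi fun _ : Option (Fin I) => setMeasure (volume : Measure (Vec nz)) :=
    withDensity_absolutelyContinuous _ _
  have hlm : Measurable fun ω : Option (Fin I) → Σ n : ℕ, Fin n → Vec nz =>
      ∑ k, l ((ω none).2 k) := by
    have : Measurable fun t : Σ n : ℕ, Fin n → Vec nz => ∑ k, l (t.2 k) := by
      refine measurable_sigma fun n => ?_
      have h : Measurable fun x : Fin n → Vec nz => ∑ k, l (x k) :=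
        Finset.measurable_fun_sum _ fun k _ => hl.comp (measurable_pi_apply k)
      exact h
    exact this.comp (measurable_pi_apply none)
  have hum : ∀ i, AEMeasurable (fun ω : Option (Fin I) → Σ n : ℕ, Fin n → Vec nz =>
      u i (toSet (ω (some i)))) (labelledLaw volume 𝓜.normConst) := fun i =>
    ((hu i).comp_quasiMeasurePreserving (Measure.quasiMeasurePreserving_eval
      (fun _ : Option (Fin I) => setMeasure (volume : Measure (Vec nz))) (some i))).mono_ac hac
  have hsum := Finset.aemeasurable_fun_sum Finset.univ fun i _ => hum i
  refine ⟨(hlm.aemeasurable.add hsum).add_const c, ?_⟩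
  have e : ∀ ω : Option (Fin I) → Σ n : ℕ, Fin n → Vec nz,
      ENNReal.ofReal (∑ k, l ((ω none).2 k) + ∑ i, u i (toSet (ω (some i))) + c) =
        ∑ k, ENNReal.ofReal (l ((ω none).2 k)) + ∑ i, ENNReal.ofReal (u i (toSet (ω (some i)))) +
          ENNReal.ofReal c := fun ω => by
    have h1 : 0 ≤ ∑ k, l ((ω none).2 k) := Finset.sum_nonneg fun k _ => hl0 _
    have h2 : 0 ≤ ∑ i, u i (toSet (ω (some i))) := Finset.sum_nonneg fun i _ => hu0 _ _
    rw [ENNReal.ofReal_add (add_nonneg h1 h2) hc, ENNReal.ofReal_add h1 h2,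
      ENNReal.ofReal_sum_of_nonneg fun k _ => hl0 _, ENNReal.ofReal_sum_of_nonneg fun i _ => hu0 _ _]
  simp only [e]
  rw [lintegral_add_right _ measurable_const, lintegral_const, measure_univ, mul_one,
    lintegral_add_right' _ (Finset.aemeasurable_fun_sum _ fun i _ => (hum i).ennreal_ofReal),
    lintegral_finsetSum' _ fun i _ => (hum i).ennreal_ofReal,
    𝓜.lintegral_labelledLaw_none hl.ennreal_ofReal]
  congr 2
  exact Finset.sum_congr rfl fun i _ => 𝓜.lintegral_labelledLaw_some (hu i).ennreal_ofReal i

/-- Among the labelled PMB densities, the one with the averaged constants is the closest. -/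
theorem klDiv_labelledLaw_le {ρ : Fin I → ℝ} {h : Fin I → Vec nz → ℝ}
    (hρ : ∀ i, ρ i ∈ Set.Icc (0 : ℝ) 1) (hh : ∀ i, IsDensity volume (h i))
    (hB : ∀ i W, bernoulli (ρ i) (h i) W = 𝓜.nuB i W)
    {κ : Vec nz → ℝ} {ρ' : Fin I → ℝ} {h' : Fin I → Vec nz → ℝ}
    (hκ : IsIntensity volume κ) (hρ' : ∀ i, ρ' i ∈ Set.Icc (0 : ℝ) 1)
    (hh' : ∀ i, IsDensity volume (h' i)) :
    InformationTheory.klDiv (labelledLaw volume 𝓜.normConst)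
        (labelledLaw volume (labelledPMB volume 𝓜.nu ρ h)) ≤
      InformationTheory.klDiv (labelledLaw volume 𝓜.normConst)
        (labelledLaw volume (labelledPMB volume κ ρ' h')) := by
  have hν := 𝓜.nu_intensity
  have hP := 𝓜.isProbabilityMeasure_labelledLaw_normConst
  have hQ := isProbabilityMeasure_labelledLaw_labelledPMB hκ hρ' hh'
  have hR := isProbabilityMeasure_labelledLaw_labelledPMB hν hρ hh
  have hpm := 𝓜.aemeasurable_normConst
  have hqm := aemeasurable_labelledPMB hκ hρ' hh'
  have hrm := aemeasurable_labelledPMB hν hρ hh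
  have hPR : labelledLaw volume 𝓜.normConst ≪
      labelledLaw volume (labelledPMB volume 𝓜.nu ρ h) :=
    withDensity_ofReal_absolutelyContinuous hpm hrm fun ω hω => by
      rw [𝓜.labelledPMB_eq_weight hB]; exact mul_pos (Real.exp_pos _) (𝓜.weight_pos hω.ne')
  refine klDiv_le_klDiv hPR fun hPQ => ?_
  have hlq := llr_withDensity hpm hqm (fun _ => 𝓜.normConst_nonneg _)
    (fun _ => labelledPMB_nonneg hκ hρ' hh' _) hPQ
  have hlr := llr_withDensity hpm hrm (fun _ => 𝓜.normConst_nonneg _)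
    (fun _ => labelledPMB_nonneg hν hρ hh _) hPR
  have hinj : ∀ᵐ ω ∂labelledLaw volume 𝓜.normConst, ∀ o, Function.Injective (ω o).2 :=
    (withDensity_absolutelyContinuous _ _).ae_le ae_pi_toSet_injective
  have hmB : ∀ i, SetMeasurable (𝓜.nuB i) := fun i => by
    have := (hasSetIntegral_bernoulli (hρ i) (hh i)).meas
    rwa [show bernoulli (ρ i) (h i) = 𝓜.nuB i from funext (hB i)] at this
  have hmb := fun i => (hasSetIntegral_bernoulli (hρ' i) (hh' i)).meas
  have hB1 : ∀ i, ∫⁻ t, ENNReal.ofReal (𝓜.nuB i (toSet t)) ∂setMeasure volume = 1 := fun i => by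
    have := (hasSetIntegral_bernoulli (hρ i) (hh i)).lintegral_eq
    rwa [show bernoulli (ρ i) (h i) = 𝓜.nuB i from funext (hB i), ENNReal.ofReal_one] at this
  have hb1 : ∀ i, ∫⁻ t, ENNReal.ofReal (bernoulli (ρ' i) (h' i) (toSet t))
      ∂setMeasure volume = 1 := fun i =>
    (hasSetIntegral_bernoulli (hρ' i) (hh' i)).lintegral_eq.trans ENNReal.ofReal_one
  -- supports
  have hκν : ∀ᵐ y, 𝓜.nu y ≠ 0 → κ y ≠ 0 := by
    have hset : MeasurableSet {y | κ y = 0} := hκ.measurable (measurableSet_singleton 0)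
    -- Test function: the zero set of `κ`. By `hlq` almost surely no point of the part `none` lies
    -- there, so `nu` has integral zero over this set.
    have h0 := 𝓜.lintegral_labelledLaw_none (g := {y | κ y = 0}.indicator 1)
      (measurable_one.indicator hset)
    have hm : Measurable fun y =>
        {y | κ y = 0}.indicator (1 : Vec nz → ℝ≥0∞) y * ENNReal.ofReal (𝓜.nu y) :=
      (measurable_one.indicator hset).mul hν.measurable.ennreal_ofReal
    rw [lintegral_eq_zero_of_ae_eq_zero, eq_comm, lintegral_eq_zero_iff hm] at h0
    · filter_upwards [h0] with y hy hν0 hκ0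
      have : ENNReal.ofReal (𝓜.nu y) = 0 := by simpa [hκ0] using hy
      exact hν0 (le_antisymm (ENNReal.ofReal_eq_zero.1 this) (hν.nonneg y))
    · filter_upwards [hlq, hinj] with ω hω hi
      have h1 := (labelledPMB_factors_ne_zero hω.2.1).1
      refine Finset.sum_eq_zero fun k _ => ?_
      refine Set.indicator_of_notMem ?_ _
      exact h1 _ (by simp [toSet])
  have hbB : ∀ i, ∀ᵐ t ∂setMeasure volume, 𝓜.nuB i (toSet t) ≠ 0 →
      bernoulli (ρ' i) (h' i) (toSet t) ≠ 0 := by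
    intro i
    -- The same argument for part `i`, tested with the zero set of the competing Bernoulli density.
    have hgm : AEMeasurable (fun t => ({0} : Set ℝ).indicator (1 : ℝ → ℝ≥0∞)
        (bernoulli (ρ' i) (h' i) (toSet t))) (setMeasure volume) :=
      (measurable_one.indicator (measurableSet_singleton 0)).comp_aemeasurable
        ((hmb i).aemeasurable volume)
    have h0 := 𝓜.lintegral_labelledLaw_some hgm i
    have hm : AEMeasurable (fun t => ({0} : Set ℝ).indicator (1 : ℝ → ℝ≥0∞)
        (bernoulli (ρ' i) (h' i) (toSet t)) * ENNReal.ofReal (𝓜.nuB i (toSet t)))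
        (setMeasure volume) := hgm.mul ((hmB i).aemeasurable volume).ennreal_ofReal
    rw [lintegral_eq_zero_of_ae_eq_zero, eq_comm, lintegral_eq_zero_iff' hm] at h0
    · filter_upwards [h0] with t ht hB0 hb0
      have : ENNReal.ofReal (𝓜.nuB i (toSet t)) = 0 := by simpa [hb0] using ht
      exact hB0 (le_antisymm (ENNReal.ofReal_eq_zero.1 this) (𝓜.nuB_nonneg i _))
    · filter_upwards [hlq] with ω hω
      have hne : bernoulli (ρ' i) (h' i) (toSet (ω (some i))) ∉ ({0} : Set ℝ) :=
        (labelledPMB_factors_ne_zero hω.2.1).2 i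
      exact Set.indicator_of_notMem hne _
  -- positive and negative parts of the logarithmic ratios
  have hmax : ∀ x y : ℝ, 0 ≤ max (x - y) 0 := fun _ _ => le_max_right _ _
  have hlog : ∀ {F : Finset (Vec nz) → ℝ}, SetMeasurable F →
      AEMeasurable (fun t => Real.log (F (toSet t))) (setMeasure volume) := fun hF =>
    Real.measurable_log.comp_aemeasurable (hF.aemeasurable volume)
  have hS := 𝓜.lintegral_labelledLaw_sum (l := fun y => max (Real.log (𝓜.nu y) - Real.log (κ y)) 0)
    ((hν.measurable.log.sub hκ.measurable.log).max measurable_const) (fun _ => hmax _ _)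
    (u := fun i W => max (Real.log (𝓜.nuB i W) - Real.log (bernoulli (ρ' i) (h' i) W)) 0)
    (fun i => ((hlog (hmB i)).sub (hlog (hmb i))).max aemeasurable_const) (fun _ _ => hmax _ _)
    (c := ∫ y, κ y) (integral_nonneg hκ.nonneg)
  have hT := 𝓜.lintegral_labelledLaw_sum (l := fun y => max (Real.log (κ y) - Real.log (𝓜.nu y)) 0)
    ((hκ.measurable.log.sub hν.measurable.log).max measurable_const) (fun _ => hmax _ _)
    (u := fun i W => max (Real.log (bernoulli (ρ' i) (h' i) W) - Real.log (𝓜.nuB i W)) 0)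
    (fun i => ((hlog (hmb i)).sub (hlog (hmB i))).max aemeasurable_const) (fun _ _ => hmax _ _)
    (c := ∫ y, 𝓜.nu y) (integral_nonneg hν.nonneg)
  have gν := lintegral_log_ratio_le hν.measurable.aemeasurable hκ.measurable.aemeasurable
    hν.nonneg hκ.nonneg hκν
  have gB := fun i => lintegral_log_ratio_le ((hmB i).aemeasurable volume)
    ((hmb i).aemeasurable volume) (fun t => 𝓜.nuB_nonneg i (toSet t))
    (fun t => bernoulli_nonneg (hρ' i) (hh' i).nonneg (toSet t)) (hbB i)
  -- Bernoulli densities have mass one, so the masses in Gibbs' inequality cancel; for the Poisson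
  -- part `∫ nu` and `∫ κ` remain.
  have hle : ∀ i, _ := fun i => (gB i).2
  simp only [hB1, hb1, ENNReal.add_le_add_iff_right ENNReal.one_ne_top] at hle
  have hνi := ofReal_integral_eq_lintegral_ofReal hν.integrable
    (Filter.Eventually.of_forall hν.nonneg)
  have hκi := ofReal_integral_eq_lintegral_ofReal hκ.integrable
    (Filter.Eventually.of_forall hκ.nonneg)
  -- `S - T` is the logarithm of the averaged density minus that of the competitor. The constants
  -- are placed crosswise, `∫ κ` in `S` and `∫ nu` in `T`, so that both functions are nonnegative
  -- and Gibbs' inequality compares their expectations.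
  set S : (Option (Fin I) → Σ n : ℕ, Fin n → Vec nz) → ℝ := fun ω =>
    ∑ k, max (Real.log (𝓜.nu ((ω none).2 k)) - Real.log (κ ((ω none).2 k))) 0 +
      ∑ i, max (Real.log (𝓜.nuB i (toSet (ω (some i)))) -
        Real.log (bernoulli (ρ' i) (h' i) (toSet (ω (some i))))) 0 + ∫ y, κ y with hSdef
  set T : (Option (Fin I) → Σ n : ℕ, Fin n → Vec nz) → ℝ := fun ω =>
    ∑ k, max (Real.log (κ ((ω none).2 k)) - Real.log (𝓜.nu ((ω none).2 k))) 0 +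
      ∑ i, max (Real.log (bernoulli (ρ' i) (h' i) (toSet (ω (some i)))) -
        Real.log (𝓜.nuB i (toSet (ω (some i))))) 0 + ∫ y, 𝓜.nu y with hTdef
  have hS0 : ∀ ω, 0 ≤ S ω := fun ω => add_nonneg (add_nonneg
    (Finset.sum_nonneg fun _ _ => hmax _ _) (Finset.sum_nonneg fun _ _ => hmax _ _))
    (integral_nonneg hκ.nonneg)
  have hT0 : ∀ ω, 0 ≤ T ω := fun ω => add_nonneg (add_nonneg
    (Finset.sum_nonneg fun _ _ => hmax _ _) (Finset.sum_nonneg fun _ _ => hmax _ _))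
    (integral_nonneg hν.nonneg)
  -- The first half of Gibbs' inequality bounds the Poisson term by `∫ κ` and each Bernoulli term by
  -- one, so `T` is integrable for every competitor that dominates the exact law.
  have hTint : Integrable T (labelledLaw volume 𝓜.normConst) := by
    rw [← lintegral_ofReal_ne_top_iff_integrable hT.1.aestronglyMeasurable
      (Filter.Eventually.of_forall hT0), hT.2]
    have h1 := ne_top_of_le_ne_top (hκi ▸ ENNReal.ofReal_ne_top) gν.1
    have h2 := fun i => ne_top_of_le_ne_top (hb1 i ▸ ENNReal.one_ne_top) (gB i).1
    exact ENNReal.add_ne_top.2 ⟨ENNReal.add_ne_top.2 ⟨h1, (ENNReal.sum_lt_top.2 fun i _ =>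
      (h2 i).lt_top).ne⟩, ENNReal.ofReal_ne_top⟩
  have hTS : ∫⁻ ω, ENNReal.ofReal (T ω) ∂labelledLaw volume 𝓜.normConst ≤
      ∫⁻ ω, ENNReal.ofReal (S ω) ∂labelledLaw volume 𝓜.normConst := by
    rw [hS.2, hT.2, hνi, hκi]
    refine (add_right_comm _ _ _).trans_le (le_trans ?_ (add_right_comm _ _ _).le)
    exact add_le_add gν.2 (Finset.sum_le_sum fun i _ => hle i)
  refine ⟨S, T, hS0, hTint, ?_, fun hSint => ?_⟩
  · filter_upwards [hlq, hlr, hinj] with ω h1 h2 h3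
    have e1 := h1.2.2
    have e2 := h2.2.2
    rw [log_labelledPMB h1.2.1, sum_toSet (h3 none)] at e1
    rw [log_labelledPMB h2.2.1, sum_toSet (h3 none)] at e2
    rw [labelledLaw, labelledLaw, labelledLaw, e1, e2]
    have hsub : ∀ x y : ℝ, max (x - y) 0 = max (y - x) 0 + (x - y) := fun x y => by
      rcases le_total x y with h | h
      · rw [max_eq_right (by linarith), max_eq_left (by linarith)]; ring
      · rw [max_eq_left (by linarith), max_eq_right (by linarith)]; ring
    have e3 : S ω = T ω + (∑ k, Real.log (𝓜.nu ((ω none).2 k)) -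
        ∑ k, Real.log (κ ((ω none).2 k))) + (∑ i, Real.log (𝓜.nuB i (toSet (ω (some i)))) -
        ∑ i, Real.log (bernoulli (ρ' i) (h' i) (toSet (ω (some i))))) +
        (∫ y, κ y) - ∫ y, 𝓜.nu y := by
      simp only [hSdef, hTdef]
      rw [Finset.sum_congr rfl fun k _ => hsub (Real.log (𝓜.nu ((ω none).2 k))) _,
        Finset.sum_congr rfl fun i _ => hsub (Real.log (𝓜.nuB i (toSet (ω (some i))))) _]
      simp only [Finset.sum_add_distrib, Finset.sum_sub_distrib]
      ring
    rw [e3]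
    simp only [hB]
    ring
  · rw [← ENNReal.ofReal_le_ofReal_iff (integral_nonneg hS0),
      ofReal_integral_eq_lintegral_ofReal hTint (Filter.Eventually.of_forall hT0),
      ofReal_integral_eq_lintegral_ofReal hSint (Filter.Eventually.of_forall hS0)]
    exact hTS

end Measurements

end SlamModel

end RFS

end

/-! ### Assembly of the claim. -/

open RFS in
theorem proposition3 {ns nx nz I J : ℕ} (hnx : 0 < nx) (hnz : 0 < nz)
    {M : Type*} [Fintype M] [MeasurableSpace M] [DiscreteMeasurableSpace M]
    (𝓜 : SlamModel ns nx nz I M)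
    (z : Fin J → Vec nz) (hz : Function.Injective z)
    (hZ : ∫ s, 𝓜.postUnnorm (measSet z) s ≠ 0) :
    -- the likelihoods of the association classes in closed form
    (∀ (W : Finset (Vec nz)) (s : Vec ns),
      𝓜.qU W s = Real.exp (-∫ y, 𝓜.psi y s) * ∏ y ∈ W, 𝓜.psi y s ∧
      ∀ i, 𝓜.qB i W s = 𝓜.q i W s) ∧
    -- the constants are their averages under the predicted vehicle density
    (∀ y, ∫ s, 𝓜.fp s * 𝓜.psi y s = 𝓜.nu y) ∧
    (∀ i W, ∫ s, 𝓜.fp s * 𝓜.q i W s = 𝓜.nuB i W) ∧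
    -- the exact posterior is the mixture with the exact normalisation constants as weights
    IsDensity volume (𝓜.posterior (measSet z)) ∧
    (∀ᵐ s, 𝓜.posterior (measSet z) s =
      (∑ A ∈ decomps (Option (Fin I)) (measSet z), 𝓜.normConst A * 𝓜.cond A s) /
        ∑ A ∈ decomps (Option (Fin I)) (measSet z), 𝓜.normConst A) ∧
    (∀ A ∈ decomps (Option (Fin I)) (measSet z), 𝓜.normConst A ≠ 0 →
      IsDensity volume (𝓜.cond A) ∧ 0 < 𝓜.weight A) ∧
    -- up to a factor common to all associations, the product weights are the values of the
    -- labelled PMB density that is closest to the one given by the exact constants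
    (∃ (ρ : Fin I → ℝ) (h : Fin I → Vec nz → ℝ),
      IsIntensity volume 𝓜.nu ∧ (∀ i, ρ i ∈ Set.Icc (0 : ℝ) 1) ∧
      (∀ i, IsDensity volume (h i)) ∧
      (∀ A : Option (Fin I) → Finset (Vec nz),
        labelledPMB volume 𝓜.nu ρ h A = Real.exp (-∫ y, 𝓜.nu y) * 𝓜.weight A) ∧
      IsProbabilityMeasure (labelledLaw volume 𝓜.normConst) ∧
      IsProbabilityMeasure (labelledLaw volume (labelledPMB volume 𝓜.nu ρ h)) ∧
      ∀ (κ : Vec nz → ℝ) (ρ' : Fin I → ℝ) (h' : Fin I → Vec nz → ℝ),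
        IsIntensity volume κ → (∀ i, ρ' i ∈ Set.Icc (0 : ℝ) 1) →
        (∀ i, IsDensity volume (h' i)) →
        InformationTheory.klDiv (labelledLaw volume 𝓜.normConst)
            (labelledLaw volume (labelledPMB volume 𝓜.nu ρ h)) ≤
          InformationTheory.klDiv (labelledLaw volume 𝓜.normConst)
            (labelledLaw volume (labelledPMB volume κ ρ' h'))) ∧
    -- first form: the mixture with product weights, and its distance to the posterior
    0 < ∑ A ∈ decomps (Option (Fin I)) (measSet z), 𝓜.weight A ∧
    ((∀ A ∈ decomps (Option (Fin I)) (measSet z), 𝓜.weight A ≠ 0 → 𝓜.normConst A ≠ 0) →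
      IsDensity volume (𝓜.mixture (measSet z))) ∧
    (∫ s, |𝓜.posterior (measSet z) s - 𝓜.mixture (measSet z) s| ≤
      ∑ A ∈ decomps (Option (Fin I)) (measSet z),
        |𝓜.normConst A / (∑ B ∈ decomps (Option (Fin I)) (measSet z), 𝓜.normConst B) -
          𝓜.weight A / (∑ B ∈ decomps (Option (Fin I)) (measSet z), 𝓜.weight B)|) ∧
    (∀ K ε : ℝ, 0 < K → ε < 1 →
      (∀ A ∈ decomps (Option (Fin I)) (measSet z),
        |𝓜.normConst A - K * 𝓜.weight A| ≤ ε * (K * 𝓜.weight A)) →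
      ∫ s, |𝓜.posterior (measSet z) s - 𝓜.mixture (measSet z) s| ≤ 2 * ε / (1 - ε)) ∧
    -- the first form as a sum over the global hypotheses
    Set.BijOn (assoc z) (globalHyps I J : Set (Hyp I J))
      {A | A ∈ decomps (Option (Fin I)) (measSet z) ∧ ∀ i, (A (some i)).card ≤ 1} ∧
    (∀ A ∈ decomps (Option (Fin I)) (measSet z), (∃ i, 1 < (A (some i)).card) →
      𝓜.weight A = 0) ∧
    (∀ a ∈ globalHyps I J, 0 ≤ 𝓜.hypProb z a) ∧
    ∑ a ∈ globalHyps I J, 𝓜.hypProb z a = 1 ∧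
    (∀ s, 𝓜.mixture (measSet z) s =
      ∑ a ∈ globalHyps I J, 𝓜.hypProb z a * 𝓜.cond (assoc z a) s) ∧
    -- second form: ratios; exact relation to the posterior
    (∀ᵐ s, 𝓜.posterior (measSet z) s =
      Real.exp (-∫ y, 𝓜.psi y s) * 𝓜.hypMixture z s /
        ∫ s', Real.exp (-∫ y, 𝓜.psi y s') * 𝓜.hypMixture z s') ∧
    -- second form: accuracy when the factorisation of the normalisation constants is accurate
    -- and the expected number of measurements outside the Bernoulli components depends little
    -- on the vehicle state
    (∀ T δ ε : ℝ, ε < 1 →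
      (∀ᵐ s, 𝓜.fp s ≠ 0 → |(∫ y, 𝓜.psi y s) - T| ≤ δ) →
      (∀ a ∈ globalHyps I J,
        |(∫ s, 𝓜.Phi (assoc z a) s) - 𝓜.hypWeight z a| ≤ ε * 𝓜.hypWeight z a) →
      ∀ᵐ s,
        (Real.exp (-(2 * δ)) / (1 + ε) * 𝓜.hypMixture z s ≤ 𝓜.posterior (measSet z) s ∧
          𝓜.posterior (measSet z) s ≤ Real.exp (2 * δ) / (1 - ε) * 𝓜.hypMixture z s) ∧
        (Real.exp (-(2 * δ)) / (1 + ε) * 𝓜.hypMixture z s ≤ 𝓜.mixture (measSet z) s ∧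
          𝓜.mixture (measSet z) s ≤ Real.exp (2 * δ) / (1 - ε) * 𝓜.hypMixture z s)) := by
  have : NeZero nx := ⟨hnx.ne'⟩
  have : NeZero nz := ⟨hnz.ne'⟩
  obtain ⟨ρ, h, hρ, hh, hB⟩ := 𝓜.exists_bernoulli_eq_nuB
  refine ⟨fun W s => ⟨𝓜.qU_eq W s, fun i => 𝓜.qB_eq i W s⟩, 𝓜.integral_fp_psi, 𝓜.integral_fp_q,
    𝓜.isDensity_posterior hZ, 𝓜.posterior_ae_eq _,
    fun A _ hA => ⟨𝓜.isDensity_cond hA, 𝓜.weight_pos hA⟩,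
    ⟨ρ, h, 𝓜.nu_intensity, hρ, hh, 𝓜.labelledPMB_eq_weight hB,
      𝓜.isProbabilityMeasure_labelledLaw_normConst,
      isProbabilityMeasure_labelledLaw_labelledPMB 𝓜.nu_intensity hρ hh,
      fun κ ρ' h' hκ hρ' hh' => 𝓜.klDiv_labelledLaw_le hρ hh hB hκ hρ' hh'⟩,
    𝓜.sum_weight_pos hZ, 𝓜.isDensity_mixture hZ, 𝓜.integral_abs_posterior_sub_mixture_le _, ?_,
    bijOn_assoc hz, fun A _ hA => 𝓜.weight_eq_zero hA, fun a _ => 𝓜.hypProb_nonneg hz a,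
    𝓜.sum_hypProb hz hZ, 𝓜.mixture_eq hz, 𝓜.posterior_ae_eq_hypMixture hz hZ,
    fun T δ ε hε hT hW => 𝓜.posterior_mixture_bounds hz hZ hε hT hW⟩
  exact fun K ε hK hε hA => (𝓜.integral_abs_posterior_sub_mixture_le _).trans
    (sum_abs_normalised_sub_le _ (fun A _ => 𝓜.weight_nonneg A) (𝓜.sum_weight_pos hZ) hK hε hA)
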